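/- Let $V_0,\kappa>0$ and $\alpha\in(0,\pi/2)$. For $a<b$ let $w_{a,b}$ denote the minimizer of $\mathcal F(v)=\int_{\mathbb R}\tfrac12|v_x|^2+\tfrac{v^2}{2}\kappa\cos\alpha-v\,x\,\kappa\sin\alpha\,dx$ among $v\in H^1_0(a,b)$ with $v\ge 0$ and $\int v\,dx=V_0$. Given a Lipschitz function $\beta:\mathbb R\to\mathbb R$, a solution on a time set $J$ is a function $u(x,t)$ for which there are Lipschitz functions $a,b:J\to\mathbb R$ such that, for all $t\in J$, $\{u(\cdot,t)>0\}=(a(t),b(t))$ and $u(\cdot,t)=w_{a(t),b(t)}$, and for a.e. $t\in J$ $$\min\{a'(t)+\tfrac12|u_x(a(t),t)|^2-\beta(a(t)),\,|u_x(a(t),t)|\}=0,\qquad \min\{-b'(t)+\tfrac12|u_x(b(t),t)|^2-\beta(b(t)),\,|u_x(b(t),t)|\}=0,$$ where $u_x$ at the endpoints is the one-sided derivative from inside the support. "Solution" without further mention means $J=[0,\infty)$, with any initial data. A pulsating traveling solution is a solution on $J=\mathbb R$ such that, for some $T\in\mathbb R$, $u(x,t+T)=u(x-L,t)$ for all $x,t$,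 where $L$ is the period of $\beta$. **Theorem 2.5.** (i) Let $\beta$ be Lipschitz and periodic with period $L>0$, with $\max\beta-\min\beta<V_0\kappa\sin\alpha$. Then there is a pulsating traveling solution $U$, with support $(A(t),B(t))$ and some $T>0$, and it is unique up to translation in time: every pulsating traveling solution is $U(\cdot,\cdot+\tau)$ for some $\tau\in\mathbb R$. Moreover, for every solution $u$ with support $(a(t),b(t))$ there is $t_0$ such that $b$ is differentiable with $b'(t)>0$ for all $t\ge t_0$, and there is $\tau\in\mathbb R$ such that, as $t\to\infty$, $\sup_x|u(x,t)-U(x,t+\tau)|\to0$, $a(t)-A(t+\tau)\to0$ and $b(t)-B(t+\tau)\to0$. (ii) Let $M,m$ be real numbers with $m\ge0$ and $M-m>V_0\kappa\sin\alpha$. Then there are $\delta>0$ and $C$ (depending only on $V_0,\kappa,\alpha,M,m$) such that, for every Lipschitz $\beta$ with $\max\beta=M$ and $\min\beta=m$ that is periodic with period $L\in(0,\delta)$, every solution sticks to the inclined plane: $|a(t)-a(0)|\le C$ and $|b(t)-b(0)|\le C$ for all $t\ge0$. -/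

import Mathlib

open Set Filter MeasureTheory Topology

namespace SlidingDrop

/-- `v ∈ H¹₀(a, b)`, in one space dimension: `v` (its continuous representative, extended by zero
to `ℝ`) vanishes outside `(a, b)`, is absolutely continuous on `[a, b]`, and its derivative (which
exists almost everywhere and is the weak derivative) is square integrable on `(a, b)`. -/
structure MemH10 (a b : ℝ) (v : ℝ → ℝ) : Prop where
  eq_zero : ∀ x, x ∉ Ioo a b → v x = 0
  abs_cont : AbsolutelyContinuousOnInterval v a b
  deriv_sq_int : MemLp (deriv v) 2 (volume.restrict (Ioo a b))

/-- The energy `∫ ½ |v_x|² + ½ v² κ cos α - v x κ sin α dx`. -/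
noncomputable def energy (κ α : ℝ) (v : ℝ → ℝ) : ℝ :=
  ∫ x, (1 / 2 * (deriv v x) ^ 2 + (v x) ^ 2 / 2 * (κ * Real.cos α) - v x * x * (κ * Real.sin α))

/-- The admissible profiles: `v ∈ H¹₀(a, b)`, `v ≥ 0`, `∫ v = V₀`. -/
def Admissible (V₀ a b : ℝ) (v : ℝ → ℝ) : Prop :=
  MemH10 a b v ∧ (∀ x, 0 ≤ v x) ∧ ∫ x in a..b, v x = V₀

/-- `w` is the minimizer of the energy among the admissible profiles. -/
def IsArgmin (V₀ κ α a b : ℝ) (w : ℝ → ℝ) : Prop :=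
  Admissible V₀ a b w ∧ ∀ v, Admissible V₀ a b v → energy κ α w ≤ energy κ α v

/-- The slope `u_x(a)` of a profile at the left end of its support (derivative from inside). -/
noncomputable def slopeLeft (w : ℝ → ℝ) (a : ℝ) : ℝ := derivWithin w (Ici a) a

/-- The slope `u_x(b)` of a profile at the right end of its support (derivative from inside). -/
noncomputable def slopeRight (w : ℝ → ℝ) (b : ℝ) : ℝ := derivWithin w (Iic b) b

/-- Solution of the sliding drop problem on the time set `J` (used with `J = [0, ∞)` and `J = ℝ`):
`u t x` is the height of the drop at time `t` and position `x`, and `(a t, b t)` its support. -/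
structure IsSolutionOn (J : Set ℝ) (V₀ κ α : ℝ) (β : ℝ → ℝ)
    (u : ℝ → ℝ → ℝ) (a b : ℝ → ℝ) : Prop where
  lip_left : ∃ K, LipschitzOnWith K a J
  lip_right : ∃ K, LipschitzOnWith K b J
  support_eq : ∀ t ∈ J, {x | 0 < u t x} = Ioo (a t) (b t)
  argmin : ∀ t ∈ J, IsArgmin V₀ κ α (a t) (b t) (u t)
  law_left : ∀ᵐ t ∂(volume.restrict J),
    min (deriv a t + 1 / 2 * |slopeLeft (u t) (a t)| ^ 2 - β (a t)) |slopeLeft (u t) (a t)| = 0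
  law_right : ∀ᵐ t ∂(volume.restrict J),
    min (-deriv b t + 1 / 2 * |slopeRight (u t) (b t)| ^ 2 - β (b t)) |slopeRight (u t) (b t)| = 0

/-- Solution for `t ≥ 0`, with arbitrary admissible initial data `u 0`. -/
def IsSolution (V₀ κ α : ℝ) (β : ℝ → ℝ) (u : ℝ → ℝ → ℝ) (a b : ℝ → ℝ) : Prop :=
  IsSolutionOn (Ici 0) V₀ κ α β u a b

/-- Pulsating traveling solution with time period `T` and space period `L`: a solution for all
`t ∈ ℝ` such that `u(x, t + T) = u(x - L, t)`. -/
def IsPulsating (V₀ κ α : ℝ) (β : ℝ → ℝ) (L T : ℝ) (u : ℝ → ℝ → ℝ) (a b : ℝ → ℝ) : Prop :=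
  IsSolutionOn univ V₀ κ α β u a b ∧ ∀ t x, u (t + T) x = u t (x - L)

end SlidingDrop

/-!
A sliding drop is governed by the two end points `a < b` of its support, and the theorem is a
statement about the system of ordinary differential equations that they obey.

**Reduction.** The energy is strictly convex, so a solution of the Euler–Lagrange equation is the
minimizer as soon as the first variation is nonnegative in every admissible direction
(`isArgmin_of_euler_lagrange`). The explicit solution on `(a, b)` has a symmetric and an
antisymmetric part; with `D = b - a`, their end slopes `p(D)` and `q(D)` give `u_x(a) = p - q` and
`u_x(b) = -(p + q)`, where `p` decreases, `q` increases and `2 p q = V₀ κ sin α =: S`. Beyond the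
width `Dm` at which `p = q`, the minimizer no longer fills the interval, because it detaches at the
left. A drop whose support is `(a, b)` therefore has `D ≤ Dm`, and with `F = (p - q)² / 2` its law
of motion is `b' = F(D) + S - β(b)`, and `a' = β(a) - F(D)` while `D < Dm`, with `a'` allowed to be
larger when `D = Dm`: a differential equation reflected below the obstacle `D = Dm` (`IsMotion`,
`IsSolutionOn.isMotion`, `IsMotion.isSolutionOn`). Only the strict monotonicity of `F` on
`(0, Dm]`, its local Lipschitz continuity, its blow-up at `0` and `F(Dm) = 0` are used (`IsForce`).

**Comparison.** Motions are ordered: if `a₁ ≤ a₂` and `b₁ ≤ b₂` at one time, then also at all later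
times (`IsMotion.comparison`). Measured by the phases of its two end points relative to a pulsating
motion, every motion thus has a smaller phase that is nondecreasing and a larger one that is
nonincreasing. Strict monotonicity of `F` forces the two to merge, which gives attraction
(`IsMotion.exists_phase`) and uniqueness (`IsMotion.eq_translate_of_pulsating`).

**Existence.** If `max β - min β < S`, the centre `c = (a + b) / 2` would move with a speed at least
`(S - (max β - min β)) / 2`, so the orbit is sought as a periodic width `D(c)`. It is found as the
smallest solution of a reflected scalar equation that comes down from the obstacle
(`exists_periodic_reflected`, `exists_periodic_width`). Both end points advance along this orbit
(`pos_of_drift`), so that it can be run through with the speed that the law prescribes at the front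
(`exists_pulsatingMotion`).

**Sticking.** If `max β - min β > S`, there are widths `D₂ < D₁` with
`min β < F(D₁) < F(D₂) < max β - S`. In each period of `β` there is a point that the rear cannot
pass forwards and the front cannot pass backwards while `D ≤ D₁`, and a point that the rear cannot
pass backwards and the front cannot pass forwards while `D ≥ D₂`. For a small period, the end
points are caught as soon as `D = (D₁ + D₂) / 2` (`exists_sticking_bound`).
-/

namespace SlidingDrop

/-! ### Real-analysis tools: absolutely continuous functions and one-sided barriers -/

theorem exists_last_le {f : ℝ → ℝ} {s t c : ℝ} (hst : s ≤ t) (hf : ContinuousOn f (Icc s t))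
    (hs : f s ≤ c) (ht : c < f t) :
    ∃ r ∈ Ico s t, f r = c ∧ ∀ x ∈ Ioc r t, c < f x := by
  have hcl : IsCompact (Icc s t ∩ f ⁻¹' Iic c) :=
    isCompact_Icc.of_isClosed_subset (hf.preimage_isClosed_of_isClosed isClosed_Icc isClosed_Iic)
      inter_subset_left
  obtain ⟨r, ⟨hr, hrc⟩, hmax⟩ := hcl.exists_isGreatest ⟨s, ⟨left_mem_Icc.2 hst, hs⟩⟩
  have hrt : r < t := by
    rcases hr.2.lt_or_eq with h | h
    · exact h
    · subst h; exact absurd hrc (not_le.2 ht)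
  have hgt : ∀ x ∈ Ioc r t, c < f x := fun x hx => by
    by_contra h
    exact absurd (hmax ⟨⟨hr.1.trans hx.1.le, hx.2⟩, not_lt.1 h⟩) (not_le.2 hx.1)
  refine ⟨r, ⟨hr.1, hrt⟩, ?_, hgt⟩
  by_contra hne
  have hlt : f r < c := lt_of_le_of_ne hrc hne
  obtain ⟨x, hx, hxc⟩ := intermediate_value_Icc hrt.le
    (hf.mono (Icc_subset_Icc_left hr.1)) ⟨hlt.le, ht.le⟩
  rcases hx.1.lt_or_eq with h | h
  · exact absurd hxc (hgt x ⟨h, hx.2⟩).ne'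
  · subst h; exact hne hxc

theorem exists_first_le {f : ℝ → ℝ} {s t c : ℝ} (hst : s ≤ t) (hf : ContinuousOn f (Icc s t))
    (hs : c < f s) (ht : f t ≤ c) :
    ∃ r ∈ Ioc s t, f r = c ∧ ∀ x ∈ Ico s r, c < f x := by
  have hg : ContinuousOn (fun x => f (-x)) (Icc (-t) (-s)) :=
    hf.comp continuousOn_neg fun x hx => ⟨by linarith [hx.2], by linarith [hx.1]⟩
  obtain ⟨r, hr, hrc, hlt⟩ := exists_last_le (c := c) (by linarith) hg (by simpa using ht)
    (by simpa using hs)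
  refine ⟨-r, ⟨by linarith [hr.2], by linarith [hr.1]⟩, hrc, fun x hx => ?_⟩
  simpa using hlt (-x) ⟨by linarith [hx.2], by linarith [hx.1]⟩

theorem le_of_ae_deriv_nonpos {f : ℝ → ℝ} {s t : ℝ} (hst : s ≤ t)
    (hf : AbsolutelyContinuousOnInterval f s t)
    (h : ∀ᵐ x, x ∈ Ioo s t → DifferentiableAt ℝ f x → deriv f x ≤ 0) : f t ≤ f s := by
  have h1 := hf.integral_deriv_eq_sub
  have h2 : 0 ≤ ∫ x in s..t, -deriv f x := by
    apply intervalIntegral.integral_nonneg_of_ae_restrict hst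
    rw [EventuallyLE, ae_restrict_iff' measurableSet_Icc]
    filter_upwards [h, hf.ae_differentiableAt, (measure_singleton s).le.antisymm bot_le |> compl_mem_ae_iff.2,
      (measure_singleton t).le.antisymm bot_le |> compl_mem_ae_iff.2] with x h3 h4 hs ht hx
    have : x ∈ Ioo s t := ⟨lt_of_le_of_ne hx.1 (Ne.symm hs), lt_of_le_of_ne hx.2 ht⟩
    have := h3 this (h4 (by rwa [uIcc_of_le hst]))
    simpa using this
  rw [intervalIntegral.integral_neg] at h2
  linarith

theorem sub_le_mul_of_ae_deriv_le {f : ℝ → ℝ} {s t c : ℝ} (hst : s ≤ t)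
    (hf : AbsolutelyContinuousOnInterval f s t)
    (h : ∀ᵐ x, x ∈ Ioo s t → DifferentiableAt ℝ f x → deriv f x ≤ c) :
    f t - f s ≤ c * (t - s) := by
  have hid : AbsolutelyContinuousOnInterval (fun x : ℝ => c * x) s t :=
    (by fun_prop : ContDiff ℝ 1 fun x : ℝ => c * x).contDiffOn.absolutelyContinuousOnInterval
  have := le_of_ae_deriv_nonpos (f := fun x => f x - c * x) hst (hf.fun_sub hid) ?_
  · linarith
  filter_upwards [h] with x hx hxm hd
  have hdf : DifferentiableAt ℝ f x := by
    simpa using hd.fun_add (by fun_prop : DifferentiableAt ℝ (fun x => c * x) x)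
  have h1 : HasDerivAt (fun x => f x - c * x) (deriv f x - c * 1) x :=
    hdf.hasDerivAt.sub ((hasDerivAt_id x).const_mul c)
  rw [h1.deriv]
  linarith [hx hxm hdf]

theorem mul_le_sub_of_ae_le_deriv {f : ℝ → ℝ} {s t c : ℝ} (hst : s ≤ t)
    (hf : AbsolutelyContinuousOnInterval f s t)
    (h : ∀ᵐ x, x ∈ Ioo s t → DifferentiableAt ℝ f x → c ≤ deriv f x) :
    c * (t - s) ≤ f t - f s := by
  have := sub_le_mul_of_ae_deriv_le (f := fun x => -f x) (c := -c) hst hf.fun_neg ?_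
  · linarith
  filter_upwards [h] with x hx hxm hd
  have hdf : DifferentiableAt ℝ f x := by simpa using hd.neg
  rw [deriv.fun_neg]
  linarith [hx hxm hdf]

/-- Grönwall's inequality for absolutely continuous functions, in the form of a sign
condition: only the points where the function is positive matter. -/
theorem nonpos_of_ae_deriv_le_mul {z : ℝ → ℝ} {s t K : ℝ} (hst : s ≤ t)
    (hz : AbsolutelyContinuousOnInterval z s t) (hs : z s ≤ 0)
    (h : ∀ᵐ x, x ∈ Ioo s t → DifferentiableAt ℝ z x → 0 < z x → deriv z x ≤ K * z x) :
    z t ≤ 0 := by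
  by_contra! hpos
  have hcont := hz.continuousOn
  rw [uIcc_of_le hst] at hcont
  obtain ⟨r, hr, hr0, hrpos⟩ := exists_last_le hst hcont hs hpos
  have hexp : AbsolutelyContinuousOnInterval (fun x : ℝ => Real.exp (-K * x)) r t :=
    (by fun_prop : ContDiff ℝ 1 fun x : ℝ => Real.exp (-K * x)).contDiffOn
      |>.absolutelyContinuousOnInterval
  have hzr : AbsolutelyContinuousOnInterval z r t := hz.mono (by
    rw [uIcc_of_le hst, uIcc_of_le hr.2.le]; exact Icc_subset_Icc_left hr.1)
  have := le_of_ae_deriv_nonpos (f := fun x => z x * Real.exp (-K * x)) hr.2.le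
    (hzr.fun_mul hexp) ?_
  · simp only [hr0, zero_mul] at this
    exact absurd this (not_le.2 (mul_pos hpos (Real.exp_pos _)))
  filter_upwards [h, hzr.ae_differentiableAt] with x hx hd hxm _
  have hdz := hd (by rw [uIcc_of_le hr.2.le]; exact Ioo_subset_Icc_self hxm)
  have h1 : HasDerivAt (fun x : ℝ => Real.exp (-K * x)) (Real.exp (-K * x) * (-K * 1)) x :=
    ((hasDerivAt_id x).const_mul (-K)).exp
  rw [(hdz.hasDerivAt.fun_mul h1).deriv]
  have h2 := hx ⟨hr.1.trans_lt hxm.1, hxm.2⟩ hdz (hrpos x ⟨hxm.1, hxm.2.le⟩)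
  have := Real.exp_pos (-K * x)
  nlinarith

/-- A function that cannot decrease while it is slightly below the level `c` does not cross
this level downwards. -/
theorem le_of_barrier {f : ℝ → ℝ} {s t c η : ℝ} (hη : 0 < η) (hst : s ≤ t)
    (hf : AbsolutelyContinuousOnInterval f s t) (hs : c ≤ f s)
    (h : ∀ᵐ x, x ∈ Ioo s t → DifferentiableAt ℝ f x → c - η < f x → f x < c → 0 ≤ deriv f x) :
    c ≤ f t := by
  by_contra! hlt
  have hcont := hf.continuousOn
  rw [uIcc_of_le hst] at hcont
  obtain ⟨r, hr, hrc, hrlt⟩ := exists_last_le (f := fun x => -f x) (c := -c) hst hcont.neg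
    (by linarith) (by linarith)
  simp only [neg_inj, neg_lt_neg_iff] at hrc hrlt
  obtain ⟨y, hy1, hy2⟩ : ∃ y, max (f t) (c - η) < y ∧ y < c :=
    exists_between (max_lt hlt (by linarith))
  obtain ⟨q, hq, hqy, hqlt⟩ := exists_first_le hr.2.le (hcont.mono (Icc_subset_Icc_left hr.1))
    (hy2.trans_eq hrc.symm) ((le_max_left _ _).trans hy1.le)
  have := mul_le_sub_of_ae_le_deriv (f := f) (c := 0) hq.1.le (hf.mono (by
    rw [uIcc_of_le hst, uIcc_of_le hq.1.le]; exact Icc_subset_Icc hr.1 hq.2)) ?_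
  · linarith
  filter_upwards [h] with x hx hxm hd
  refine hx ⟨hr.1.trans_lt hxm.1, hxm.2.trans_le hq.2⟩ hd ?_ (hrlt x ⟨hxm.1, hxm.2.le.trans hq.2⟩)
  exact ((le_max_right _ _).trans_lt hy1).trans (hqlt x ⟨hxm.1.le, hxm.2⟩)

theorem ge_of_barrier {f : ℝ → ℝ} {s t c η : ℝ} (hη : 0 < η) (hst : s ≤ t)
    (hf : AbsolutelyContinuousOnInterval f s t) (hs : f s ≤ c)
    (h : ∀ᵐ x, x ∈ Ioo s t → DifferentiableAt ℝ f x → c < f x → f x < c + η → deriv f x ≤ 0) :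
    f t ≤ c := by
  have := le_of_barrier (f := fun x => -f x) (c := -c) hη hst hf.fun_neg (by linarith) ?_
  · linarith
  filter_upwards [h] with x hx hxm hd h1 h2
  have hdf : DifferentiableAt ℝ f x := by simpa using hd.neg
  rw [deriv.fun_neg]
  linarith [hx hxm hdf (by linarith) (by linarith)]

/-- A quantity cannot reach its value at `c` with a positive speed that is bounded by a multiple
of the distance still to go. -/
theorem no_arrival {y ρ : ℝ → ℝ} {l c K : ℝ} (hlc : l < c) (hy : ContinuousOn y (Icc l c))
    (hd : ∀ x ∈ Ioo l c, HasDerivAt y (ρ x) x) (hpos : ∀ x ∈ Ioo l c, 0 < ρ x)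
    (hle : ∀ x ∈ Ioo l c, ρ x ≤ K * |y c - y x|) : False := by
  have hstrict : StrictMonoOn y (Icc l c) := by
    refine strictMonoOn_of_deriv_pos (convex_Icc l c) hy fun x hx => ?_
    rw [interior_Icc] at hx
    rw [(hd x hx).deriv]; exact hpos x hx
  have hlt : ∀ x ∈ Ico l c, y x < y c := fun x hx =>
    hstrict (Ico_subset_Icc_self hx) (right_mem_Icc.2 hlc.le) hx.2
  have hmono : MonotoneOn (fun x => (y c - y x) * Real.exp (K * x)) (Icc l c) := by
    have hder : ∀ x ∈ Ioo l c, HasDerivAt (fun x => (y c - y x) * Real.exp (K * x))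
        (-ρ x * Real.exp (K * x) + (y c - y x) * (Real.exp (K * x) * (K * 1))) x := fun x hx =>
      ((hd x hx).const_sub (y c)).mul ((hasDerivAt_id x).const_mul K).exp
    refine monotoneOn_of_deriv_nonneg (convex_Icc l c) (by fun_prop) ?_ ?_
    · rw [interior_Icc]
      exact fun x hx => (hder x hx).differentiableAt.differentiableWithinAt
    · rw [interior_Icc]
      intro x hx
      rw [(hder x hx).deriv]
      have h1 := hle x hx
      rw [abs_of_pos (sub_pos.2 (hlt x ⟨hx.1.le, hx.2⟩))] at h1
      have := Real.exp_pos (K * x)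
      nlinarith
  have := hmono (left_mem_Icc.2 hlc.le) (right_mem_Icc.2 hlc.le) hlc.le
  simp only [sub_self, zero_mul] at this
  have h2 := mul_pos (sub_pos.2 (hlt l ⟨le_rfl, hlc⟩)) (Real.exp_pos (K * l))
  linarith

theorem absCont_of_lipschitzOnWith {f : ℝ → ℝ} {K : NNReal} {J : Set ℝ}
    {s t : ℝ} (hf : LipschitzOnWith K f J) (hst : s ≤ t) (hJ : Icc s t ⊆ J) :
    AbsolutelyContinuousOnInterval f s t :=
  LipschitzOnWith.absolutelyContinuousOnInterval (K := K) (by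
    rw [uIcc_of_le hst]; exact hf.mono hJ)

section Motion

/-! ### The reduced motion of the two contact points -/

/-- The properties of the force `F` at the rear contact point, as a function of the width
`D ∈ (0, Dm]` of the drop, that govern its motion; `Dm` is the largest possible width. -/
structure IsForce (F : ℝ → ℝ) (Dm : ℝ) : Prop where
  width_pos : 0 < Dm
  anti : StrictAntiOn F (Ioc 0 Dm)
  eq_zero : F Dm = 0
  blowup : ∀ R, ∃ ε ∈ Ioo 0 Dm, R < F ε
  lip : ∀ ε ∈ Ioo 0 Dm, ∃ K, LipschitzOnWith K F (Icc ε Dm)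

/-- The system of ordinary differential equations for the end points `a < b` of the support of a
drop. The front point obeys `b' = F (b - a) + S - β b`. The rear point obeys
`a' = β a - F (b - a)` as long as the width is less than `Dm`, and is pushed forwards (reflected)
when the width is `Dm`. -/
structure IsMotion (J : Set ℝ) (F : ℝ → ℝ) (S Dm : ℝ) (β a b : ℝ → ℝ) : Prop where
  lip_left : ∃ K, LipschitzOnWith K a J
  lip_right : ∃ K, LipschitzOnWith K b J
  lt : ∀ t ∈ J, a t < b t
  width_le : ∀ t ∈ J, b t - a t ≤ Dm
  law_right : ∀ᵐ t, t ∈ J → deriv b t = F (b t - a t) + S - β (b t)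
  le_law_left : ∀ᵐ t, t ∈ J → β (a t) - F (b t - a t) ≤ deriv a t
  law_left : ∀ᵐ t, t ∈ J → b t - a t < Dm → deriv a t = β (a t) - F (b t - a t)

variable {J J' : Set ℝ} {F β a b a₁ b₁ a₂ b₂ : ℝ → ℝ} {S Dm L s t : ℝ}

namespace IsForce

theorem antitoneOn (hF : IsForce F Dm) : AntitoneOn F (Ioc 0 Dm) := hF.anti.antitoneOn

theorem continuousOn (hF : IsForce F Dm) : ContinuousOn F (Ioc 0 Dm) := fun x hx => by
  have hpos := hF.width_pos
  have hmin : min (x / 2) (Dm / 2) ∈ Ioo 0 Dm :=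
    ⟨lt_min (by linarith [hx.1]) (by linarith), (min_le_right _ _).trans_lt (by linarith)⟩
  obtain ⟨K, hK⟩ := hF.lip _ hmin
  have hlt : min (x / 2) (Dm / 2) < x := (min_le_left _ _).trans_lt (by linarith [hx.1])
  refine (hK.continuousOn x ⟨hlt.le, hx.2⟩).mono_of_mem_nhdsWithin ?_
  filter_upwards [self_mem_nhdsWithin, mem_nhdsWithin_of_mem_nhds (Ioi_mem_nhds hlt)] with y hy hy'
  exact ⟨le_of_lt hy', hy.2⟩

/-- Every value in `(0, ∞)` is attained by the force. -/
theorem exists_eq (hF : IsForce F Dm) {R : ℝ} (hR : 0 < R) : ∃ D ∈ Ioo 0 Dm, F D = R := by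
  obtain ⟨ε, hε, hR'⟩ := hF.blowup R
  obtain ⟨D, hD, h⟩ := intermediate_value_Icc' hε.2.le
    (hF.continuousOn.mono fun x hx => ⟨hε.1.trans_le hx.1, hx.2⟩)
    (show R ∈ Icc (F Dm) (F ε) from ⟨hF.eq_zero.trans_le hR.le, hR'.le⟩)
  refine ⟨D, ⟨hε.1.trans_le hD.1, lt_of_le_of_ne hD.2 ?_⟩, h⟩
  rintro rfl
  linarith [hF.eq_zero]

/-- The force drops by a uniform amount when the width grows by `e`, away from width zero. -/
theorem exists_drop (hF : IsForce F Dm) {ε e : ℝ} (hε : 0 < ε) (hεD : ε ≤ Dm) (he : 0 < e) :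
    ∃ c > 0, ∀ x y, 0 < x → ε ≤ y → y ≤ Dm → x ≤ y - e → F y + c ≤ F x := by
  set e' := min e (ε / 2)
  have he' : 0 < e' := lt_min he (by linarith)
  have he2 : e' ≤ ε / 2 := min_le_right _ _
  have hcont : ContinuousOn (fun y => F (y - e') - F y) (Icc ε Dm) := by
    refine ContinuousOn.sub (hF.continuousOn.comp (by fun_prop) fun y hy => ?_)
      (hF.continuousOn.mono fun y hy => ⟨hε.trans_le hy.1, hy.2⟩)
    exact ⟨by linarith [hy.1], by linarith [hy.2]⟩
  obtain ⟨y₀, hy₀, hmin⟩ := isCompact_Icc.exists_isMinOn (nonempty_Icc.2 hεD) hcont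
  refine ⟨F (y₀ - e') - F y₀, ?_, fun x y hx hy hyD hxy => ?_⟩
  · exact sub_pos.2 (hF.anti ⟨by linarith [hy₀.1], by linarith [hy₀.2]⟩
      ⟨hε.trans_le hy₀.1, hy₀.2⟩ (by linarith))
  · have h1 : F (y₀ - e') - F y₀ ≤ F (y - e') - F y := hmin (show y ∈ Icc ε Dm from ⟨hy, hyD⟩)
    have h2 : F (y - e') ≤ F x := hF.antitoneOn ⟨hx, by linarith⟩ ⟨by linarith, by linarith⟩
      (by linarith [min_le_left e (ε / 2)])
    linarith

end IsForce

namespace IsMotion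

theorem mono (h : IsMotion J F S Dm β a b) (hJ : J' ⊆ J) : IsMotion J' F S Dm β a b where
  lip_left := h.lip_left.imp fun _ hK => hK.mono hJ
  lip_right := h.lip_right.imp fun _ hK => hK.mono hJ
  lt t ht := h.lt t (hJ ht)
  width_le t ht := h.width_le t (hJ ht)
  law_right := h.law_right.mono fun _ hx hxJ => hx (hJ hxJ)
  le_law_left := h.le_law_left.mono fun _ hx hxJ => hx (hJ hxJ)
  law_left := h.law_left.mono fun _ hx hxJ => hx (hJ hxJ)

theorem width_mem (h : IsMotion J F S Dm β a b) (ht : t ∈ J) : b t - a t ∈ Ioc 0 Dm :=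
  ⟨sub_pos.2 (h.lt t ht), h.width_le t ht⟩

theorem continuousOn_left (h : IsMotion J F S Dm β a b) : ContinuousOn a J :=
  h.lip_left.elim fun _ hK => hK.continuousOn

theorem continuousOn_right (h : IsMotion J F S Dm β a b) : ContinuousOn b J :=
  h.lip_right.elim fun _ hK => hK.continuousOn

theorem continuousOn_width (h : IsMotion J F S Dm β a b) : ContinuousOn (fun t => b t - a t) J :=
  h.continuousOn_right.sub h.continuousOn_left

theorem absCont_left (h : IsMotion J F S Dm β a b) (hst : s ≤ t) (hJ : Icc s t ⊆ J) :
    AbsolutelyContinuousOnInterval a s t :=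
  h.lip_left.elim fun _ hK => absCont_of_lipschitzOnWith hK hst hJ

theorem absCont_right (h : IsMotion J F S Dm β a b) (hst : s ≤ t) (hJ : Icc s t ⊆ J) :
    AbsolutelyContinuousOnInterval b s t :=
  h.lip_right.elim fun _ hK => absCont_of_lipschitzOnWith hK hst hJ

theorem comp_add (h : IsMotion univ F S Dm β a b) (τ : ℝ) :
    IsMotion univ F S Dm β (fun t => a (t + τ)) (fun t => b (t + τ)) := by
  have hq : Tendsto (fun t : ℝ => t + τ) (ae volume) (ae volume) :=
    (measurePreserving_add_right volume τ).quasiMeasurePreserving.tendsto_ae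
  have hlip : ∀ f : ℝ → ℝ, (∃ K, LipschitzOnWith K f univ) →
      ∃ K, LipschitzOnWith K (fun t => f (t + τ)) univ := by
    rintro f ⟨K, hK⟩
    refine ⟨K, fun x _ y _ => ?_⟩
    simpa using hK (mem_univ (x + τ)) (mem_univ (y + τ))
  exact
  { lip_left := hlip a h.lip_left
    lip_right := hlip b h.lip_right
    lt := fun t _ => h.lt _ trivial
    width_le := fun t _ => h.width_le _ trivial
    law_right := (hq.eventually h.law_right).mono fun t ht _ => by
      rw [deriv_comp_add_const]; exact ht trivial
    le_law_left := (hq.eventually h.le_law_left).mono fun t ht _ => by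
      rw [deriv_comp_add_const]; exact ht trivial
    law_left := (hq.eventually h.law_left).mono fun t ht _ => by
      rw [deriv_comp_add_const]; exact ht trivial }

/-- The front point moves with a continuous speed, so that its law holds at all times. -/
theorem hasDerivAt_right (hF : IsForce F Dm) (hβ : Continuous β) (h : IsMotion J F S Dm β a b)
    (ht : J ∈ 𝓝 t) : HasDerivAt b (F (b t - a t) + S - β (b t)) t := by
  obtain ⟨ε, hε, hball⟩ := Metric.nhds_basis_closedBall.mem_iff.1 ht
  rw [Real.closedBall_eq_Icc] at hball
  set s := t - ε
  set r := t + ε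
  have hsr : s ≤ r := by simp only [s, r]; linarith
  set ρ : ℝ → ℝ := fun x => F (b x - a x) + S - β (b x) with hρ
  have hcont : ContinuousOn ρ (Icc s r) := by
    refine ((hF.continuousOn.comp (h.continuousOn_width.mono hball)
      fun x hx => h.width_mem (hball hx)).add continuousOn_const).sub
      (hβ.comp_continuousOn (h.continuousOn_right.mono hball))
  have heq : ∀ x ∈ Icc s r, b x = b s + ∫ y in s..x, ρ y := fun x hx => by
    have hAC := h.absCont_right hx.1 ((Icc_subset_Icc_right hx.2).trans hball)
    have h1 := hAC.integral_deriv_eq_sub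
    have h2 : ∫ y in s..x, deriv b y = ∫ y in s..x, ρ y := by
      refine intervalIntegral.integral_congr_ae ?_
      filter_upwards [h.law_right] with y hy hyI
      rw [uIoc_of_le hx.1] at hyI
      exact hy (hball ⟨hyI.1.le, hyI.2.trans hx.2⟩)
    linarith
  have hIoo : Ioo s r ∈ 𝓝 t := Ioo_mem_nhds (by simp only [s]; linarith) (by simp only [r]; linarith)
  have htI : t ∈ Ioo s r := mem_of_mem_nhds hIoo
  have hint : IntervalIntegrable ρ volume s t :=
    (hcont.mono (Icc_subset_Icc_right htI.2.le)).intervalIntegrable_of_Icc htI.1.le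
  have hder : HasDerivAt (fun x => ∫ y in s..x, ρ y) (ρ t) t := by
    refine intervalIntegral.integral_hasDerivAt_right hint ?_
      (hcont.continuousAt (Icc_mem_nhds htI.1 htI.2))
    exact (hcont.mono Ioo_subset_Icc_self).stronglyMeasurableAtFilter isOpen_Ioo t htI
  refine (hder.const_add (b s)).congr_of_eventuallyEq ?_
  filter_upwards [hIoo] with x hx
  exact heq x (Ioo_subset_Icc_self hx)

/-- **Comparison principle.** The larger of the two differences `a₁ - a₂` and `b₁ - b₂` grows at
most exponentially: where `a₁ - a₂` is larger, the first drop is the narrower one, so that it feels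
the larger force at its rear and is not being reflected; where `b₁ - b₂` is larger,
the first drop is the wider one and is driven by the smaller force at its front. -/
theorem comparison (hF : IsForce F Dm) {K : NNReal} (hβ : LipschitzWith K β)
    (h₁ : IsMotion J F S Dm β a₁ b₁) (h₂ : IsMotion J F S Dm β a₂ b₂) (hst : s ≤ t)
    (hJ : Icc s t ⊆ J) (ha : a₁ s ≤ a₂ s) (hb : b₁ s ≤ b₂ s) : a₁ t ≤ a₂ t ∧ b₁ t ≤ b₂ t := by
  set z : ℝ → ℝ := fun x => max (a₁ x - a₂ x) (b₁ x - b₂ x) with hz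
  have hβ' : ∀ x y, x ≤ y → β y - β x ≤ K * (y - x) ∧ β x - β y ≤ K * (y - x) := fun x y hxy => by
    have := hβ.dist_le_mul y x
    rw [Real.dist_eq, Real.dist_eq, abs_of_nonneg (sub_nonneg.2 hxy)] at this
    exact ⟨(le_abs_self _).trans this, by linarith [neg_abs_le (β y - β x)]⟩
  have hda := (h₁.absCont_left hst hJ).fun_sub (h₂.absCont_left hst hJ)
  have hdb := (h₁.absCont_right hst hJ).fun_sub (h₂.absCont_right hst hJ)
  have hzAC : AbsolutelyContinuousOnInterval z s t := by
    obtain ⟨K₁, h1⟩ := (h₁.mono hJ).lip_left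
    obtain ⟨K₂, h2⟩ := (h₂.mono hJ).lip_left
    obtain ⟨K₃, h3⟩ := (h₁.mono hJ).lip_right
    obtain ⟨K₄, h4⟩ := (h₂.mono hJ).lip_right
    exact absCont_of_lipschitzOnWith
      (lipschitzWith_max.comp_lipschitzOnWith ((h1.sub h2).prodMk (h3.sub h4))) hst subset_rfl
  have key : z t ≤ 0 := by
    refine nonpos_of_ae_deriv_le_mul (K := K) hst hzAC (max_le (by linarith) (by linarith)) ?_
    filter_upwards [h₁.law_left, h₂.le_law_left, h₁.law_right, h₂.law_right,
      (h₁.absCont_left hst hJ).ae_differentiableAt, (h₂.absCont_left hst hJ).ae_differentiableAt,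
      (h₁.absCont_right hst hJ).ae_differentiableAt,
      (h₂.absCont_right hst hJ).ae_differentiableAt] with x l1 l2 r1 r2 d1 d2 d3 d4 hx hzd hzpos
    have hxI : x ∈ uIcc s t := by rw [uIcc_of_le hst]; exact Ioo_subset_Icc_self hx
    have hxJ : x ∈ J := hJ (Ioo_subset_Icc_self hx)
    have dA : HasDerivAt (fun x => a₁ x - a₂ x) (deriv a₁ x - deriv a₂ x) x :=
      (d1 hxI).hasDerivAt.sub (d2 hxI).hasDerivAt
    have dB : HasDerivAt (fun x => b₁ x - b₂ x) (deriv b₁ x - deriv b₂ x) x :=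
      (d3 hxI).hasDerivAt.sub (d4 hxI).hasDerivAt
    -- if `z` touches a differentiable minorant `y` at `x`, the derivatives agree there
    have touch : ∀ {y : ℝ → ℝ} {y' : ℝ}, HasDerivAt y y' x → (∀ w, y w ≤ z w) → y x = z x →
        deriv z x = y' := fun {y y'} hy hle heq => by
      have hmin : IsLocalMin (fun w => z w - y w) x := Eventually.of_forall fun w => by
        have := hle w; simp only [heq, sub_self]; linarith
      have := hmin.hasDerivAt_eq_zero (hzd.hasDerivAt.fun_sub hy)
      linarith
    have w1 := h₁.width_mem hxJ
    have w2 := h₂.width_mem hxJ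
    rcases lt_or_ge (b₁ x - b₂ x) (a₁ x - a₂ x) with hlt | hge
    · have hzx : z x = a₁ x - a₂ x := max_eq_left hlt.le
      rw [touch dA (fun w => le_max_left _ _) hzx.symm, l1 hxJ (by linarith [w2.2]), hzx]
      have h3 : F (b₂ x - a₂ x) ≤ F (b₁ x - a₁ x) := hF.antitoneOn w1 w2 (by linarith)
      linarith [l2 hxJ, (hβ' (a₂ x) (a₁ x) (by linarith)).1]
    · have hzx : z x = b₁ x - b₂ x := max_eq_right hge
      rw [touch dB (fun w => le_max_right _ _) hzx.symm, r1 hxJ, r2 hxJ, hzx]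
      have h3 : F (b₁ x - a₁ x) ≤ F (b₂ x - a₂ x) := hF.antitoneOn w2 w1 (by linarith)
      linarith [(hβ' (b₂ x) (b₁ x) (by linarith)).2]
  exact ⟨by linarith [(le_max_left _ _).trans key], by linarith [(le_max_right _ _).trans key]⟩

end IsMotion

/-! ### Sticking -/

theorem exists_mem_Ioc_eventually_lt (hL : 0 < L) (hper : Function.Periodic β L)
    (hβ : Continuous β) {p R : ℝ} (hp : R < β p) (x : ℝ) :
    ∃ c ∈ Ioc (x - L) x, ∃ η > 0, ∀ y, |y - c| < η → R < β y := by
  obtain ⟨c, hc, hpc⟩ := hper.exists_mem_Ioc hL p (x - L)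
  rw [sub_add_cancel] at hc
  obtain ⟨η, hη, h⟩ := Metric.eventually_nhds_iff.1
    (hβ.continuousAt.eventually_const_lt (show R < β c from hpc ▸ hp))
  exact ⟨c, hc, η, hη, fun y hy => h hy⟩

theorem exists_mem_Ico_eventually_lt (hL : 0 < L) (hper : Function.Periodic β L)
    (hβ : Continuous β) {p R : ℝ} (hp : R < β p) (x : ℝ) :
    ∃ c ∈ Ico x (x + L), ∃ η > 0, ∀ y, |y - c| < η → R < β y := by
  obtain ⟨c, hc, hpc⟩ := hper.exists_mem_Ico hL p x
  obtain ⟨η, hη, h⟩ := Metric.eventually_nhds_iff.1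
    (hβ.continuousAt.eventually_const_lt (show R < β c from hpc ▸ hp))
  exact ⟨c, hc, η, hη, fun y hy => h hy⟩

namespace IsMotion

variable {p D : ℝ}

/-- While the width is at least `D`, the rear point cannot recede past a point where `β` is larger
than `F D`; there is one in each period. The next three lemmas are the analogous barriers for the
other point or the other direction. -/
theorem left_ge (hF : IsForce F Dm) (hL : 0 < L) (hper : Function.Periodic β L)
    (hβ : Continuous β) (h : IsMotion J F S Dm β a b) (hst : s ≤ t) (hJ : Icc s t ⊆ J)
    (hD : 0 < D) (hw : ∀ x ∈ Icc s t, D ≤ b x - a x) (hp : F D < β p) : a s - L ≤ a t := by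
  obtain ⟨c, hc, η, hη, hlt⟩ := exists_mem_Ioc_eventually_lt hL hper hβ hp (a s)
  refine hc.1.le.trans (le_of_barrier hη hst (h.absCont_left hst hJ) hc.2 ?_)
  filter_upwards [h.le_law_left] with x hx hxm _ h1 h2
  have hxI := Ioo_subset_Icc_self hxm
  have h3 := hw x hxI
  have h4 := hF.antitoneOn ⟨hD, h3.trans (h.width_le x (hJ hxI))⟩ (h.width_mem (hJ hxI)) h3
  linarith [hx (hJ hxI), hlt (a x) (abs_lt.2 ⟨by linarith, by linarith⟩)]

theorem right_le (hF : IsForce F Dm) (hL : 0 < L) (hper : Function.Periodic β L)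
    (hβ : Continuous β) (h : IsMotion J F S Dm β a b) (hst : s ≤ t) (hJ : Icc s t ⊆ J)
    (hD : 0 < D) (hw : ∀ x ∈ Icc s t, D ≤ b x - a x) (hp : F D + S < β p) : b t ≤ b s + L := by
  obtain ⟨c, hc, η, hη, hlt⟩ := exists_mem_Ico_eventually_lt hL hper hβ hp (b s)
  refine (ge_of_barrier hη hst (h.absCont_right hst hJ) hc.1 ?_).trans hc.2.le
  filter_upwards [h.law_right] with x hx hxm _ h1 h2
  have hxI := Ioo_subset_Icc_self hxm
  have h3 := hw x hxI
  have h4 := hF.antitoneOn ⟨hD, h3.trans (h.width_le x (hJ hxI))⟩ (h.width_mem (hJ hxI)) h3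
  linarith [hx (hJ hxI), hlt (b x) (abs_lt.2 ⟨by linarith, by linarith⟩)]

theorem left_le (hF : IsForce F Dm) (hL : 0 < L) (hper : Function.Periodic β L)
    (hβ : Continuous β) (h : IsMotion J F S Dm β a b) (hst : s ≤ t) (hJ : Icc s t ⊆ J)
    (hD : D < Dm) (hw : ∀ x ∈ Icc s t, b x - a x ≤ D) (hp : β p < F D) : a t ≤ a s + L := by
  obtain ⟨c, hc, η, hη, hlt⟩ := exists_mem_Ico_eventually_lt (β := fun x => -β x) hL
    (fun x => by simp [hper x]) hβ.neg (neg_lt_neg hp) (a s)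
  refine (ge_of_barrier hη hst (h.absCont_left hst hJ) hc.1 ?_).trans hc.2.le
  filter_upwards [h.law_left] with x hx hxm _ h1 h2
  have hxI := Ioo_subset_Icc_self hxm
  have h3 := hw x hxI
  have h5 := h.width_mem (hJ hxI)
  have h4 := hF.antitoneOn h5 ⟨h5.1.trans_le h3, hD.le⟩ h3
  linarith [hx (hJ hxI) (h3.trans_lt hD), hlt (a x) (abs_lt.2 ⟨by linarith, by linarith⟩)]

theorem right_ge (hF : IsForce F Dm) (hL : 0 < L) (hper : Function.Periodic β L)
    (hβ : Continuous β) (h : IsMotion J F S Dm β a b) (hst : s ≤ t) (hJ : Icc s t ⊆ J)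
    (hD : D ≤ Dm) (hw : ∀ x ∈ Icc s t, b x - a x ≤ D) (hp : β p < F D + S) : b s - L ≤ b t := by
  obtain ⟨c, hc, η, hη, hlt⟩ := exists_mem_Ioc_eventually_lt (β := fun x => -β x) hL
    (fun x => by simp [hper x]) hβ.neg (neg_lt_neg hp) (b s)
  refine hc.1.le.trans (le_of_barrier hη hst (h.absCont_right hst hJ) hc.2 ?_)
  filter_upwards [h.law_right] with x hx hxm _ h1 h2
  have hxI := Ioo_subset_Icc_self hxm
  have h3 := hw x hxI
  have h5 := h.width_mem (hJ hxI)
  have h4 := hF.antitoneOn h5 ⟨h5.1.trans_le h3, hD⟩ h3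
  linarith [hx (hJ hxI), hlt (b x) (abs_lt.2 ⟨by linarith, by linarith⟩)]

end IsMotion

/-- **Sticking.** If the oscillation of `β` exceeds `S`, then there is a range `[D₂, D₁]` of widths
for which each end point is blocked in both directions. Once the width is in the middle of this
range, it stays within it, provided that the period is small. Before, the drop is either too narrow
or too wide, so that two of the four directions are still blocked, and the bound on the
width controls the other two. -/
theorem exists_sticking_bound (hF : IsForce F Dm) {M m : ℝ} (hS : 0 < S) (hm : 0 ≤ m)
    (hMm : S < M - m) :
    ∃ δ > 0, ∃ C : ℝ, ∀ (β : ℝ → ℝ) (L : ℝ), 0 < L → L < δ → Function.Periodic β L →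
      Continuous β → IsGreatest (range β) M → IsLeast (range β) m →
      ∀ a b : ℝ → ℝ, IsMotion (Ici 0) F S Dm β a b →
        ∀ t ≥ 0, |a t - a 0| ≤ C ∧ |b t - b 0| ≤ C := by
  obtain ⟨R₁, hR₁, hR₁'⟩ : ∃ R, m < R ∧ R < M - S := exists_between (by linarith)
  obtain ⟨R₂, hR₂, hR₂'⟩ : ∃ R, R₁ < R ∧ R < M - S := exists_between hR₁'
  obtain ⟨D₁, hD₁, hFD₁⟩ := hF.exists_eq (R := R₁) (by linarith)
  obtain ⟨D₂, hD₂, hFD₂⟩ := hF.exists_eq (R := R₂) (by linarith)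
  have hD : D₂ < D₁ := (hF.anti.lt_iff_gt ⟨hD₁.1, hD₁.2.le⟩ ⟨hD₂.1, hD₂.2.le⟩).1 (by linarith)
  refine ⟨(D₁ - D₂) / 8, by linarith, (D₁ - D₂) / 4 + Dm, ?_⟩
  rintro β L hL hLδ hper hβ ⟨⟨pM, hpM⟩, -⟩ ⟨⟨pm, hpm⟩, -⟩ a b h
  set D₀ := (D₁ + D₂) / 2 with hD₀
  have hsub : ∀ {s t : ℝ}, 0 ≤ s → Icc s t ⊆ Ici 0 := fun hs x hx => hs.trans hx.1
  have hwc : ∀ {s t : ℝ}, 0 ≤ s → ContinuousOn (fun x => b x - a x) (Icc s t) :=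
    fun hs => h.continuousOn_width.mono (hsub hs)
  -- narrow drops: the rear does not advance and the front does not recede by more than a period
  have narrow : ∀ s t, 0 ≤ s → s ≤ t → (∀ x ∈ Icc s t, b x - a x ≤ D₁) →
      a t ≤ a s + L ∧ b s - L ≤ b t := fun s t hs hst hw =>
    ⟨h.left_le hF hL hper hβ hst (hsub hs) hD₁.2 hw (p := pm) (by linarith),
      h.right_ge hF hL hper hβ hst (hsub hs) hD₁.2.le hw (p := pm) (by linarith)⟩
  -- wide drops: the rear does not recede and the front does not advance by more than a period
  have wide : ∀ s t, 0 ≤ s → s ≤ t → (∀ x ∈ Icc s t, D₂ ≤ b x - a x) →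
      a s - L ≤ a t ∧ b t ≤ b s + L := fun s t hs hst hw =>
    ⟨h.left_ge hF hL hper hβ hst (hsub hs) hD₂.1 hw (p := pM) (by linarith),
      h.right_le hF hL hper hβ hst (hsub hs) hD₂.1 hw (p := pM) (by linarith)⟩
  have far : ∀ t, 0 ≤ t → ((∀ x ∈ Icc 0 t, b x - a x ≤ D₀) ∨ ∀ x ∈ Icc 0 t, D₀ ≤ b x - a x) →
      |a t - a 0| ≤ L + Dm ∧ |b t - b 0| ≤ L + Dm := by
    rintro t ht (hw | hw)
    · have h1 := narrow 0 t le_rfl ht fun x hx => (hw x hx).trans (by linarith)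
      have h2 := hw t ⟨ht, le_rfl⟩
      have h3 := h.lt 0 self_mem_Ici
      have h4 := h.lt t ht
      have h5 := hD₁.2
      exact ⟨abs_le.2 ⟨by linarith, by linarith⟩, abs_le.2 ⟨by linarith, by linarith⟩⟩
    · have h1 := wide 0 t le_rfl ht fun x hx => le_trans (by linarith) (hw x hx)
      have h2 := hw t ⟨ht, le_rfl⟩
      have h3 := h.width_le 0 self_mem_Ici
      have h4 := hD₂.1
      have h5 := hF.width_pos
      exact ⟨abs_le.2 ⟨by linarith, by linarith⟩, abs_le.2 ⟨by linarith, by linarith⟩⟩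
  have near : ∀ s t, 0 ≤ s → s ≤ t → b s - a s = D₀ → |a t - a s| ≤ L ∧ |b t - b s| ≤ L := by
    intro s t hs hst hDs
    have hstay : ∀ x ∈ Icc s t, |b x - a x - D₀| < (D₁ - D₂) / 2 := by
      by_contra! hex
      obtain ⟨x, hx, hxD⟩ := hex
      obtain ⟨y, hy, hyD, hlt⟩ := exists_first_le
        (f := fun y => -|b y - a y - D₀|) (c := -((D₁ - D₂) / 2)) hx.1
        (((hwc hs).sub continuousOn_const).abs.neg) (by rw [hDs]; simp; linarith) (by linarith)
      have hw : ∀ w ∈ Icc s y, |b w - a w - D₀| ≤ (D₁ - D₂) / 2 := fun w hw => by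
        rcases hw.2.lt_or_eq with h' | h'
        · linarith [hlt w ⟨hw.1, h'⟩]
        · subst h'; linarith
      have h1 := narrow s y hs hy.1.le fun w hw' => by linarith [(abs_le.1 (hw w hw')).2]
      have h2 := wide s y hs hy.1.le fun w hw' => by linarith [(abs_le.1 (hw w hw')).1]
      have h3 : |b y - a y - D₀| ≤ 2 * L := abs_le.2 ⟨by linarith, by linarith⟩
      linarith
    have h1 := narrow s t hs hst fun w hw' => by linarith [(abs_lt.1 (hstay w hw')).2]
    have h2 := wide s t hs hst fun w hw' => by linarith [(abs_lt.1 (hstay w hw')).1]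
    exact ⟨abs_le.2 ⟨by linarith, by linarith⟩, abs_le.2 ⟨by linarith, by linarith⟩⟩
  intro t ht
  by_cases hex : (∀ x ∈ Icc 0 t, b x - a x ≤ D₀) ∨ ∀ x ∈ Icc 0 t, D₀ ≤ b x - a x
  · obtain ⟨h1, h2⟩ := far t ht hex
    exact ⟨h1.trans (by linarith), h2.trans (by linarith)⟩
  · -- the width passes through `D₀`; `s` is the first time that it does
    obtain ⟨s, hs, hDs, hside⟩ : ∃ s ∈ Icc 0 t, b s - a s = D₀ ∧
        ((∀ x ∈ Icc 0 s, b x - a x ≤ D₀) ∨ ∀ x ∈ Icc 0 s, D₀ ≤ b x - a x) := by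
      push Not at hex
      obtain ⟨⟨x, hx, hxD⟩, ⟨y, hy, hyD⟩⟩ := hex
      rcases lt_trichotomy (b 0 - a 0) D₀ with h0 | h0 | h0
      · obtain ⟨s, hs, hDs, hlt⟩ := exists_first_le (f := fun y => -(b y - a y)) (c := -D₀) hx.1
          (hwc le_rfl).neg (by linarith) (by linarith)
        refine ⟨s, ⟨hs.1.le, hs.2.trans hx.2⟩, by linarith, Or.inl fun w hw => ?_⟩
        rcases hw.2.lt_or_eq with h' | h'
        · linarith [hlt w ⟨hw.1, h'⟩]
        · subst h'; linarith
      · refine ⟨0, ⟨le_rfl, ht⟩, h0, Or.inl fun w hw => ?_⟩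
        rw [le_antisymm hw.2 hw.1]; exact h0.le
      · obtain ⟨s, hs, hDs, hlt⟩ := exists_first_le (f := fun y => b y - a y) (c := D₀) hy.1
          (hwc le_rfl) h0 hyD.le
        refine ⟨s, ⟨hs.1.le, hs.2.trans hy.2⟩, hDs, Or.inr fun w hw => ?_⟩
        rcases hw.2.lt_or_eq with h' | h'
        · exact (hlt w ⟨hw.1, h'⟩).le
        · subst h'; exact hDs.ge
    obtain ⟨h1, h2⟩ := far s hs.1 hside
    obtain ⟨h3, h4⟩ := near s t hs.1 hs.2 hDs
    have h5 := abs_sub_le (a t) (a s) (a 0)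
    have h6 := abs_sub_le (b t) (b s) (b 0)
    exact ⟨by linarith, by linarith⟩

/-! ### Attraction to a pulsating motion -/

/-- A motion for all times that advances by `L` in time `T`, with a strictly increasing rear point
and a front point of positive speed. -/
structure IsPulsatingMotion (F : ℝ → ℝ) (S Dm : ℝ) (β : ℝ → ℝ) (L T : ℝ) (A B : ℝ → ℝ) : Prop where
  motion : IsMotion univ F S Dm β A B
  period_pos : 0 < T
  left_add : ∀ t, A (t + T) = A t + L
  right_add : ∀ t, B (t + T) = B t + L
  left_mono : StrictMono A
  speed_pos : ∀ t, 0 < F (B t - A t) + S - β (B t)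

theorem exists_pos_le_of_periodic {f : ℝ → ℝ} {T : ℝ} (hT : 0 < T) (hf : Continuous f)
    (hper : Function.Periodic f T) (hpos : ∀ t, 0 < f t) : ∃ c > 0, ∀ t, c ≤ f t := by
  obtain ⟨t₀, -, h⟩ := isCompact_Icc.exists_isMinOn (nonempty_Icc.2 hT.le) hf.continuousOn
  refine ⟨f t₀, hpos t₀, fun t => ?_⟩
  obtain ⟨s, hs, hts⟩ := hper.exists_mem_Ico₀ hT t
  rw [hts]
  exact h (Ico_subset_Icc_self hs)

theorem exists_le_of_periodic {f : ℝ → ℝ} {T : ℝ} (hT : 0 < T) (hf : Continuous f)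
    (hper : Function.Periodic f T) : ∃ c, ∀ t, f t ≤ c := by
  obtain ⟨t₀, -, h⟩ := isCompact_Icc.exists_isMaxOn (nonempty_Icc.2 hT.le) hf.continuousOn
  refine ⟨f t₀, fun t => ?_⟩
  obtain ⟨s, hs, hts⟩ := hper.exists_mem_Ico₀ hT t
  rw [hts]
  exact h (Ico_subset_Icc_self hs)

theorem add_nat_mul_of_add {A : ℝ → ℝ} {T L : ℝ} (h : ∀ t, A (t + T) = A t + L) (n : ℕ) (t : ℝ) :
    A (t + n * T) = A t + n * L := by
  induction n with
  | zero => simp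
  | succ n ih => push_cast; rw [add_mul, one_mul, ← add_assoc, h, ih]; ring

theorem tendsto_atTop_of_add {A : ℝ → ℝ} {T L : ℝ} (hL : 0 < L) (hmono : Monotone A)
    (h : ∀ t, A (t + T) = A t + L) : Tendsto A atTop atTop := by
  refine tendsto_atTop_atTop_of_monotone hmono fun y => ?_
  obtain ⟨n, hn⟩ := exists_nat_ge ((y - A 0) / L)
  refine ⟨0 + n * T, ?_⟩
  rw [add_nat_mul_of_add h]
  rw [div_le_iff₀ hL] at hn
  linarith

theorem tendsto_atBot_of_add {A : ℝ → ℝ} {T L : ℝ} (hL : 0 < L) (hmono : Monotone A)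
    (h : ∀ t, A (t + T) = A t + L) : Tendsto A atBot atBot := by
  have := tendsto_atTop_of_add (A := fun t => -A (-t)) (T := T) hL
    (fun x y hxy => neg_le_neg (hmono (neg_le_neg hxy))) fun t => by
      have := h (-(t + T))
      rw [show -(t + T) + T = -t by ring] at this
      linarith
  have h2 := tendsto_neg_atTop_atBot.comp (this.comp tendsto_neg_atBot_atTop)
  simpa [Function.comp_def] using h2

theorem exists_continuous_inverse {A : ℝ → ℝ} (hc : Continuous A) (hmono : StrictMono A)
    (htop : Tendsto A atTop atTop) (hbot : Tendsto A atBot atBot) :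
    ∃ Ai : ℝ → ℝ, Continuous Ai ∧ StrictMono Ai ∧ (∀ x, A (Ai x) = x) ∧ ∀ t, Ai (A t) = t := by
  let e := hmono.orderIsoOfSurjective A (hc.surjective htop hbot)
  exact ⟨e.symm, e.toHomeomorph.symm.continuous, e.symm.strictMono, e.apply_symm_apply,
    e.symm_apply_apply⟩

variable {A B : ℝ → ℝ} {T : ℝ}

namespace IsPulsatingMotion

theorem continuous_left (h : IsPulsatingMotion F S Dm β L T A B) : Continuous A :=
  continuousOn_univ.1 h.motion.continuousOn_left

theorem continuous_right (h : IsPulsatingMotion F S Dm β L T A B) : Continuous B :=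
  continuousOn_univ.1 h.motion.continuousOn_right

theorem hasDerivAt_right (hF : IsForce F Dm) (hβ : Continuous β)
    (h : IsPulsatingMotion F S Dm β L T A B) (t : ℝ) :
    HasDerivAt B (F (B t - A t) + S - β (B t)) t :=
  h.motion.hasDerivAt_right hF hβ univ_mem

theorem right_mono (hF : IsForce F Dm) (hβ : Continuous β)
    (h : IsPulsatingMotion F S Dm β L T A B) : StrictMono B :=
  strictMono_of_deriv_pos fun t => by
    rw [(h.hasDerivAt_right hF hβ t).deriv]; exact h.speed_pos t

theorem continuous_speed (hF : IsForce F Dm) (hβ : Continuous β)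
    (h : IsPulsatingMotion F S Dm β L T A B) :
    Continuous fun t => F (B t - A t) + S - β (B t) := by
  refine ((continuousOn_univ.1 ?_).add continuous_const).sub (hβ.comp h.continuous_right)
  exact hF.continuousOn.comp h.motion.continuousOn_width fun t ht => h.motion.width_mem ht

theorem periodic_speed (hβ : Function.Periodic β L) (h : IsPulsatingMotion F S Dm β L T A B) :
    Function.Periodic (fun t => F (B t - A t) + S - β (B t)) T := fun t => by
  simp only [h.left_add, h.right_add, hβ (B t), add_sub_add_right_eq_sub]

theorem exists_pos_le_width (h : IsPulsatingMotion F S Dm β L T A B) :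
    ∃ ε > 0, ∀ t, ε ≤ B t - A t :=
  exists_pos_le_of_periodic h.period_pos (h.continuous_right.sub h.continuous_left)
    (fun t => by simp only [h.left_add, h.right_add, add_sub_add_right_eq_sub])
    fun t => sub_pos.2 (h.motion.lt t trivial)

theorem exists_pos_le_left_sub (h : IsPulsatingMotion F S Dm β L T A B) {δ : ℝ} (hδ : 0 < δ) :
    ∃ e > 0, ∀ t, A t + e ≤ A (t + δ) := by
  have hA := h.continuous_left
  obtain ⟨e, he, hle⟩ := exists_pos_le_of_periodic (f := fun t => A (t + δ) - A t) h.period_pos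
    (by fun_prop) (fun t => by
      simp only [add_right_comm t T δ, h.left_add, add_sub_add_right_eq_sub])
    fun t => sub_pos.2 (h.left_mono (by linarith))
  exact ⟨e, he, fun t => by linarith [hle t]⟩

end IsPulsatingMotion

/-- **Attraction.** Let `θa` and `θb` be the times by which the rear and the front point of a motion
are ahead of those of a pulsating motion. By comparison, `min θa θb` is nondecreasing
and `max θa θb` is nonincreasing in time. If the two phases stayed apart, then the widths of the two
drops at equal positions of their fronts would differ by a fixed amount, with a
fixed sign, and the phase `θb` would drift off linearly. Hence both phases have a common limit. -/
theorem IsMotion.exists_phase (hF : IsForce F Dm) (hL : 0 < L) (hper : Function.Periodic β L)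
    {K : NNReal} (hβ : LipschitzWith K β) (hU : IsPulsatingMotion F S Dm β L T A B)
    (h : IsMotion (Ici 0) F S Dm β a b) :
    ∃ τ, Tendsto (fun t => a t - A (t + τ)) atTop (𝓝 0) ∧
      Tendsto (fun t => b t - B (t + τ)) atTop (𝓝 0) := by
  have hβc := hβ.continuous
  have hBmono := hU.right_mono hF hβc
  obtain ⟨Ai, hAic, hAim, hAAi, hAiA⟩ := exists_continuous_inverse hU.continuous_left hU.left_mono
    (tendsto_atTop_of_add hL hU.left_mono.monotone hU.left_add)
    (tendsto_atBot_of_add hL hU.left_mono.monotone hU.left_add)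
  obtain ⟨Bi, hBic, hBim, hBBi, hBiB⟩ := exists_continuous_inverse hU.continuous_right hBmono
    (tendsto_atTop_of_add hL hBmono.monotone hU.right_add)
    (tendsto_atBot_of_add hL hBmono.monotone hU.right_add)
  set θa : ℝ → ℝ := fun t => Ai (a t) - t with hθa
  set θb : ℝ → ℝ := fun t => Bi (b t) - t with hθb
  have hAθ : ∀ t, A (t + θa t) = a t := fun t => by simp [hθa, hAAi]
  have hBθ : ∀ t, B (t + θb t) = b t := fun t => by simp [hθb, hBBi]
  set lo : ℝ → ℝ := fun t => min (θa t) (θb t) with hlo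
  set hi : ℝ → ℝ := fun t => max (θa t) (θb t) with hhi
  have hsub : ∀ {s t : ℝ}, 0 ≤ s → Icc s t ⊆ Ici 0 := fun hs x hx => hs.trans hx.1
  have hlo_mono : ∀ s t, 0 ≤ s → s ≤ t → lo s ≤ lo t := fun s t hs hst => by
    have := ((hU.motion.comp_add (lo s)).mono (subset_univ (Ici 0))).comparison hF hβ h hst
      (hsub hs) ((hU.left_mono.monotone (add_le_add_right (min_le_left _ _) s)).trans_eq (hAθ s))
      ((hBmono.monotone (add_le_add_right (min_le_right _ _) s)).trans_eq (hBθ s))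
    have h1 := hAim.monotone this.1
    have h2 := hBim.monotone this.2
    rw [hAiA] at h1
    rw [hBiB] at h2
    exact le_min (by simp only [hθa]; linarith) (by simp only [hθb]; linarith)
  have hhi_anti : ∀ s t, 0 ≤ s → s ≤ t → hi t ≤ hi s := fun s t hs hst => by
    have := h.comparison hF hβ ((hU.motion.comp_add (hi s)).mono (subset_univ (Ici 0))) hst
      (hsub hs) ((hAθ s).symm.trans_le
        (hU.left_mono.monotone (add_le_add_right (le_max_left _ _) s)))
      ((hBθ s).symm.trans_le (hBmono.monotone (add_le_add_right (le_max_right _ _) s)))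
    have h1 := hAim.monotone this.1
    have h2 := hBim.monotone this.2
    rw [hAiA] at h1
    rw [hBiB] at h2
    exact max_le (by simp only [hθa]; linarith) (by simp only [hθb]; linarith)
  -- the speed of the phase of the front point
  have hθb' : ∀ t, 0 < t → HasDerivAt θb ((F (b t - a t) + S - β (b t)) /
      (F (B (t + θb t) - A (t + θb t)) + S - β (B (t + θb t))) - 1) t := fun t ht => by
    have h1 : HasDerivAt Bi
        (F (B (Bi (b t)) - A (Bi (b t))) + S - β (B (Bi (b t))))⁻¹ (b t) :=
      HasDerivAt.of_local_left_inverse hBic.continuousAt (hU.hasDerivAt_right hF hβc _)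
        (hU.speed_pos _).ne' (Eventually.of_forall hBBi)
    have h2 := h.hasDerivAt_right hF hβc (Ici_mem_nhds ht)
    have h3 := (h1.comp t h2).sub (hasDerivAt_id t)
    have h4 : t + θb t = Bi (b t) := by simp [hθb]
    rw [h4]
    convert! h3 using 2
    rw [div_eq_inv_mul]
  obtain ⟨ε, hε, hεle⟩ := hU.exists_pos_le_width
  obtain ⟨vmax, hvmax⟩ := exists_le_of_periodic hU.period_pos (hU.continuous_speed hF hβc)
    (hU.periodic_speed hper)
  have hvpos : 0 < vmax := (hU.speed_pos 0).trans_le (hvmax 0)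
  have hgap : ∀ δ > 0, ∃ t ≥ 0, |θa t - θb t| < δ := by
    intro δ hδ
    by_contra! hcon
    obtain ⟨e, he, hAe⟩ := hU.exists_pos_le_left_sub hδ
    obtain ⟨c, hc, hFc⟩ := hF.exists_drop hε ((hεle 0).trans (hU.motion.width_le 0 trivial)) he
    have hcont : ContinuousOn (fun t => θa t - θb t) (Ici 0) :=
      ((hAic.comp_continuousOn h.continuousOn_left).sub continuousOn_id).sub
        ((hBic.comp_continuousOn h.continuousOn_right).sub continuousOn_id)
    have hmvt : ∀ C : ℝ, (∀ t, 0 < t → C ≤ deriv θb t) → ∀ t, 1 ≤ t →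
        C * (t - 1) ≤ θb t - θb 1 := fun C hC t ht => by
      refine Convex.mul_sub_le_image_sub_of_le_deriv (convex_Icc 1 t)
        (fun x hx => (hθb' x (by linarith [hx.1])).continuousAt.continuousWithinAt)
        (fun x hx => ?_) (fun x hx => ?_) 1 (left_mem_Icc.2 ht) t (right_mem_Icc.2 ht) ht
      · rw [interior_Icc] at hx
        exact (hθb' x (by linarith [hx.1])).differentiableAt.differentiableWithinAt
      · rw [interior_Icc] at hx
        exact hC x (by linarith [hx.1])
    have hmvt' : ∀ C : ℝ, (∀ t, 0 < t → deriv θb t ≤ C) → ∀ t, 1 ≤ t →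
        θb t - θb 1 ≤ C * (t - 1) := fun C hC t ht => by
      refine Convex.image_sub_le_mul_sub_of_deriv_le (convex_Icc 1 t)
        (fun x hx => (hθb' x (by linarith [hx.1])).continuousAt.continuousWithinAt)
        (fun x hx => ?_) (fun x hx => ?_) 1 (left_mem_Icc.2 ht) t (right_mem_Icc.2 ht) ht
      · rw [interior_Icc] at hx
        exact (hθb' x (by linarith [hx.1])).differentiableAt.differentiableWithinAt
      · rw [interior_Icc] at hx
        exact hC x (by linarith [hx.1])
    have hsign : (∀ t ≥ 0, δ ≤ θa t - θb t) ∨ ∀ t ≥ 0, θa t - θb t ≤ -δ := by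
      by_contra! hno
      obtain ⟨⟨x, hx, hx'⟩, ⟨y, hy, hy'⟩⟩ := hno
      have hxneg : θa x - θb x ≤ -δ := by
        rcases le_abs.1 (hcon x hx) with h' | h' <;> linarith
      have hypos : δ ≤ θa y - θb y := by
        rcases le_abs.1 (hcon y hy) with h' | h' <;> linarith
      obtain ⟨w, hw, hw0⟩ := isPreconnected_Ici.intermediate_value (show x ∈ Ici 0 from hx)
        (show y ∈ Ici 0 from hy) hcont (show (0 : ℝ) ∈ Icc _ _ from ⟨by linarith, by linarith⟩)
      have := hcon w hw
      rw [show θa w - θb w = 0 from hw0, abs_zero] at this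
      linarith
    have hcv : 0 < c / vmax := div_pos hc hvpos
    rcases hsign with hs | hs
    · have hder : ∀ t, 0 < t → c / vmax ≤ deriv θb t := fun t ht => by
        rw [(hθb' t ht).deriv]
        have hB := hBθ t
        have h1 := (hAe (t + θb t)).trans
          ((hU.left_mono.monotone (by linarith [hs t ht.le])).trans_eq (hAθ t))
        have h2 := hFc (b t - a t) (B (t + θb t) - A (t + θb t)) (h.width_mem ht.le).1 (hεle _)
          (hU.motion.width_le _ trivial) (by rw [hB]; linarith)
        have h3 := hU.speed_pos (t + θb t)
        have h4 := hvmax (t + θb t)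
        rw [div_sub_one h3.ne']
        refine (div_le_div_of_nonneg_left hc.le h3 h4).trans
          (div_le_div_of_nonneg_right ?_ h3.le)
        rw [hB] at h2 ⊢
        linarith
      obtain ⟨n, hn⟩ := exists_nat_gt ((hi 0 - θb 1) / (c / vmax))
      rw [div_lt_iff₀ hcv] at hn
      have h1 := hmvt _ hder (n + 1) (by simp)
      have h2 := (le_max_right _ _).trans (hhi_anti 0 (n + 1) le_rfl (by positivity))
      rw [add_sub_cancel_right, mul_comm] at h1
      linarith
    · have hder : ∀ t, 0 < t → deriv θb t ≤ -(c / vmax) := fun t ht => by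
        rw [(hθb' t ht).deriv]
        have hB := hBθ t
        have h1 := hAe (t + θa t)
        rw [hAθ] at h1
        have h1' : a t + e ≤ A (t + θb t) :=
          h1.trans (hU.left_mono.monotone (by linarith [hs t ht.le]))
        have h2 := hFc (B (t + θb t) - A (t + θb t)) (b t - a t) (hε.trans_le (hεle _))
          ((hεle (t + θb t)).trans (by rw [hB]; linarith)) (h.width_mem ht.le).2
          (by rw [hB]; linarith)
        have h3 := hU.speed_pos (t + θb t)
        have h4 := hvmax (t + θb t)
        rw [div_sub_one h3.ne', ← neg_le_neg_iff, neg_neg, ← neg_div]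
        refine (div_le_div_of_nonneg_left hc.le h3 h4).trans
          (div_le_div_of_nonneg_right ?_ h3.le)
        rw [hB] at h2 ⊢
        linarith
      obtain ⟨n, hn⟩ := exists_nat_gt ((θb 1 - lo 0) / (c / vmax))
      rw [div_lt_iff₀ hcv] at hn
      have h1 := hmvt' _ hder (n + 1) (by simp)
      have h2 := (hlo_mono 0 (n + 1) le_rfl (by positivity)).trans (min_le_right _ _)
      rw [add_sub_cancel_right, neg_mul, mul_comm] at h1
      linarith
  -- the common limit of the phases
  have hlohi : ∀ t, hi t - lo t = |θa t - θb t| := fun t => max_sub_min_eq_abs' _ _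
  have hbdd : BddAbove (range fun t => lo (max t 0)) := ⟨hi 0, by
    rintro _ ⟨t, rfl⟩
    exact (min_le_left _ _).trans ((le_max_left _ _).trans
      (hhi_anti 0 (max t 0) le_rfl (le_max_right _ _)))⟩
  have hlim := tendsto_atTop_ciSup (f := fun t => lo (max t 0))
    (fun s t hst => hlo_mono _ _ (le_max_right _ _) (max_le_max_right 0 hst)) hbdd
  set τ := ⨆ t, lo (max t 0)
  have hgap0 : Tendsto (fun t => |θa t - θb t|) atTop (𝓝 0) := by
    rw [Metric.tendsto_atTop]
    intro δ hδ
    obtain ⟨t₀, ht₀, hlt⟩ := hgap δ hδ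
    refine ⟨t₀, fun t ht => ?_⟩
    rw [Real.dist_0_eq_abs, abs_abs]
    have h1 := hlo_mono t₀ t ht₀ ht
    have h2 := hhi_anti t₀ t ht₀ ht
    linarith [hlohi t, hlohi t₀]
  have hlo_lim : Tendsto lo atTop (𝓝 τ) := hlim.congr' <| by
    filter_upwards [eventually_ge_atTop 0] with t ht
    rw [max_eq_left ht]
  have hhi_lim : Tendsto hi atTop (𝓝 τ) := by
    have := hlo_lim.add hgap0
    rw [add_zero] at this
    exact this.congr fun t => by linarith [hlohi t]
  have ha_lim : Tendsto θa atTop (𝓝 τ) := tendsto_of_tendsto_of_tendsto_of_le_of_le hlo_lim hhi_lim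
    (fun t => min_le_left _ _) fun t => le_max_left _ _
  have hb_lim : Tendsto θb atTop (𝓝 τ) := tendsto_of_tendsto_of_tendsto_of_le_of_le hlo_lim hhi_lim
    (fun t => min_le_right _ _) fun t => le_max_right _ _
  have hfin : ∀ (f : ℝ → ℝ) (θ : ℝ → ℝ), (∃ K, LipschitzOnWith K f univ) →
      Tendsto θ atTop (𝓝 τ) → Tendsto (fun t => f (t + θ t) - f (t + τ)) atTop (𝓝 0) := by
    rintro f θ ⟨K, hK⟩ hθ
    rw [lipschitzOnWith_univ] at hK
    have h1 : Tendsto (fun t => (K : ℝ) * |θ t - τ|) atTop (𝓝 0) := by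
      have := ((hθ.sub_const τ).abs).const_mul (K : ℝ)
      simpa using this
    refine squeeze_zero_norm (fun t => ?_) h1
    have := hK.dist_le_mul (t + θ t) (t + τ)
    rwa [Real.dist_eq, Real.dist_eq, add_sub_add_left_eq_sub] at this
  refine ⟨τ, ?_, ?_⟩
  · exact (hfin A θa hU.motion.lip_left ha_lim).congr fun t => by rw [hAθ]
  · exact (hfin B θb hU.motion.lip_right hb_lim).congr fun t => by rw [hBθ]

/-- A motion that is attracted to a pulsating motion has a front point that eventually advances. -/
theorem IsMotion.eventually_speed_pos (hF : IsForce F Dm) (hper : Function.Periodic β L)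
    {K : NNReal} (hβ : LipschitzWith K β) (hU : IsPulsatingMotion F S Dm β L T A B)
    (h : IsMotion (Ici 0) F S Dm β a b) {τ : ℝ}
    (ha : Tendsto (fun t => a t - A (t + τ)) atTop (𝓝 0))
    (hb : Tendsto (fun t => b t - B (t + τ)) atTop (𝓝 0)) :
    ∃ t₀, ∀ t ≥ t₀, DifferentiableAt ℝ b t ∧ 0 < deriv b t := by
  obtain ⟨c, hc, hcle⟩ := exists_pos_le_of_periodic hU.period_pos
    (hU.continuous_speed hF hβ.continuous) (hU.periodic_speed hper) hU.speed_pos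
  obtain ⟨ε, hε, hεle⟩ := hU.exists_pos_le_width
  have hεD := (hεle 0).trans (hU.motion.width_le 0 trivial)
  obtain ⟨KF, hKF⟩ := hF.lip (ε / 2) ⟨by linarith, by linarith⟩
  have hw : Tendsto (fun t => (b t - a t) - (B (t + τ) - A (t + τ))) atTop (𝓝 0) := by
    have := hb.sub ha
    rw [sub_zero] at this
    exact this.congr fun t => by ring
  have hsum : Tendsto (fun t => (KF : ℝ) * |(b t - a t) - (B (t + τ) - A (t + τ))| +
      K * |b t - B (t + τ)|) atTop (𝓝 0) := by
    simpa using (hw.abs.const_mul (KF : ℝ)).add (hb.abs.const_mul (K : ℝ))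
  have hev : ∀ᶠ t in atTop, 0 < F (b t - a t) + S - β (b t) := by
    filter_upwards [hsum.eventually_lt_const hc, hw.eventually_const_lt (show -(ε / 2) < 0 by linarith),
      eventually_ge_atTop 0] with t h1 h2 h3
    have h4 := hεle (t + τ)
    have h5 := hKF.dist_le_mul (b t - a t) ⟨by linarith, h.width_le t h3⟩
      (B (t + τ) - A (t + τ)) ⟨by linarith, hU.motion.width_le _ trivial⟩
    have h6 := hβ.dist_le_mul (b t) (B (t + τ))
    rw [Real.dist_eq, Real.dist_eq] at h5 h6
    have h7 := hcle (t + τ)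
    linarith [neg_abs_le (F (b t - a t) - F (B (t + τ) - A (t + τ))),
      le_abs_self (β (b t) - β (B (t + τ)))]
  obtain ⟨t₀, ht₀⟩ := eventually_atTop.1 (hev.and (eventually_gt_atTop 0))
  refine ⟨t₀, fun t ht => ?_⟩
  have hd := h.hasDerivAt_right hF hβ.continuous (Ici_mem_nhds (ht₀ t ht).2)
  exact ⟨hd.differentiableAt, hd.deriv ▸ (ht₀ t ht).1⟩

theorem eq_zero_of_periodic_of_tendsto {f : ℝ → ℝ} {T : ℝ} (hT : 0 < T)
    (hper : Function.Periodic f T) (hf : Tendsto f atTop (𝓝 0)) (t : ℝ) : f t = 0 := by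
  have h1 : Tendsto (fun n : ℕ => t + n * T) atTop atTop :=
    tendsto_atTop_add_const_left _ _ (tendsto_natCast_atTop_atTop.atTop_mul_const hT)
  refine tendsto_nhds_unique (tendsto_const_nhds.congr fun n => ?_) (hf.comp h1)
  exact ((hper.nat_mul n) t).symm

/-- Two pulsating motions agree up to a translation in time: the difference of their phases is
periodic and tends to zero. -/
theorem IsMotion.eq_translate_of_pulsating (hF : IsForce F Dm) (hL : 0 < L)
    (hper : Function.Periodic β L) {K : NNReal} (hβ : LipschitzWith K β)
    (hU : IsPulsatingMotion F S Dm β L T A B) (h : IsMotion univ F S Dm β a b) {T' : ℝ}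
    (ha' : ∀ t, a (t + T') = a t + L) (hb' : ∀ t, b (t + T') = b t + L) :
    ∃ τ, ∀ t, a t = A (t + τ) ∧ b t = B (t + τ) := by
  obtain ⟨τ, ha, hb⟩ := (h.mono (subset_univ (Ici 0))).exists_phase hF hL hper hβ hU
  have hTT : T' = T := by
    have hBtop := tendsto_atTop_of_add hL (hU.right_mono hF hβ.continuous).monotone hU.right_add
    have key : ∀ n : ℕ, b (0 + n * T') = b 0 + n * L := fun n => add_nat_mul_of_add hb' n 0
    have hbt : Tendsto b atTop atTop := by
      have := (hBtop.comp (tendsto_atTop_add_const_right atTop τ tendsto_id)).atTop_add hb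
      exact this.congr fun t => by simp
    have hT'pos : 0 < T' := by
      by_contra! hneg
      -- otherwise `b (-n T') = b 0 - n L` would tend to `-∞` along nonnegative times
      have h1 : ∀ n : ℕ, b (n * (-T')) = b 0 - n * L := fun n => by
        have := add_nat_mul_of_add hb' n (n * (-T'))
        rw [show (n : ℝ) * (-T') + n * T' = 0 by ring] at this
        linarith
      rcases hneg.lt_or_eq with hlt | heq
      · have h2 := hbt.comp (tendsto_natCast_atTop_atTop.atTop_mul_const
          (neg_pos.2 hlt) : Tendsto (fun n : ℕ => (n : ℝ) * (-T')) atTop atTop)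
        obtain ⟨n, hn⟩ := (h2.eventually_gt_atTop (b 0)).exists
        simp only [Function.comp_apply, h1] at hn
        have : (0 : ℝ) ≤ n * L := by positivity
        linarith
      · have := hb' 0
        rw [heq, add_zero] at this
        linarith
    -- after `n` periods the phases differ by `n (T' - T)`, which has to stay bounded
    have hdiff : Tendsto (fun n : ℕ => B (τ + n * (T' - T))) atTop (𝓝 (b 0)) := by
      have hn : Tendsto (fun n : ℕ => (0 : ℝ) + n * T') atTop atTop :=
        tendsto_atTop_add_const_left _ _ (tendsto_natCast_atTop_atTop.atTop_mul_const hT'pos)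
      have h1 := (hb.comp hn).const_sub (b 0)
      rw [sub_zero] at h1
      refine h1.congr fun n => ?_
      have h2 := add_nat_mul_of_add hU.right_add n (τ + n * (T' - T))
      rw [show τ + n * (T' - T) + n * T = 0 + n * T' + τ by ring] at h2
      simp only [Function.comp_apply, key, h2]
      ring
    have hBmono := (hU.right_mono hF hβ.continuous).monotone
    rcases lt_trichotomy T' T with hlt | heq | hgt
    · have h1 : Tendsto (fun n : ℕ => τ + n * (T' - T)) atTop atBot :=
        tendsto_atBot_add_const_left _ _
          (tendsto_natCast_atTop_atTop.atTop_mul_const_of_neg (sub_neg.2 hlt))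
      exact absurd hdiff (not_tendsto_nhds_of_tendsto_atBot
        ((tendsto_atBot_of_add hL hBmono hU.right_add).comp h1) _)
    · exact heq
    · have h1 : Tendsto (fun n : ℕ => τ + n * (T' - T)) atTop atTop :=
        tendsto_atTop_add_const_left _ _
          (tendsto_natCast_atTop_atTop.atTop_mul_const (sub_pos.2 hgt))
      exact absurd hdiff (not_tendsto_nhds_of_tendsto_atTop (hBtop.comp h1) _)
  subst hTT
  refine ⟨τ, fun t => ⟨?_, ?_⟩⟩
  · refine sub_eq_zero.1 (eq_zero_of_periodic_of_tendsto (f := fun t => a t - A (t + τ))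
      hU.period_pos (fun t => ?_) ha t)
    simp only [add_right_comm t T' τ, ha', hU.left_add, add_sub_add_right_eq_sub]
  · refine sub_eq_zero.1 (eq_zero_of_periodic_of_tendsto (f := fun t => b t - B (t + τ))
      hU.period_pos (fun t => ?_) hb t)
    simp only [add_right_comm t T' τ, hb', hU.right_add, add_sub_add_right_eq_sub]

/-! ### Scalar differential equations reflected below an obstacle -/

/-- A bounded field that is globally Lipschitz in space has solutions for all times. -/
theorem exists_global_solution {G : ℝ → ℝ → ℝ} {K C : NNReal} (hlip : ∀ c, LipschitzWith K (G c))
    (hcont : ∀ x, Continuous fun c => G c x) (hbdd : ∀ c x, ‖G c x‖ ≤ C) (c₀ x₀ : ℝ) :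
    ∃ X : ℝ → ℝ, X c₀ = x₀ ∧ ∀ c, HasDerivAt X (G c (X c)) c := by
  have hloc : ∀ n : ℕ, ∃ X : ℝ → ℝ, X c₀ = x₀ ∧ ∀ c ∈ Ioo (c₀ - (n + 1)) (c₀ + (n + 1)),
      HasDerivAt X (G c (X c)) c := fun n => by
    have hn : (0 : ℝ) ≤ n + 1 := by positivity
    have hPL : IsPicardLindelof G (tmin := c₀ - (n + 1)) (tmax := c₀ + (n + 1))
        ⟨c₀, by constructor <;> linarith⟩ x₀ (C * (n + 1)) 0 C K :=
      { lipschitzOnWith := fun c _ => (hlip c).lipschitzOnWith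
        continuousOn := fun x _ => (hcont x).continuousOn
        norm_le := fun c _ x _ => hbdd c x
        mul_max_le := by simp }
    obtain ⟨X, hX0, hX⟩ := hPL.exists_eq_forall_mem_Icc_hasDerivWithinAt₀
    exact ⟨X, hX0, fun c hc => (hX c (Ioo_subset_Icc_self hc)).hasDerivAt (Icc_mem_nhds hc.1 hc.2)⟩
  choose X hX0 hX using hloc
  have hagree : ∀ n k : ℕ, n ≤ k → ∀ c ∈ Ioo (c₀ - (n + 1)) (c₀ + (n + 1)), X n c = X k c := by
    intro n k hnk c hc
    have hnk' : (n : ℝ) ≤ k := by exact_mod_cast hnk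
    have hn0 : (0 : ℝ) ≤ n := Nat.cast_nonneg n
    refine ODE_solution_unique_of_mem_Ioo (v := G) (s := fun _ => univ) (K := K) (t₀ := c₀)
      (fun c _ => (hlip c).lipschitzOnWith) ⟨by linarith, by linarith⟩
      (fun c hc => ⟨hX n c hc, trivial⟩)
      (fun c hc => ⟨hX k c ⟨by linarith [hc.1], by linarith [hc.2]⟩, trivial⟩)
      ((hX0 n).trans (hX0 k).symm) hc
  have hmem : ∀ c : ℝ, c ∈ Ioo (c₀ - ((⌈|c - c₀|⌉₊ : ℕ) + 1)) (c₀ + ((⌈|c - c₀|⌉₊ : ℕ) + 1)) :=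
    fun c => by
      have := abs_le.1 (Nat.le_ceil |c - c₀|)
      constructor <;> linarith [this.1, this.2]
  have heq : ∀ (n : ℕ), ∀ c ∈ Ioo (c₀ - (n + 1)) (c₀ + (n + 1)), X ⌈|c - c₀|⌉₊ c = X n c := by
    intro n c hc
    rcases le_total ⌈|c - c₀|⌉₊ n with h | h
    · exact hagree _ _ h c (hmem c)
    · exact (hagree _ _ h c hc).symm
  refine ⟨fun c => X ⌈|c - c₀|⌉₊ c, hX0 _, fun c => ?_⟩
  refine (hX _ c (hmem c)).congr_of_eventuallyEq ?_
  filter_upwards [Ioo_mem_nhds (hmem c).1 (hmem c).2] with x hx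
  exact heq _ x hx

/-- **Reflected solutions.** For a bounded Lipschitz field `G` that is `L`-periodic in time and
positive below the level `ε`, there is an `L`-periodic solution of `D' = G(c, D)` that is
reflected below the obstacle `D ≤ top`. It is the smallest value at time `c` of the
solutions that were above the obstacle at some earlier time. -/
theorem exists_periodic_reflected {G : ℝ → ℝ → ℝ} {K C : NNReal} {ε top L : ℝ}
    (hlip : ∀ c, LipschitzWith K (G c)) (hcont : ∀ x, Continuous fun c => G c x)
    (hbdd : ∀ c x, ‖G c x‖ ≤ C) (hper : ∀ c x, G (c + L) x = G c x)
    (hε : ε ≤ top) (hpos : ∀ c x, x ≤ ε → 0 < G c x) :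
    ∃ D : ℝ → ℝ, LipschitzWith C D ∧ (∀ c, D c ∈ Icc ε top) ∧ Function.Periodic D L ∧
      (∀ c, D c < top → HasDerivAt D (G c (D c)) c) ∧ ∀ c, D c = top → 0 ≤ G c top := by
  let Sol : (ℝ → ℝ) → Prop := fun X => ∀ c, HasDerivAt X (G c (X c)) c
  have hex : ∀ c x, ∃ X, Sol X ∧ X c = x := fun c x =>
    (exists_global_solution hlip hcont hbdd c x).imp fun X h => ⟨h.2, h.1⟩
  have huniq : ∀ {X Y}, Sol X → Sol Y → ∀ c, X c = Y c → X = Y := fun {X Y} hX hY c h =>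
    ODE_solution_unique_univ (v := G) (s := fun _ => univ) (K := K) (t₀ := c)
      (fun c => (hlip c).lipschitzOnWith) (fun c => ⟨hX c, trivial⟩) (fun c => ⟨hY c, trivial⟩) h
  have hSc : ∀ {X}, Sol X → Continuous X := fun hX =>
    continuous_iff_continuousAt.2 fun c => (hX c).continuousAt
  have hlt : ∀ {X Y}, Sol X → Sol Y → ∀ c d, X c < Y c → X d < Y d := by
    intro X Y hX hY c d h
    by_contra! h'
    obtain ⟨w, hw⟩ := mem_range_of_exists_le_of_exists_ge ((hSc hY).sub (hSc hX))
      ⟨d, sub_nonpos.2 h'⟩ ⟨c, (sub_pos.2 h).le⟩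
    rw [huniq hX hY w (sub_eq_zero.1 hw).symm] at h
    exact lt_irrefl _ h
  have hle : ∀ {X Y}, Sol X → Sol Y → ∀ c d, X c ≤ Y c → X d ≤ Y d := by
    intro X Y hX hY c d h
    by_contra! h'
    exact absurd (hlt hY hX d c h') (not_lt.2 h)
  have hSlip : ∀ {X}, Sol X → LipschitzWith C X := fun {X} hX =>
    lipschitzWith_of_nnnorm_deriv_le (fun c => (hX c).differentiableAt) fun c => by
      rw [(hX c).deriv]; exact hbdd c _
  have hlip' : ∀ {X : ℝ → ℝ}, LipschitzWith C X → ∀ c d : ℝ, c ≤ d →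
      X d ≤ X c + C * (d - c) ∧ X c ≤ X d + C * (d - c) := fun {X} hX c d hcd => by
    have := hX.dist_le_mul d c
    rw [Real.dist_eq, Real.dist_eq, abs_of_nonneg (sub_nonneg.2 hcd)] at this
    have h2 := abs_le.1 this
    constructor <;> linarith [h2.1, h2.2]
  let Adm : ℝ → (ℝ → ℝ) → Prop := fun c X => Sol X ∧ ∃ c₁ ≤ c, top ≤ X c₁
  let vals : ℝ → Set ℝ := fun c => {x | ∃ X, Adm c X ∧ X c = x}
  have hlow : ∀ {c X}, Adm c X → ε ≤ X c := by
    rintro c X ⟨hX, c₁, hc, hX1⟩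
    refine le_of_barrier one_pos hc (absCont_of_lipschitzOnWith (hSlip hX).lipschitzOnWith hc
      (subset_univ _)) (hε.trans hX1) (Eventually.of_forall fun x _ _ _ h => ?_)
    rw [(hX x).deriv]
    exact (hpos x _ h.le).le
  have hne : ∀ c, (vals c).Nonempty := fun c => by
    obtain ⟨X, hX, hXc⟩ := hex c top
    exact ⟨_, X, ⟨hX, c, le_rfl, hXc.ge⟩, rfl⟩
  have hbb : ∀ c, BddBelow (vals c) := fun c => ⟨ε, by rintro _ ⟨X, hX, rfl⟩; exact hlow hX⟩
  set D : ℝ → ℝ := fun c => sInf (vals c) with hD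
  have hD_le : ∀ {c X}, Adm c X → D c ≤ X c := fun {c X} hX => csInf_le (hbb c) ⟨X, hX, rfl⟩
  have hle_D : ∀ {c y}, (∀ X, Adm c X → y ≤ X c) → y ≤ D c := fun {c y} h =>
    le_csInf (hne c) (by rintro _ ⟨X, hX, rfl⟩; exact h X hX)
  have hD_top : ∀ c, D c ≤ top := fun c => by
    obtain ⟨X, hX, hXc⟩ := hex c top
    exact (hD_le ⟨hX, c, le_rfl, hXc.ge⟩).trans_eq hXc
  have hDε : ∀ c, ε ≤ D c := fun c => hle_D fun X hX => hlow hX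
  -- `D` is a subsolution
  have hsub : ∀ {X} c₁ c₂, Sol X → c₁ ≤ c₂ → D c₁ ≤ X c₁ → D c₂ ≤ X c₂ := by
    intro X c₁ c₂ hX hc h
    refine le_of_forall_pos_lt_add fun e he => ?_
    obtain ⟨Z, hZ, hZc⟩ := hex c₂ (X c₂ + e)
    have h1 : D c₁ < Z c₁ := h.trans_lt (hlt hX hZ c₂ c₁ (by linarith))
    obtain ⟨_, ⟨Y, ⟨hY, c₀, hc₀, hY0⟩, rfl⟩, hYZ⟩ := exists_lt_of_csInf_lt (hne c₁) h1
    exact (hD_le ⟨hY, c₀, hc₀.trans hc, hY0⟩).trans_lt ((hlt hY hZ c₁ c₂ hYZ).trans_eq hZc)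
  -- and a supersolution where it does not touch the obstacle
  have hsup : ∀ {X} c₁ c₂, Sol X → c₁ ≤ c₂ → X c₁ ≤ D c₁ → (∀ c ∈ Icc c₁ c₂, X c ≤ top) →
      X c₂ ≤ D c₂ := by
    intro X c₁ c₂ hX hc h htop
    refine hle_D fun Y hY' => ?_
    obtain ⟨hY, c₀, hc₀, hY0⟩ := hY'
    rcases le_total c₀ c₁ with h1 | h1
    · exact hle hX hY c₁ c₂ (h.trans (hD_le ⟨hY, c₀, h1, hY0⟩))
    · exact hle hX hY c₀ c₂ ((htop c₀ ⟨h1, hc₀⟩).trans hY0)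
  have hDlip : LipschitzWith C D := by
    refine LipschitzWith.of_le_add_mul C fun x y => ?_
    rcases le_total y x with h | h
    · obtain ⟨X, hX, hXc⟩ := hex y (D y)
      have h1 := hsub y x hX h hXc.ge
      have h2 := (hlip' (hSlip hX) y x h).1
      rw [Real.dist_eq, abs_of_nonneg (sub_nonneg.2 h)]
      linarith
    · have : D x - C * (y - x) ≤ D y := by
        refine hle_D fun Y hY' => ?_
        obtain ⟨hY, c₀, hc₀, hY0⟩ := hY'
        rcases le_total c₀ x with h1 | h1
        · linarith [hD_le ⟨hY, c₀, h1, hY0⟩, (hlip' (hSlip hY) x y h).2]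
        · have h2 : (C : ℝ) * (y - c₀) ≤ C * (y - x) :=
            mul_le_mul_of_nonneg_left (by linarith) C.2
          linarith [hD_top x, (hlip' (hSlip hY) c₀ y hc₀).2]
      rw [Real.dist_eq, abs_sub_comm, abs_of_nonneg (sub_nonneg.2 h)]
      linarith
  refine ⟨D, hDlip, fun c => ⟨hDε c, hD_top c⟩, ?_, ?_, ?_⟩
  · have hshift : ∀ d c, (∀ c x, G (c + d) x = G c x) → D (c - d) ≤ D c := fun d c hd => by
      refine hle_D fun X hX' => ?_
      obtain ⟨hX, c₁, hc₁, hX1⟩ := hX'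
      have hY : Sol fun c => X (c + d) := fun c => by
        have := (hX (c + d)).comp_add_const c d
        rwa [hd] at this
      have := hD_le (c := c - d) (X := fun c => X (c + d))
        ⟨hY, c₁ - d, by linarith, by simpa using hX1⟩
      simpa using this
    intro c
    refine le_antisymm ?_ ?_
    · have := hshift (-L) c fun c x => by
        have := hper (c + -L) x
        rw [neg_add_cancel_right] at this
        exact this.symm
      simpa using this
    · simpa using hshift L (c + L) hper
  · intro c hc
    obtain ⟨X, hX, hXc⟩ := hex c (D c)
    have hloc : ∀ᶠ x in 𝓝 c, D x = X x := by
      obtain ⟨δ, hδ, hδ'⟩ : ∃ δ > 0, 2 * C * δ < top - D c :=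
        ⟨(top - D c) / (2 * (C + 1)), by have := sub_pos.2 hc; positivity, by
          have h1 : (0 : ℝ) < C + 1 := by positivity
          rw [show 2 * (C : ℝ) * ((top - D c) / (2 * (C + 1))) = (top - D c) * (C / (C + 1)) by
            field_simp]
          exact mul_lt_of_lt_one_right (sub_pos.2 hc) ((div_lt_one h1).2 (by linarith))⟩
      have hC : ∀ x, x ≤ δ → (C : ℝ) * x ≤ C * δ := fun x hx => mul_le_mul_of_nonneg_left hx C.2
      filter_upwards [Ioo_mem_nhds (show c - δ < c by linarith) (show c < c + δ by linarith)]
        with x hx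
      have hCδ : 0 ≤ C * δ := mul_nonneg C.2 hδ.le
      rcases le_total c x with h | h
      · refine le_antisymm (hsub c x hX h hXc.ge) (hsup c x hX h hXc.le fun w hw => ?_)
        have := (hlip' (hSlip hX) c w hw.1).1
        linarith [hC (w - c) (by linarith [hw.2, hx.2])]
      · obtain ⟨Y, hY, hYx⟩ := hex x (D x)
        have h1 := hsub x c hY h hYx.ge
        have h2 := hsup x c hY h hYx.le fun w hw => by
          have h3 := (hlip' (hSlip hY) x w hw.1).1
          have h4 := (hlip' hDlip x c h).2
          linarith [hC (w - x) (by linarith [hw.2, hx.1]), hC (c - x) (by linarith [hx.1])]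
        rw [← hYx, huniq hY hX c (by rw [hXc]; exact le_antisymm h2 h1)]
    have := (hX c).congr_of_eventuallyEq hloc
    rwa [hXc] at this
  · intro c hc
    by_contra! hneg
    obtain ⟨X, hX, hXc⟩ := hex c top
    have h1 := (hasDerivAt_iff_tendsto_slope.1 (hX c)).eventually_lt_const (by rwa [hXc] :
      G c (X c) < 0)
    have h2 : ∀ᶠ x in 𝓝[<] c, slope X c x < 0 :=
      h1.filter_mono (nhdsWithin_mono _ fun x hx => ne_of_lt hx)
    obtain ⟨x, hx, hxc⟩ := (h2.and self_mem_nhdsWithin).exists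
    rw [slope_def_field, div_neg_iff] at hx
    have hxc' : x < c := hxc
    have h3 : top < X x := by
      rcases hx with h | h <;> linarith [h.1, h.2]
    obtain ⟨Z, hZ, hZx⟩ := hex x top
    have h4 := hlt hZ hX x c (by rwa [hZx])
    have h5 := hD_le (c := c) ⟨hZ, x, hxc'.le, hZx.ge⟩
    linarith

/-! ### Existence of a pulsating motion -/

/-- A positivity principle along a curve. As long as `P < V / 2` (and the constraint `N < 0` is
inactive), a bounded quantity `E` grows at least at unit speed, so that this regime
has a beginning, where `P = V / 2`. From there on, `P` cannot reach zero, since `y' = P / V` while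
`P` is bounded by the distance of `y` from its value at the first zero of `P`. -/
theorem pos_of_drift {E y N P V : ℝ → ℝ} {R K v : ℝ} (hEc : Continuous E) (hyc : Continuous y)
    (hNc : Continuous N) (hPc : Continuous P) (hVc : Continuous V) (hK : 0 ≤ K) (hv : 0 < v)
    (hV : ∀ x, v ≤ V x) (hEb : ∀ x z, E x - E z ≤ R)
    (hE : ∀ x, P x < V x / 2 → N x < 0 → ∃ e ≥ 1, HasDerivAt E e x)
    (hy : ∀ x, P x < V x / 2 → N x < 0 → HasDerivAt y (P x / V x) x)
    (hN : ∀ x z, E x ≤ E z → N z < 0 → N x < 0)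
    (hP : ∀ x z, E x ≤ E z → P z = 0 → P x ≤ K * |y z - y x|) {c : ℝ} (hc : N c < 0) :
    0 < P c := by
  by_contra! hPc0
  set f : ℝ → ℝ := fun x => max (P x - V x / 2) (N x) with hf
  have hfc : Continuous f := by fun_prop
  have hfneg : ∀ x, f x < 0 → P x < V x / 2 ∧ N x < 0 := fun x hx => by
    have := max_lt_iff.1 hx
    exact ⟨by linarith [this.1], this.2⟩
  have hgrow : ∀ s t, s ≤ t → (∀ x ∈ Ioo s t, f x < 0) → 1 * (t - s) ≤ E t - E s := by
    intro s t hst hneg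
    refine Convex.mul_sub_le_image_sub_of_le_deriv (convex_Icc s t) hEc.continuousOn
      (fun x hx => ?_) (fun x hx => ?_) s (left_mem_Icc.2 hst) t (right_mem_Icc.2 hst) hst <;>
    · rw [interior_Icc] at hx
      obtain ⟨h1, h2⟩ := hfneg x (hneg x hx)
      obtain ⟨e, he, hd⟩ := hE x h1 h2
      first
        | exact hd.differentiableAt.differentiableWithinAt
        | exact hd.deriv ▸ he
  have hfc0 : f c < 0 := max_lt (by linarith [hV c]) hc
  obtain ⟨x₀, hx₀, hfx₀⟩ : ∃ x₀ ≤ c, 0 ≤ f x₀ := by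
    by_contra! hno
    have hR : 0 ≤ R := by simpa using hEb c c
    have := hgrow (c - (R + 1)) c (by linarith) fun x hx => hno x hx.2.le
    linarith [hEb c (c - (R + 1))]
  obtain ⟨r, hr, hfr, hneg⟩ := exists_last_le (f := fun x => -f x) (c := 0) hx₀
    hfc.neg.continuousOn (by linarith) (by linarith)
  have hneg' : ∀ x ∈ Ioc r c, f x < 0 := fun x hx => by linarith [hneg x hx]
  have hErc : ∀ s t, r ≤ s → s ≤ t → t ≤ c → E s ≤ E t := fun s t hs hst ht => by
    have := hgrow s t hst fun x hx => hneg' x ⟨hs.trans_lt hx.1, hx.2.le.trans ht⟩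
    linarith
  have hNr : N r < 0 := hN r c (hErc r c le_rfl hr.2.le le_rfl) hc
  have hPr : 0 < P r := by
    have h0 : f r = 0 := by linarith
    rcases max_choice (P r - V r / 2) (N r) with h | h
    · linarith [hV r, show f r = P r - V r / 2 from h]
    · linarith [show f r = N r from h]
  obtain ⟨q, hq, hPq, hpos⟩ := exists_first_le (f := P) (c := 0) hr.2.le hPc.continuousOn hPr hPc0
  refine no_arrival (y := y) (ρ := fun x => P x / V x) (K := K / v) hq.1 hyc.continuousOn
    (fun x hx => ?_) (fun x hx => ?_) (fun x hx => ?_)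
  · obtain ⟨h1, h2⟩ := hfneg x (hneg' x ⟨hx.1, hx.2.le.trans hq.2⟩)
    exact hy x h1 h2
  · exact div_pos (hpos x ⟨hx.1.le, hx.2⟩) (hv.trans_le (hV x))
  · have h1 := hP x q (hErc x q hx.1.le hx.2.le hq.2) hPq
    rw [div_mul_eq_mul_div]
    exact div_le_div₀ (mul_nonneg hK (abs_nonneg _)) h1 hv (hV x)

/-- The width `D` of a pulsating motion, as a function of the centre `c` of the support. In this
parametrization the law reads `dD/dc = (b' - a') / c'`, where the speed `c'` of the centre is
bounded below by `(S - (max β - min β)) / 2`. -/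
theorem exists_periodic_width (hF : IsForce F Dm) (hper : Function.Periodic β L) {K : NNReal}
    (hβ : LipschitzWith K β) {M m : ℝ} (hM : ∀ x, β x ≤ M) (hm : ∀ x, m ≤ β x) (hS : M - m < S) :
    ∃ (D : ℝ → ℝ) (C : NNReal) (ε : ℝ), 0 < ε ∧ ε ≤ Dm ∧ LipschitzWith C D ∧
      (∀ c, D c ∈ Icc ε Dm) ∧ Function.Periodic D L ∧
      (∀ c, D c < Dm → HasDerivAt D ((2 * F (D c) + S - β (c - D c / 2) - β (c + D c / 2)) /
        ((S + β (c - D c / 2) - β (c + D c / 2)) / 2)) c) ∧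
      ∀ c, D c = Dm → 0 ≤ S - β (c - Dm / 2) - β (c + Dm / 2) := by
  obtain ⟨ε, hε, hFε⟩ := hF.blowup M
  obtain ⟨KF, hKF⟩ := hF.lip ε hε
  set q : ℝ → ℝ := fun x => max ε (min x Dm) with hq
  have hqmem : ∀ x, q x ∈ Icc ε Dm := fun x =>
    ⟨le_max_left _ _, max_le hε.2.le (min_le_right _ _)⟩
  have hqid : ∀ x ∈ Icc ε Dm, q x = x := fun x hx => by
    simp only [hq, min_eq_left hx.2, max_eq_right hx.1]
  have hqlip : ∀ x y, |q x - q y| ≤ |x - y| := fun x y =>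
    ((abs_max_sub_max_le_max _ _ _ _).trans (by simp)).trans
      ((abs_min_sub_min_le_max x Dm y Dm).trans (by simp))
  have hFq : ∀ x, 0 ≤ F (q x) ∧ F (q x) ≤ F ε := fun x => by
    have h1 := hqmem x
    have h2 : q x ∈ Ioc 0 Dm := ⟨hε.1.trans_le h1.1, h1.2⟩
    exact ⟨hF.eq_zero ▸ hF.antitoneOn h2 ⟨hF.width_pos, le_rfl⟩ h1.2,
      hF.antitoneOn ⟨hε.1, hε.2.le⟩ h2 h1.1⟩
  set num : ℝ → ℝ → ℝ := fun c x => 2 * F (q x) + S - β (c - q x / 2) - β (c + q x / 2) with hnum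
  set den : ℝ → ℝ → ℝ := fun c x => (S + β (c - q x / 2) - β (c + q x / 2)) / 2 with hden
  set v := (S + m - M) / 2 with hv
  have hvpos : 0 < v := by simp only [hv]; linarith
  have hden_ge : ∀ c x, v ≤ den c x := fun c x => by
    simp only [hv, hden]; linarith [hm (c - q x / 2), hM (c + q x / 2)]
  have hden_pos : ∀ c x, 0 < den c x := fun c x => hvpos.trans_le (hden_ge c x)
  set CN := 2 * F ε + |S| + 2 * (|M| + |m|) with hCN
  have hCN0 : 0 ≤ CN := by have := (hFq 0).1.trans (hFq 0).2; positivity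
  have hnum_le : ∀ c x, |num c x| ≤ CN := fun c x => by
    have h1 := hFq x
    have h2 : ∀ y, -(|M| + |m|) ≤ β y ∧ β y ≤ |M| + |m| := fun y => by
      have e1 := neg_abs_le m
      have e2 := le_abs_self M
      have e3 := abs_nonneg m
      have e4 := abs_nonneg M
      exact ⟨by linarith [hm y], by linarith [hM y]⟩
    have h3 := h2 (c - q x / 2)
    have h4 := h2 (c + q x / 2)
    exact abs_le.2 ⟨by simp only [hnum, hCN]; linarith [neg_abs_le S],
      by simp only [hnum, hCN]; linarith [le_abs_self S]⟩
  have hβd : ∀ x y, |β x - β y| ≤ K * |x - y| := fun x y => hβ.dist_le_mul x y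
  have hβm : ∀ c x y, |β (c - q x / 2) - β (c - q y / 2)| ≤ K * |x - y| / 2 := fun c x y => by
    refine (hβd _ _).trans ?_
    rw [show c - q x / 2 - (c - q y / 2) = -((q x - q y) / 2) by ring, abs_neg, abs_div, abs_two]
    have := mul_le_mul_of_nonneg_left (hqlip x y) K.2
    change (K : ℝ) * |q x - q y| ≤ K * |x - y| at this
    linarith
  have hβp : ∀ c x y, |β (c + q x / 2) - β (c + q y / 2)| ≤ K * |x - y| / 2 := fun c x y => by
    refine (hβd _ _).trans ?_
    rw [show c + q x / 2 - (c + q y / 2) = (q x - q y) / 2 by ring, abs_div, abs_two]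
    have := mul_le_mul_of_nonneg_left (hqlip x y) K.2
    change (K : ℝ) * |q x - q y| ≤ K * |x - y| at this
    linarith
  have hFd : ∀ x y, |F (q x) - F (q y)| ≤ KF * |x - y| := fun x y =>
    (hKF.dist_le_mul _ (hqmem x) _ (hqmem y)).trans
      (mul_le_mul_of_nonneg_left (hqlip x y) KF.2)
  have hnum_d : ∀ c x y, |num c x - num c y| ≤ (2 * KF + K) * |x - y| := fun c x y => by
    have h1 := abs_le.1 (hFd x y)
    have h2 := abs_le.1 (hβm c x y)
    have h3 := abs_le.1 (hβp c x y)
    exact abs_le.2 ⟨by simp only [hnum]; linarith [h1.1, h2.2, h3.2],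
      by simp only [hnum]; linarith [h1.2, h2.1, h3.1]⟩
  have hden_d : ∀ c x y, |den c y - den c x| ≤ K / 2 * |x - y| := fun c x y => by
    have h2 := abs_le.1 (hβm c x y)
    have h3 := abs_le.1 (hβp c x y)
    exact abs_le.2 ⟨by simp only [hden]; linarith [h2.2, h3.1],
      by simp only [hden]; linarith [h2.1, h3.2]⟩
  have hlip : ∀ c, LipschitzWith
      (Real.toNNReal ((2 * KF + K) / v + CN * (K / 2) / (v * v))) fun x => num c x / den c x := by
    refine fun c => LipschitzWith.of_dist_le' fun x y => ?_
    rw [Real.dist_eq, Real.dist_eq]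
    have hx := hden_pos c x
    have hy := hden_pos c y
    have heq : num c x / den c x - num c y / den c y = (num c x - num c y) / den c x +
        num c y * (den c y - den c x) / (den c x * den c y) := by
      field_simp
      ring
    rw [heq, add_mul]
    refine (abs_add_le _ _).trans (add_le_add ?_ ?_)
    · rw [abs_div, abs_of_pos hx, div_mul_eq_mul_div]
      exact div_le_div₀ (by positivity) (hnum_d c x y) hvpos (hden_ge c x)
    · rw [abs_div, abs_mul, abs_of_pos (mul_pos hx hy),
        show CN * (K / 2) / (v * v) * |x - y| = CN * (K / 2 * |x - y|) / (v * v) by ring]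
      exact div_le_div₀ (by positivity) (mul_le_mul (hnum_le c y) (hden_d c x y) (abs_nonneg _) hCN0)
        (mul_pos hvpos hvpos) (mul_le_mul (hden_ge c x) (hden_ge c y) hvpos.le hx.le)
  have hβc := hβ.continuous
  obtain ⟨D, hD1, hD2, hD3, hD4, hD5⟩ := exists_periodic_reflected
    (G := fun c x => num c x / den c x) (C := ⟨CN / v, by positivity⟩) (ε := ε) (top := Dm) (L := L)
    hlip (fun x => (by fun_prop : Continuous fun c => num c x).div (by fun_prop)
      fun c => (hden_pos c x).ne')
    (fun c x => by
      rw [Real.norm_eq_abs, abs_div, abs_of_pos (hden_pos c x)]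
      exact div_le_div₀ hCN0 (hnum_le c x) hvpos (hden_ge c x))
    (fun c x => by
      simp only [hnum, hden, show c + L - q x / 2 = c - q x / 2 + L by ring,
        show c + L + q x / 2 = c + q x / 2 + L by ring, hper _])
    hε.2.le (fun c x hx => div_pos (by
      have : q x = ε := max_eq_left ((min_le_left _ _).trans hx)
      simp only [hnum, this]
      linarith [hM (c - ε / 2), hM (c + ε / 2), (hm 0).trans (hM 0)]) (hden_pos c x))
  refine ⟨D, _, ε, hε.1, hε.2.le, hD1, hD2, hD3, fun c hc => ?_, fun c hc => ?_⟩
  · have := hD4 c hc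
    simp only [hnum, hden, hqid _ (hD2 c)] at this
    exact this
  · have h1 := (le_div_iff₀ (hden_pos c Dm)).1 (hD5 c hc)
    have h2 : q Dm = Dm := hqid _ ⟨hε.2.le, le_rfl⟩
    simp only [hnum, h2, hF.eq_zero] at h1
    linarith

/-- A positive continuous `L`-periodic field on the line has a solution `B` that advances by `L` in
a fixed time. -/
theorem exists_autonomous_flow {h : ℝ → ℝ} (hc : Continuous h) (hpos : ∀ y, 0 < h y) (hL : 0 < L)
    (hper : Function.Periodic h L) :
    ∃ (T : ℝ) (B : ℝ → ℝ), 0 < T ∧ (∀ t, HasDerivAt B (h (B t)) t) ∧ ∀ t, B (t + T) = B t + L := by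
  have hic : Continuous fun y => (h y)⁻¹ := hc.inv₀ fun y => (hpos y).ne'
  set Θ : ℝ → ℝ := fun y => ∫ x in (0 : ℝ)..y, (h x)⁻¹ with hΘ
  have hd : ∀ y, HasDerivAt Θ (h y)⁻¹ y := fun y => hic.integral_hasStrictDerivAt 0 y |>.hasDerivAt
  have hmono : StrictMono Θ := strictMono_of_deriv_pos fun y => by
    rw [(hd y).deriv]; exact inv_pos.2 (hpos y)
  have hcont : Continuous Θ := continuous_iff_continuousAt.2 fun y => (hd y).continuousAt
  have hT : 0 < Θ L := by
    have := hmono hL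
    simpa [hΘ] using this
  have hadd : ∀ y, Θ (y + L) = Θ y + Θ L := fun y => by
    have h1 := intervalIntegral.integral_add_adjacent_intervals
      (hic.intervalIntegrable 0 y) (hic.intervalIntegrable (μ := volume) y (y + L))
    have hper' : Function.Periodic (fun x => (h x)⁻¹) L := fun x => by simp only [hper x]
    have h2 := hper'.intervalIntegral_add_eq y 0
    rw [zero_add] at h2
    simp only [hΘ]
    rw [← h1, h2]
  obtain ⟨B, hBc, -, hΘB, hBΘ⟩ := exists_continuous_inverse hcont hmono
    (tendsto_atTop_of_add hT hmono.monotone hadd) (tendsto_atBot_of_add hT hmono.monotone hadd)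
  refine ⟨Θ L, B, hT, fun t => ?_, fun t => ?_⟩
  · have := HasDerivAt.of_local_left_inverse hBc.continuousAt (hd (B t))
      (inv_pos.2 (hpos (B t))).ne' (Eventually.of_forall hΘB)
    rwa [inv_inv] at this
  · apply hmono.injective
    rw [hΘB, hadd, hΘB]

/-- **Existence of a pulsating motion.** The orbit is the `L`-periodic width `D` as a function of
the centre of the support; both end points advance along this orbit, which can therefore
be run through with the speed prescribed by the law at the front. -/
theorem exists_pulsatingMotion (hF : IsForce F Dm) (hL : 0 < L) (hper : Function.Periodic β L)
    {K : NNReal} (hβ : LipschitzWith K β) {M m : ℝ} (hM : ∀ x, β x ≤ M) (hm : ∀ x, m ≤ β x)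
    (hS : M - m < S) : ∃ T A B, IsPulsatingMotion F S Dm β L T A B := by
  obtain ⟨D, C, ε, hε, -, hDlip, hDmem, hDper, hDd, hDtop⟩ :=
    exists_periodic_width hF hper hβ hM hm hS
  have hβc := hβ.continuous
  have hDc := hDlip.continuous
  have hDI : ∀ c, D c ∈ Ioc 0 Dm := fun c => ⟨hε.trans_le (hDmem c).1, (hDmem c).2⟩
  have hFD : Continuous fun c => F (D c) :=
    hF.continuousOn.comp_continuous hDc hDI
  set a : ℝ → ℝ := fun c => c - D c / 2 with ha
  set b : ℝ → ℝ := fun c => c + D c / 2 with hb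
  have hac : Continuous a := by fun_prop
  have hbc : Continuous b := by fun_prop
  have hba : ∀ c, b c - a c = D c := fun c => by simp only [ha, hb]; ring
  set H : ℝ → ℝ := fun c => F (D c) + S - β (b c) with hH
  set Q : ℝ → ℝ := fun c => β (a c) - F (D c) with hQ
  set V : ℝ → ℝ := fun c => (S + β (a c) - β (b c)) / 2 with hV
  have hHc : Continuous H := (hFD.add continuous_const).sub (hβc.comp hbc)
  have hQc : Continuous Q := (hβc.comp hac).sub hFD
  have hVc : Continuous V := by fun_prop
  have hHQV : ∀ c, H c + Q c = 2 * V c := fun c => by simp only [hH, hQ, hV]; ring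
  set v := (S + m - M) / 2 with hv
  have hvpos : 0 < v := by simp only [hv]; linarith
  have hVge : ∀ c, v ≤ V c := fun c => by
    simp only [hv, hV]; linarith [hm (a c), hM (b c)]
  have hVpos : ∀ c, 0 < V c := fun c => hvpos.trans_le (hVge c)
  have hDd' : ∀ c, D c < Dm → HasDerivAt D ((H c - Q c) / V c) c := fun c hc => by
    have := hDd c hc
    convert! this using 2
    simp only [hH, hQ, ha, hb]; ring
  have hbd : ∀ c, D c < Dm → HasDerivAt b (H c / V c) c := fun c hc => by
    have := (hasDerivAt_id c).add ((hDd' c hc).div_const 2)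
    convert! this using 1
    have := (hVpos c).ne'
    field_simp
    linarith [hHQV c]
  have had : ∀ c, D c < Dm → HasDerivAt a (Q c / V c) c := fun c hc => by
    have := (hasDerivAt_id c).sub ((hDd' c hc).div_const 2)
    convert! this using 1
    have := (hVpos c).ne'
    field_simp
    linarith [hHQV c]
  have htop : ∀ c, D c = Dm → Q c ≤ H c := fun c hc => by
    have := hDtop c hc
    simp only [hH, hQ, ha, hb, hc, hF.eq_zero]
    linarith
  have hDeq : ∀ c, D c < Dm ∨ D c = Dm := fun c => (hDI c).2.lt_or_eq
  have hβd : ∀ x y, β x - β y ≤ K * |x - y| := fun x y =>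
    (le_abs_self _).trans (hβ.dist_le_mul x y)
  -- the front point advances along the orbit
  have hHpos : ∀ c, 0 < H c := fun c => by
    have hlt : ∀ x, H x < V x / 2 → D x < Dm := fun x hx => by
      refine (hDeq x).resolve_right fun h => ?_
      linarith [htop x h, hHQV x, hVpos x]
    refine pos_of_drift (E := fun x => -D x) (y := b) (N := fun _ => -1) (V := V) (R := Dm)
      (K := K) hDc.neg hbc continuous_const hHc hVc K.2 hvpos hVge ?_ ?_ ?_ ?_ ?_
      (c := c) (by norm_num)
    · intro x z; linarith [(hDI x).1, (hDI z).2]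
    · intro x hx _
      refine ⟨_, ?_, (hDd' x (hlt x hx)).neg⟩
      rw [ge_iff_le, ← neg_div, le_div_iff₀ (hVpos x)]
      linarith [hHQV x]
    · exact fun x hx _ => hbd x (hlt x hx)
    · intro x z _ _; norm_num
    · intro x z hxz hz
      have h1 : F (D x) ≤ F (D z) := hF.antitoneOn (hDI z) (hDI x) (by linarith)
      have h2 := hβd (b z) (b x)
      have h3 : H z = F (D z) + S - β (b z) := rfl
      have h4 : H x = F (D x) + S - β (b x) := rfl
      linarith
  -- so does the rear point, where it is not reflected
  have hQpos : ∀ c, D c < Dm → 0 < Q c := fun c hc => by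
    refine pos_of_drift (E := D) (y := a) (N := fun x => D x - Dm) (V := V) (R := Dm)
      (K := K) hDc hac (by fun_prop) hQc hVc K.2 hvpos hVge ?_ ?_ ?_ ?_ ?_ (c := c) (by linarith)
    · intro x z; linarith [(hDI z).1, (hDI x).2]
    · intro x hx hN
      refine ⟨_, ?_, hDd' x (by linarith)⟩
      rw [ge_iff_le, le_div_iff₀ (hVpos x)]
      linarith [hHQV x]
    · exact fun x hx hN => had x (by linarith)
    · intro x z _ _; linarith
    · intro x z hxz hz
      have h1 : F (D z) ≤ F (D x) := hF.antitoneOn (hDI x) (hDI z) hxz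
      have h2 := hβd (a x) (a z)
      rw [abs_sub_comm] at h2
      have h3 : Q z = β (a z) - F (D z) := rfl
      have h4 : Q x = β (a x) - F (D x) := rfl
      linarith
  have haL : ∀ c, a (c + L) = a c + L := fun c => by simp only [ha, hDper c]; ring
  have hbL : ∀ c, b (c + L) = b c + L := fun c => by simp only [hb, hDper c]; ring
  have hHper : Function.Periodic H L := fun c => by simp only [hH, hDper c, hbL, hper (b c)]
  obtain ⟨h₀, hh₀, hHge⟩ := exists_pos_le_of_periodic hL hHc hHper hHpos
  obtain ⟨h₁, hHle⟩ := exists_le_of_periodic hL hHc hHper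
  obtain ⟨V₁, hVle⟩ : ∃ V₁, ∀ c, V c ≤ V₁ :=
    ⟨(S + M - m) / 2, fun c => by simp only [hV]; linarith [hm (b c), hM (a c)]⟩
  have hV₁ : 0 < V₁ := (hVpos 0).trans_le (hVle 0)
  have habl : ∀ σ : ℝ, |σ| ≤ 1 → LipschitzWith (1 + C) fun c => c + σ * D c / 2 := fun σ hσ => by
    refine LipschitzWith.of_dist_le_mul fun x y => ?_
    have h1 := hDlip.dist_le_mul x y
    rw [Real.dist_eq, Real.dist_eq] at h1 ⊢
    have h2 : x + σ * D x / 2 - (y + σ * D y / 2) = (x - y) + σ * ((D x - D y) / 2) := by ring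
    rw [h2]
    refine (abs_add_le _ _).trans ?_
    rw [abs_mul, abs_div, abs_two]
    push_cast
    have h3 : |σ| * (|D x - D y| / 2) ≤ 1 * (|D x - D y| / 2) :=
      mul_le_mul_of_nonneg_right hσ (by positivity)
    linarith [abs_nonneg (D x - D y)]
  have hbl : LipschitzWith (1 + C) b := by simpa using habl 1 (by simp)
  have hal : LipschitzWith (1 + C) a := by
    simpa [ha, sub_eq_add_neg, neg_div] using habl (-1) (by simp)
  -- `b` expands distances, since its derivative is `H / V` or, on the obstacle, `1`
  set δ := min (h₀ / V₁) 1 with hδ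
  have hδpos : 0 < δ := lt_min (div_pos hh₀ hV₁) one_pos
  have hbexp : ∀ s t, s ≤ t → δ * (t - s) ≤ b t - b s := fun s t hst => by
    refine mul_le_sub_of_ae_le_deriv hst
      (absCont_of_lipschitzOnWith hbl.lipschitzOnWith hst (subset_univ _))
      (Eventually.of_forall fun x _ hd => ?_)
    rcases hDeq x with hx | hx
    · rw [(hbd x hx).deriv]
      exact (min_le_left _ _).trans (div_le_div₀ (hHpos x).le (hHge x) (hVpos x) (hVle x))
    · have hDdiff : HasDerivAt D (2 * (deriv b x - 1)) x := by
        have := (hd.hasDerivAt.sub (hasDerivAt_id x)).const_mul 2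
        convert! this using 1
        ext y; simp [hb]; ring
      have hmax : IsLocalMax D x := Eventually.of_forall fun y => by rw [hx]; exact (hDI y).2
      have := hmax.hasDerivAt_eq_zero hDdiff
      exact (min_le_right _ _).trans (by linarith)
  have hbmono : StrictMono b := fun s t hst => by
    have := hbexp s t hst.le
    have := mul_pos hδpos (sub_pos.2 hst)
    linarith
  have hamono : StrictMono a := by
    have hmono : Monotone a := fun s t hst => by
      have := mul_le_sub_of_ae_le_deriv (f := a) (c := 0) hst
        (absCont_of_lipschitzOnWith hal.lipschitzOnWith hst (subset_univ _))
        (Eventually.of_forall fun x _ hd => ?_)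
      · linarith
      rcases hDeq x with hx | hx
      · rw [(had x hx).deriv]; exact (div_pos (hQpos x hx) (hVpos x)).le
      · have hDdiff : HasDerivAt D (2 * (1 - deriv a x)) x := by
          have := ((hasDerivAt_id x).sub hd.hasDerivAt).const_mul 2
          convert! this using 1
          ext y; simp [ha]; ring
        have hmax : IsLocalMax D x := Eventually.of_forall fun y => by rw [hx]; exact (hDI y).2
        have := hmax.hasDerivAt_eq_zero hDdiff
        linarith
    -- on an interval where `a` is constant the width is `Dm`, and then `a` is not constant
    refine hmono.strictMono_of_injective fun s t hst => ?_
    by_contra hne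
    wlog hlt : s < t generalizing s t
    · exact this t s hst.symm (Ne.symm hne) (lt_of_le_of_ne (not_lt.1 hlt) (Ne.symm hne))
    have hconst : ∀ x ∈ Icc s t, a x = a s := fun x hx =>
      le_antisymm ((hmono hx.2).trans_eq hst.symm) (hmono hx.1)
    have hDx : ∀ x ∈ Ioo s t, D x = Dm := fun x hx => by
      refine (hDeq x).resolve_left fun hxD => ?_
      have h0 : HasDerivAt a 0 x := (hasDerivAt_const x (a s)).congr_of_eventuallyEq <| by
        filter_upwards [Icc_mem_nhds hx.1 hx.2] with y hy
        exact hconst y hy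
      have := (had x hxD).unique h0
      exact (div_pos (hQpos x hxD) (hVpos x)).ne' this
    obtain ⟨x, hx⟩ := exists_between hlt
    obtain ⟨y, hy⟩ := exists_between hx.2
    have h1 := hconst x ⟨hx.1.le, hx.2.le⟩
    have h2 := hconst y ⟨(hx.1.trans hy.1).le, hy.2.le⟩
    rw [← h1] at h2
    simp only [ha, hDx x hx, hDx y ⟨hx.1.trans hy.1, hy.2⟩] at h2
    linarith [hy.1]
  obtain ⟨bi, hbic, hbim, hbbi, hbib⟩ := exists_continuous_inverse hbc hbmono
    (tendsto_atTop_of_add hL hbmono.monotone hbL) (tendsto_atBot_of_add hL hbmono.monotone hbL)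
  have hbiL : ∀ y, bi (y + L) = bi y + L := fun y => by
    apply hbmono.injective
    rw [hbbi, hbL, hbbi]
  have hbil : LipschitzWith (Real.toNNReal δ⁻¹) bi := by
    refine LipschitzWith.of_dist_le' fun x y => ?_
    wlog hxy : x ≤ y generalizing x y
    · rw [dist_comm, dist_comm x]; exact this y x (le_of_not_ge hxy)
    have h1 := hbexp (bi x) (bi y) (hbim.monotone hxy)
    rw [hbbi, hbbi] at h1
    rw [dist_comm, dist_comm x, Real.dist_eq, Real.dist_eq, abs_of_nonneg (sub_nonneg.2 hxy),
      abs_of_nonneg (sub_nonneg.2 (hbim.monotone hxy)), inv_mul_eq_div, le_div_iff₀ hδpos]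
    linarith
  obtain ⟨T, B, hT, hBd, hBT⟩ := exists_autonomous_flow (h := fun y => H (bi y))
    (hHc.comp hbic) (fun y => hHpos _) hL fun y => by simp only [hbiL, hHper (bi y)]
  set σ : ℝ → ℝ := fun t => bi (B t) with hσ
  set A : ℝ → ℝ := fun t => a (σ t) with hA
  have hbσ : ∀ t, b (σ t) = B t := fun t => hbbi _
  have hwidth : ∀ t, B t - A t = D (σ t) := fun t => by rw [← hbσ, hA]; exact hba _
  have hBl : LipschitzWith (Real.toNNReal h₁) B :=
    lipschitzWith_of_nnnorm_deriv_le (fun t => (hBd t).differentiableAt) fun t => by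
      rw [(hBd t).deriv, ← NNReal.coe_le_coe, coe_nnnorm, Real.norm_eq_abs,
        abs_of_pos (hHpos _)]
      exact (hHle _).trans (Real.le_coe_toNNReal _)
  have hAl : LipschitzWith _ A := hal.comp (hbil.comp hBl)
  have hσT : ∀ t, σ (t + T) = σ t + L := fun t => by simp only [hσ, hBT, hbiL]
  have hBm : StrictMono B := strictMono_of_deriv_pos fun t => by
    rw [(hBd t).deriv]; exact hHpos _
  have hrear : ∀ t, D (σ t) < Dm → HasDerivAt A (Q (σ t)) t := fun t ht => by
    have h1 : HasDerivAt bi (H (σ t) / V (σ t))⁻¹ (B t) :=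
      HasDerivAt.of_local_left_inverse hbic.continuousAt (hbd (σ t) ht)
        (div_pos (hHpos _) (hVpos _)).ne' (Eventually.of_forall hbbi)
    have h2 := (had (σ t) ht).comp t (h1.comp t (hBd t))
    convert! h2 using 1
    have := (hVpos (σ t)).ne'
    have := (hHpos (σ t)).ne'
    change Q (σ t) = Q (σ t) / V (σ t) * ((H (σ t) / V (σ t))⁻¹ * H (σ t))
    field_simp
  refine ⟨T, A, B, ⟨⟨_, hAl.lipschitzOnWith⟩, ⟨_, hBl.lipschitzOnWith⟩, fun t _ => ?_,
    fun t _ => ?_, ?_, ?_, ?_⟩, hT, fun t => ?_, hBT, ?_, fun t => ?_⟩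
  · have := (hDI (σ t)).1; rw [← hwidth] at this; linarith
  · rw [hwidth]; exact (hDI _).2
  · refine Eventually.of_forall fun t _ => ?_
    rw [(hBd t).deriv, hwidth]
    exact congrArg (F (D (σ t)) + S - β ·) (hbσ t)
  · filter_upwards [(hAl.lipschitzOnWith (s := univ)).ae_differentiableWithinAt_of_mem] with t ht _
    have hd : DifferentiableAt ℝ A t := (ht trivial).differentiableAt univ_mem
    rcases hDeq (σ t) with h | h
    · rw [(hrear t h).deriv, hwidth]
    · have hmax : IsLocalMax (fun s => B s - A s) t := Eventually.of_forall fun s => by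
        simp only [hwidth, h]; exact (hDI _).2
      have h1 := hmax.hasDerivAt_eq_zero ((hBd t).sub hd.hasDerivAt)
      have h2 : H (σ t) - deriv A t = 0 := h1
      rw [hwidth]
      exact (htop (σ t) h).trans_eq (by linarith)
  · refine Eventually.of_forall fun t _ ht => ?_
    rw [hwidth] at ht
    rw [(hrear t ht).deriv, hwidth]
  · simp only [hA, hσT, haL]
  · exact hamono.comp (hbim.comp hBm)
  · rw [hwidth, ← hbσ]; exact hHpos _

end Motion

/-! ### The Euler–Lagrange equation is sufficient -/

theorem deriv_eq_zero_of_notMem_Icc {a b x : ℝ} {v : ℝ → ℝ} (hv : ∀ x, x ∉ Ioo a b → v x = 0)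
    (hx : x ∉ Icc a b) : deriv v x = 0 := by
  have : v =ᶠ[𝓝 x] fun _ => (0 : ℝ) := by
    filter_upwards [isClosed_Icc.isOpen_compl.mem_nhds hx] with y hy
    exact hv y fun h => hy (Ioo_subset_Icc_self h)
  rw [this.deriv_eq, deriv_const]

/-- The integrand of the energy. -/
noncomputable def energyDensity (κ α : ℝ) (v : ℝ → ℝ) (x : ℝ) : ℝ :=
  1 / 2 * (deriv v x) ^ 2 + (v x) ^ 2 / 2 * (κ * Real.cos α) - v x * x * (κ * Real.sin α)

theorem MemH10.energy_eq {κ α a b : ℝ} {v : ℝ → ℝ} (hab : a ≤ b) (hv : MemH10 a b v) :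
    IntervalIntegrable (energyDensity κ α v) volume a b ∧
      energy κ α v = ∫ x in a..b, energyDensity κ α v x := by
  have hvc : ContinuousOn v (uIcc a b) := hv.abs_cont.continuousOn
  constructor
  · refine IntervalIntegrable.sub (IntervalIntegrable.add ?_ ?_) ?_
    · refine IntervalIntegrable.const_mul ?_ _
      rw [intervalIntegrable_iff_integrableOn_Ioo_of_le hab]
      exact hv.deriv_sq_int.integrable_sq
    · exact ContinuousOn.intervalIntegrable (by fun_prop)
    · exact ContinuousOn.intervalIntegrable (by fun_prop)
  · rw [intervalIntegral.integral_of_le hab, ← integral_Icc_eq_integral_Ioc]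
    refine (setIntegral_eq_integral_of_forall_compl_eq_zero fun x hx => ?_).symm
    have h1 := deriv_eq_zero_of_notMem_Icc hv.eq_zero hx
    have h2 := hv.eq_zero x fun h => hx (Ioo_subset_Icc_self h)
    simp [h1, h2]

/-- **Sufficiency of the Euler–Lagrange equation.** Let `g` solve `g'' = k g - s x - Λ` and vanish at
the ends of `(a, b)`, with `g ≥ 0` and `∫ g = V₀`. If `a₀ = a`, or if `a₀ ≤ a` and `g'(a) = 0`,
`s a + Λ ≤ 0`, then `g`, extended by zero, is the only minimizer of the energy on `(a₀, b)`: the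
first variation in any admissible direction is nonnegative and the energy is strictly convex. -/
theorem isArgmin_of_euler_lagrange {V₀ κ α a₀ a b Λ : ℝ} {g g' : ℝ → ℝ}
    (hk : 0 < κ * Real.cos α) (hs : 0 < κ * Real.sin α) (ha₀ : a₀ ≤ a) (hab : a < b)
    (hg : ∀ x, HasDerivAt g (g' x) x)
    (hg' : ∀ x, HasDerivAt g' (κ * Real.cos α * g x - κ * Real.sin α * x - Λ) x)
    (hga : g a = 0) (hgb : g b = 0) (hpos : ∀ x ∈ Ioo a b, 0 ≤ g x)
    (hint : ∫ x in a..b, g x = V₀)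
    (hcase : a₀ = a ∨ (g' a = 0 ∧ κ * Real.sin α * a + Λ ≤ 0)) :
    IsArgmin V₀ κ α a₀ b ((Ioo a b).indicator g) ∧
      ∀ v, IsArgmin V₀ κ α a₀ b v → v = (Ioo a b).indicator g := by
  set k := κ * Real.cos α with hkdef
  set s := κ * Real.sin α with hsdef
  set w := (Ioo a b).indicator g with hw
  have ha₀b : a₀ < b := ha₀.trans_lt hab
  have hgc : Continuous g := continuous_iff_continuousAt.2 fun x => (hg x).continuousAt
  have hgc' : Continuous g' := continuous_iff_continuousAt.2 fun x => (hg' x).continuousAt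
  have hwIoo : ∀ x ∈ Ioo a b, w x = g x := fun x hx => indicator_of_mem hx g
  have hw0 : ∀ x, x ∉ Ioo a b → w x = 0 := fun x hx => indicator_of_notMem hx g
  have hwd : ∀ x ∈ Ioo a b, deriv w x = g' x := fun x hx => by
    have : w =ᶠ[𝓝 x] g := by
      filter_upwards [Ioo_mem_nhds hx.1 hx.2] with y hy using hwIoo y hy
    rw [this.deriv_eq, (hg x).deriv]
  have hwd0 : ∀ x, x ∉ Icc a b → deriv w x = 0 := fun x hx => deriv_eq_zero_of_notMem_Icc hw0 hx
  obtain ⟨C, hC⟩ := isCompact_Icc.exists_bound_of_continuousOn (s := Icc a b) hgc'.continuousOn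
  have hC0 : 0 ≤ C := (norm_nonneg _).trans (hC a (left_mem_Icc.2 hab.le))
  have hae : ∀ᵐ x : ℝ, x ≠ a ∧ x ≠ b := by
    filter_upwards [(measure_singleton (μ := volume) a).le.antisymm bot_le |> compl_mem_ae_iff.2,
      (measure_singleton (μ := volume) b).le.antisymm bot_le |> compl_mem_ae_iff.2] with x h1 h2
    exact ⟨h1, h2⟩
  have hwclamp : w = fun x => g (max a (min x b)) := by
    ext x
    rcases le_or_gt x a with h | h
    · rw [hw0 x fun hx => absurd hx.1 (not_lt.2 h), max_eq_left ((min_le_left _ _).trans h), hga]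
    · rcases le_or_gt b x with h' | h'
      · rw [hw0 x fun hx => absurd hx.2 (not_lt.2 h'), min_eq_right h', max_eq_right hab.le, hgb]
      · rw [hwIoo x ⟨h, h'⟩, min_eq_left h'.le, max_eq_right h.le]
  have hwAC : AbsolutelyContinuousOnInterval w a₀ b := by
    have hgl : LipschitzOnWith (Real.toNNReal C) g (Icc a b) :=
      (convex_Icc a b).lipschitzOnWith_of_nnnorm_hasDerivWithin_le
        (fun x _ => (hg x).hasDerivWithinAt) fun x hx => by
        rw [← NNReal.coe_le_coe, coe_nnnorm]
        exact (hC x hx).trans (Real.le_coe_toNNReal _)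
    have hcl : LipschitzWith 1 fun x : ℝ => max a (min x b) :=
      (LipschitzWith.id.min_const b).const_max a
    refine LipschitzOnWith.absolutelyContinuousOnInterval (K := Real.toNNReal C * 1) ?_
    rw [hwclamp]
    exact hgl.comp (hcl.lipschitzOnWith) fun x _ => ⟨le_max_left _ _, max_le hab.le (min_le_right _ _)⟩
  have hwH : MemH10 a₀ b w :=
    { eq_zero := fun x hx => hw0 x fun h => hx ⟨ha₀.trans_lt h.1, h.2⟩
      abs_cont := hwAC
      deriv_sq_int := by
        refine MemLp.of_bound (measurable_deriv w).aestronglyMeasurable C ?_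
        refine ae_restrict_of_ae ?_
        filter_upwards [hae] with x hx
        by_cases hxI : x ∈ Icc a b
        · rw [hwd x ⟨lt_of_le_of_ne hxI.1 (Ne.symm hx.1), lt_of_le_of_ne hxI.2 hx.2⟩]
          exact hC x hxI
        · rw [hwd0 x hxI, norm_zero]; exact hC0 }
  have hwV : ∫ x in a₀..b, w x = V₀ := by
    rw [intervalIntegral.integral_of_le ha₀b.le, hw, setIntegral_indicator measurableSet_Ioo,
      ← hint, intervalIntegral.integral_of_le hab.le, integral_Ioc_eq_integral_Ioo]
    congr 2
    ext x
    exact ⟨fun h => h.2, fun h => ⟨⟨ha₀.trans_lt h.1, h.2.le⟩, h⟩⟩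
  have hwadm : Admissible V₀ a₀ b w := ⟨hwH, fun x => by
    by_cases hx : x ∈ Ioo a b
    · rw [hwIoo x hx]; exact hpos x hx
    · rw [hw0 x hx], hwV⟩
  -- the energy grows at least quadratically away from `w`
  have key : ∀ v, Admissible V₀ a₀ b v →
      k / 2 * ∫ x in a₀..b, (v x - w x) ^ 2 ≤ energy κ α v - energy κ α w := by
    rintro v ⟨hvH, hv0, hvV⟩
    set d : ℝ → ℝ := fun x => v x - w x with hd
    have hdAC : AbsolutelyContinuousOnInterval d a₀ b := hvH.abs_cont.fun_sub hwAC
    have hdc := hdAC.continuousOn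
    have hvc := hvH.abs_cont.continuousOn
    have hwc := hwAC.continuousOn
    have hsub₁ : uIcc a₀ a ⊆ uIcc a₀ b := by
      rw [uIcc_of_le ha₀, uIcc_of_le ha₀b.le]; exact Icc_subset_Icc_right hab.le
    have hsub₂ : uIcc a b ⊆ uIcc a₀ b := by
      rw [uIcc_of_le hab.le, uIcc_of_le ha₀b.le]; exact Icc_subset_Icc_left ha₀
    have hdAC₂ := hdAC.mono hsub₂
    have hgAC' : AbsolutelyContinuousOnInterval g' a b := by
      refine ContDiffOn.absolutelyContinuousOnInterval (ContDiff.contDiffOn ?_)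
      rw [contDiff_one_iff_deriv]
      refine ⟨fun x => (hg' x).differentiableAt, ?_⟩
      rw [show deriv g' = fun x => k * g x - s * x - Λ from funext fun x => (hg' x).deriv]
      fun_prop
    set Z : ℝ → ℝ := fun x => deriv w x * deriv d x + (k * w x - s * x - Λ) * d x with hZ
    -- left of `a` only the constraint force acts
    have hZ₁ : ∀ᵐ x, x ∈ uIoc a₀ a → Z x = -(s * x + Λ) * v x := by
      filter_upwards [hae] with x hx hxI
      rw [uIoc_of_le ha₀] at hxI
      have h1 : x < a := lt_of_le_of_ne hxI.2 hx.1
      have h2 : w x = 0 := hw0 x fun h => absurd h.1 (not_lt.2 h1.le)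
      have h3 : deriv w x = 0 := hwd0 x fun h => absurd h.1 (not_le.2 h1)
      simp only [hZ, hd, h2, h3]
      ring
    have hZ₂ : ∀ᵐ x, x ∈ uIoc a b → Z x = deriv g' x * d x + g' x * deriv d x := by
      filter_upwards [hae] with x hx hxI
      rw [uIoc_of_le hab.le] at hxI
      have h1 : x ∈ Ioo a b := ⟨hxI.1, lt_of_le_of_ne hxI.2 hx.2⟩
      simp only [hZ, hwd x h1, hwIoo x h1, (hg' x).deriv]
      ring
    have hI₁ : IntervalIntegrable (fun x => -(s * x + Λ) * v x) volume a₀ a :=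
      ContinuousOn.intervalIntegrable ((by fun_prop : Continuous fun x : ℝ =>
        -(s * x + Λ)).continuousOn.mul (hvc.mono hsub₁))
    have hI₂ : IntervalIntegrable (fun x => deriv g' x * d x + g' x * deriv d x) volume a b :=
      (hgAC'.intervalIntegrable_deriv.mul_continuousOn hdAC₂.continuousOn).add
        (hdAC₂.intervalIntegrable_deriv.continuousOn_mul hgAC'.continuousOn)
    have hZi₁ : IntervalIntegrable Z volume a₀ a :=
      hI₁.congr_ae ((ae_restrict_iff' measurableSet_uIoc).2 (hZ₁.mono fun x h hx => (h hx).symm))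
    have hZi₂ : IntervalIntegrable Z volume a b :=
      hI₂.congr_ae ((ae_restrict_iff' measurableSet_uIoc).2 (hZ₂.mono fun x h hx => (h hx).symm))
    have hdb : d b = 0 := by
      simp only [hd, hvH.eq_zero b (by simp), hw0 b (by simp), sub_zero]
    have hda : d a = v a := by simp only [hd, hw0 a (by simp), sub_zero]
    have hZnonneg : 0 ≤ ∫ x in a₀..b, Z x := by
      rw [← intervalIntegral.integral_add_adjacent_intervals hZi₁ hZi₂,
        intervalIntegral.integral_congr_ae hZ₁, intervalIntegral.integral_congr_ae hZ₂,
        hgAC'.integral_deriv_mul_eq_sub hdAC₂, hdb, hda, mul_zero, zero_sub]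
      rcases hcase with rfl | ⟨h1, h2⟩
      · rw [intervalIntegral.integral_same, hvH.eq_zero a₀ (by simp)]; simp
      · rw [h1, zero_mul, neg_zero, add_zero]
        refine intervalIntegral.integral_nonneg ha₀ fun x hx => mul_nonneg ?_ (hv0 x)
        have := mul_le_mul_of_nonneg_left hx.2 hs.le
        linarith
    have hdV : ∫ x in a₀..b, d x = 0 := by
      simp only [hd]
      rw [intervalIntegral.integral_sub hvc.intervalIntegrable hwc.intervalIntegrable, hvV, hwV,
        sub_self]
    obtain ⟨hvi, hve⟩ := hvH.energy_eq (κ := κ) (α := α) ha₀b.le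
    obtain ⟨hwi, hwe⟩ := hwH.energy_eq (κ := κ) (α := α) ha₀b.le
    have hd2i : IntervalIntegrable (fun x => k / 2 * d x ^ 2) volume a₀ b :=
      ContinuousOn.intervalIntegrable (by fun_prop)
    have hdi : IntervalIntegrable (fun x => Λ * d x) volume a₀ b :=
      ContinuousOn.intervalIntegrable (by fun_prop)
    have hZi := hZi₁.trans hZi₂
    calc k / 2 * ∫ x in a₀..b, d x ^ 2
        ≤ ∫ x in a₀..b, (k / 2 * d x ^ 2 + Λ * d x + Z x) := by
          rw [intervalIntegral.integral_add (hd2i.add hdi) hZi,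
            intervalIntegral.integral_add hd2i hdi, intervalIntegral.integral_const_mul,
            intervalIntegral.integral_const_mul, hdV]
          linarith
      _ ≤ ∫ x in a₀..b, (energyDensity κ α v x - energyDensity κ α w x) := by
          refine intervalIntegral.integral_mono_ae_restrict ha₀b.le ((hd2i.add hdi).add hZi)
            (hvi.sub hwi) ((ae_restrict_iff' measurableSet_Icc).2 ?_)
          filter_upwards [hvH.abs_cont.ae_differentiableAt, hwAC.ae_differentiableAt] with x h1 h2 hx
          rw [uIcc_of_le ha₀b.le] at h1 h2
          have h3 : deriv d x = deriv v x - deriv w x := deriv_fun_sub (h1 hx) (h2 hx)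
          have h4 : energyDensity κ α v x - energyDensity κ α w x =
              k / 2 * d x ^ 2 + Λ * d x + Z x + 1 / 2 * (deriv v x - deriv w x) ^ 2 := by
            simp only [energyDensity, hZ, h3, ← hkdef, ← hsdef]
            simp only [hd]
            ring
          linarith [sq_nonneg (deriv v x - deriv w x)]
      _ = energy κ α v - energy κ α w := by
          rw [intervalIntegral.integral_sub hvi hwi, hve, hwe]
  have hsq : ∀ v : ℝ → ℝ, 0 ≤ ∫ x in a₀..b, (v x - w x) ^ 2 := fun v =>
    intervalIntegral.integral_nonneg ha₀b.le fun x _ => sq_nonneg _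
  refine ⟨⟨hwadm, fun v hv => ?_⟩, fun v hv => ?_⟩
  · have := mul_nonneg (half_pos hk).le (hsq v)
    linarith [key v hv]
  · have h1 := key v hv.1
    have h2 := hv.2 w hwadm
    have h3 : ∫ x in a₀..b, (v x - w x) ^ 2 ≤ 0 := by
      by_contra! h
      have := mul_pos (half_pos hk) h
      linarith
    ext x
    by_contra hne
    have hxI : x ∈ Icc a₀ b := by
      by_contra hx
      exact hne ((hv.1.1.eq_zero x fun h => hx (Ioo_subset_Icc_self h)).trans
        (hwH.eq_zero x fun h => hx (Ioo_subset_Icc_self h)).symm)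
    have hc : ContinuousOn (fun x => (v x - w x) ^ 2) (Icc a₀ b) := by
      have h4 := hv.1.1.abs_cont.continuousOn
      have h5 := hwAC.continuousOn
      rw [uIcc_of_le ha₀b.le] at h4 h5
      fun_prop
    have := intervalIntegral.integral_pos ha₀b hc (fun x _ => sq_nonneg _)
      ⟨x, hxI, by have := sub_ne_zero.2 hne; positivity⟩
    linarith

open Real in
/-- `z coth z - 1`, the dimensionless function that governs both end slopes of the profile. -/
noncomputable def cothGap (z : ℝ) : ℝ := z * cosh z / sinh z - 1

/-- The slope at the left end of the symmetric part of the profile of width `D`, with `r² = k`. -/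
noncomputable def evenSlope (V₀ r D : ℝ) : ℝ := V₀ * r ^ 2 / (2 * cothGap (r * D / 2))

/-- The (downward) slope at both ends of the antisymmetric part of the profile of width `D`. -/
noncomputable def oddSlope (s r D : ℝ) : ℝ := s / r ^ 2 * cothGap (r * D / 2)

/-- The force at the rear contact point, half the square of the slope there. -/
noncomputable def rearForce (V₀ s r D : ℝ) : ℝ := (evenSlope V₀ r D - oddSlope s r D) ^ 2 / 2

open Real in
/-- The solution of the Euler–Lagrange equation on `[-D / 2, D / 2]` with zero boundary values and
integral `V₀`, as the sum of its symmetric and its antisymmetric part. -/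
noncomputable def centredProfile (V₀ s r D y : ℝ) : ℝ :=
  evenSlope V₀ r D * (cosh (r * D / 2) - cosh (r * y)) / (r * sinh (r * D / 2)) +
    s / r ^ 2 * (y - D / 2 * sinh (r * y) / sinh (r * D / 2))

open Real in
/-- The derivative of `centredProfile`. -/
noncomputable def centredProfileDeriv (V₀ s r D y : ℝ) : ℝ :=
  -(evenSlope V₀ r D * sinh (r * y) / sinh (r * D / 2)) +
    s / r ^ 2 * (1 - r * D / 2 * cosh (r * y) / sinh (r * D / 2))

/-- The profile of the drop with support `(a, b)`. -/
noncomputable def profile (V₀ s r a b : ℝ) : ℝ → ℝ :=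
  (Ioo a b).indicator fun x => centredProfile V₀ s r (b - a) (x - (a + b) / 2)

/-! ### Hyperbolic inequalities -/

section Hyperbolic

open Real

variable {z η : ℝ}

theorem sinh_add_sinh_le (hx : 0 ≤ z) (hy : 0 ≤ η) : sinh z + sinh η ≤ sinh (z + η) := by
  rw [sinh_add]
  have h1 := sinh_nonneg_iff.2 hx
  have h2 := sinh_nonneg_iff.2 hy
  nlinarith [one_le_cosh z, one_le_cosh η]

theorem sinh_lt_mul_cosh (hz : 0 < z) : sinh z < z * cosh z := by
  have hmono : StrictMonoOn (fun x => x * cosh x - sinh x) (Ici 0) := by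
    have hd : ∀ x, HasDerivAt (fun x => x * cosh x - sinh x)
        (1 * cosh x + x * sinh x - cosh x) x := fun x =>
      ((hasDerivAt_id x).mul (hasDerivAt_cosh x)).sub (hasDerivAt_sinh x)
    refine strictMonoOn_of_deriv_pos (convex_Ici 0) (by fun_prop) fun x hx => ?_
    rw [interior_Ici] at hx
    rw [(hd x).deriv]
    have := mul_pos (show 0 < x from hx) (sinh_pos_iff.2 hx)
    linarith
  have := hmono self_mem_Ici hz.le hz
  simp only [zero_mul, sinh_zero, sub_zero] at this
  linarith

theorem cothGap_pos (hz : 0 < z) : 0 < cothGap z := by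
  rw [cothGap, sub_pos, one_lt_div (sinh_pos_iff.2 hz)]
  exact sinh_lt_mul_cosh hz

theorem sub_one_le_cothGap (hz : 0 < z) : z - 1 ≤ cothGap z := by
  have h := sinh_pos_iff.2 hz
  rw [cothGap]
  have : z ≤ z * cosh z / sinh z := by
    rw [le_div_iff₀ h]
    exact mul_le_mul_of_nonneg_left (sinh_lt_cosh z).le hz.le
  linarith

theorem cothGap_le_cosh_sub_one (hz : 0 < z) : cothGap z ≤ cosh z - 1 := by
  have h := sinh_pos_iff.2 hz
  rw [cothGap]
  have : z * cosh z / sinh z ≤ cosh z := by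
    rw [div_le_iff₀ h, mul_comm]
    exact mul_le_mul_of_nonneg_left (self_le_sinh_iff.2 hz.le) (cosh_pos z).le
  linarith

theorem contDiffOn_cothGap : ContDiffOn ℝ 1 cothGap (Ioi 0) := by
  refine ContDiffOn.sub (ContDiffOn.div ?_ ?_ fun x hx => (sinh_pos_iff.2 hx).ne')
    contDiffOn_const
  · exact (contDiff_id.mul contDiff_cosh).contDiffOn
  · exact contDiff_sinh.contDiffOn

theorem strictMonoOn_cothGap : StrictMonoOn cothGap (Ioi 0) := by
  refine strictMonoOn_of_deriv_pos (convex_Ioi 0) contDiffOn_cothGap.continuousOn fun x hx => ?_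
  rw [interior_Ioi] at hx
  have h := sinh_pos_iff.2 hx
  have hd : HasDerivAt cothGap
      (((1 * cosh x + x * sinh x) * sinh x - x * cosh x * cosh x) / sinh x ^ 2) x :=
    (((hasDerivAt_id x).mul (hasDerivAt_cosh x)).div (hasDerivAt_sinh x) h.ne').sub_const 1
  rw [hd.deriv]
  refine div_pos ?_ (by positivity)
  have h1 : x < sinh x := self_lt_sinh_iff.2 hx
  have h2 := one_le_cosh x
  nlinarith [cosh_sq x]

/-- The inequality behind the positivity of the profile in the extreme case where its symmetric and
antisymmetric parts have the same end slopes. The difference of the two sides vanishes at `η = z`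
and is decreasing in `η`, by the superadditivity of `sinh`. -/
theorem mul_sinh_sub_lt (hη : 0 ≤ η) (hηz : η < z) :
    sinh z * (η * sinh z - z * sinh η) < (z * cosh z - sinh z) * (cosh z - cosh η) := by
  have hz : 0 < z := hη.trans_lt hηz
  set f : ℝ → ℝ := fun x => (z * cosh z - sinh z) * (cosh z - cosh x) -
    sinh z * (x * sinh z - z * sinh x) with hf
  have hd : ∀ x, HasDerivAt f ((z * cosh z - sinh z) * (0 - sinh x) -
      sinh z * (1 * sinh z - z * cosh x)) x := fun x =>
    (((hasDerivAt_const x (cosh z)).sub (hasDerivAt_cosh x)).const_mul _).sub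
      ((((hasDerivAt_id x).mul_const (sinh z)).sub ((hasDerivAt_sinh x).const_mul z)).const_mul _)
  have hanti : StrictAntiOn f (Icc 0 z) := by
    refine strictAntiOn_of_deriv_neg (convex_Icc 0 z)
      (fun x _ => (hd x).continuousAt.continuousWithinAt) fun x hx => ?_
    rw [interior_Icc] at hx
    rw [(hd x).deriv]
    have h1 : sinh z = sinh (z - x) * cosh x + cosh (z - x) * sinh x := by
      rw [← sinh_add, sub_add_cancel]
    have h2 : sinh (z - x) = sinh z * cosh x - cosh z * sinh x := sinh_sub z x
    have h3 : sinh (z - x) + sinh x ≤ sinh z := by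
      have := sinh_add_sinh_le (z := z - x) (η := x) (by linarith [hx.2]) hx.1.le
      rwa [sub_add_cancel] at this
    have h4 : 0 < sinh (z - x) := sinh_pos_iff.2 (by linarith [hx.2])
    have h5 : z < sinh z := self_lt_sinh_iff.2 hz
    nlinarith [mul_lt_mul_of_pos_right h5 h4, mul_le_mul_of_nonneg_left h3 (hz.trans h5).le]
  have := hanti ⟨hη, hηz.le⟩ ⟨hz.le, le_rfl⟩ hηz
  simp only [hf, sub_self, mul_zero, mul_comm z (sinh z)] at this
  linarith

theorem mul_sinh_le_mul_sinh (hη : 0 ≤ η) (hηz : η ≤ z) : z * sinh η ≤ η * sinh z := by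
  have hmono : MonotoneOn (fun x => η * sinh x - x * sinh η) (Ici η) := by
    have hd : ∀ x, HasDerivAt (fun x => η * sinh x - x * sinh η) (η * cosh x - 1 * sinh η) x :=
      fun x => ((hasDerivAt_sinh x).const_mul η).sub ((hasDerivAt_id x).mul_const _)
    refine monotoneOn_of_deriv_nonneg (convex_Ici η) (by fun_prop)
      (fun x _ => (hd x).differentiableAt.differentiableWithinAt) fun x hx => ?_
    rw [interior_Ici] at hx
    rw [(hd x).deriv]
    have h1 : sinh η ≤ η * cosh η := by
      rcases hη.eq_or_lt with rfl | h
      · simp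
      · exact (sinh_lt_mul_cosh h).le
    have h2 : cosh η ≤ cosh x := by
      rw [cosh_le_cosh, abs_of_nonneg hη, abs_of_nonneg (hη.trans (le_of_lt hx))]
      exact le_of_lt hx
    nlinarith
  have := hmono self_mem_Ici hηz hηz
  simp only [sub_self] at this
  linarith

end Hyperbolic

/-! ### The profile and its force -/

section Profile

open Real

variable {V₀ s r D y : ℝ}

theorem evenSlope_pos (hV₀ : 0 < V₀) (hr : 0 < r) (hD : 0 < D) : 0 < evenSlope V₀ r D := by
  have := cothGap_pos (show 0 < r * D / 2 by positivity)
  rw [evenSlope]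
  positivity

theorem oddSlope_pos (hs : 0 < s) (hr : 0 < r) (hD : 0 < D) : 0 < oddSlope s r D := by
  have := cothGap_pos (show 0 < r * D / 2 by positivity)
  rw [oddSlope]
  positivity

/-- The difference of the squares of the two end slopes is determined by the
total tangential component of the weight. -/
theorem two_mul_evenSlope_mul_oddSlope (hr : 0 < r) (hD : 0 < D) :
    2 * evenSlope V₀ r D * oddSlope s r D = V₀ * s := by
  have := (cothGap_pos (show 0 < r * D / 2 by positivity)).ne'
  rw [evenSlope, oddSlope]
  field_simp

theorem hasDerivAt_centredProfile (hr : 0 < r) :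
    HasDerivAt (centredProfile V₀ s r D) (centredProfileDeriv V₀ s r D y) y := by
  have h1 : HasDerivAt (fun y => cosh (r * y)) (sinh (r * y) * (r * 1)) y :=
    ((hasDerivAt_id y).const_mul r).cosh
  have h2 : HasDerivAt (fun y => sinh (r * y)) (cosh (r * y) * (r * 1)) y :=
    ((hasDerivAt_id y).const_mul r).sinh
  have h3 := (((h1.const_sub (cosh (r * D / 2))).const_mul (evenSlope V₀ r D)).div_const
    (r * sinh (r * D / 2))).add
    (((hasDerivAt_id y).sub ((h2.const_mul (D / 2)).div_const (sinh (r * D / 2)))).const_mul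
      (s / r ^ 2))
  convert! h3 using 1
  rw [centredProfileDeriv]
  field_simp

theorem hasDerivAt_centredProfileDeriv (hr : 0 < r) (hD : 0 < D) :
    HasDerivAt (centredProfileDeriv V₀ s r D) (r ^ 2 * centredProfile V₀ s r D y - s * y -
      evenSlope V₀ r D * r * cosh (r * D / 2) / sinh (r * D / 2)) y := by
  have h1 : HasDerivAt (fun y => cosh (r * y)) (sinh (r * y) * (r * 1)) y :=
    ((hasDerivAt_id y).const_mul r).cosh
  have h2 : HasDerivAt (fun y => sinh (r * y)) (cosh (r * y) * (r * 1)) y :=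
    ((hasDerivAt_id y).const_mul r).sinh
  have h3 := ((h2.const_mul (evenSlope V₀ r D)).div_const (sinh (r * D / 2))).neg.add
    ((((h1.const_mul (r * D / 2)).div_const (sinh (r * D / 2))).const_sub 1).const_mul (s / r ^ 2))
  have hz := (sinh_pos_iff.2 (show 0 < r * D / 2 by positivity)).ne'
  convert! h3 using 1
  rw [centredProfile]
  field_simp
  ring

theorem centredProfile_right (hr : 0 < r) (hD : 0 < D) : centredProfile V₀ s r D (D / 2) = 0 := by
  have hz := (sinh_pos_iff.2 (show 0 < r * D / 2 by positivity)).ne'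
  rw [centredProfile, show r * (D / 2) = r * D / 2 by ring]
  field_simp
  ring

theorem centredProfile_left (hr : 0 < r) (hD : 0 < D) : centredProfile V₀ s r D (-(D / 2)) = 0 := by
  have hz := (sinh_pos_iff.2 (show 0 < r * D / 2 by positivity)).ne'
  rw [centredProfile, show r * -(D / 2) = -(r * D / 2) by ring, sinh_neg, cosh_neg]
  field_simp
  ring

theorem centredProfileDeriv_left (hr : 0 < r) (hD : 0 < D) :
    centredProfileDeriv V₀ s r D (-(D / 2)) = evenSlope V₀ r D - oddSlope s r D := by
  have hz := (sinh_pos_iff.2 (show 0 < r * D / 2 by positivity)).ne'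
  rw [centredProfileDeriv, oddSlope, cothGap, show r * -(D / 2) = -(r * D / 2) by ring, sinh_neg,
    cosh_neg]
  field_simp
  ring

theorem centredProfileDeriv_right (hr : 0 < r) (hD : 0 < D) :
    centredProfileDeriv V₀ s r D (D / 2) = -(evenSlope V₀ r D + oddSlope s r D) := by
  have hz := (sinh_pos_iff.2 (show 0 < r * D / 2 by positivity)).ne'
  rw [centredProfileDeriv, oddSlope, cothGap, show r * (D / 2) = r * D / 2 by ring]
  field_simp
  ring

theorem integral_centredProfile (hr : 0 < r) (hD : 0 < D) :
    ∫ y in -(D / 2)..D / 2, centredProfile V₀ s r D y = V₀ := by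
  have hz := (sinh_pos_iff.2 (show 0 < r * D / 2 by positivity)).ne'
  set G : ℝ → ℝ := fun y => evenSlope V₀ r D * (y * cosh (r * D / 2) - sinh (r * y) / r) /
    (r * sinh (r * D / 2)) + s / r ^ 2 * (y ^ 2 / 2 - D / 2 * (cosh (r * y) / r) /
      sinh (r * D / 2)) with hG
  have hd : ∀ y, HasDerivAt G (centredProfile V₀ s r D y) y := fun y => by
    have h1 : HasDerivAt (fun y => cosh (r * y)) (sinh (r * y) * (r * 1)) y :=
      ((hasDerivAt_id y).const_mul r).cosh
    have h2 : HasDerivAt (fun y => sinh (r * y)) (cosh (r * y) * (r * 1)) y :=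
      ((hasDerivAt_id y).const_mul r).sinh
    have h3 := (((((hasDerivAt_id y).mul_const (cosh (r * D / 2))).sub
      (h2.div_const r)).const_mul (evenSlope V₀ r D)).div_const (r * sinh (r * D / 2))).add
      (((((hasDerivAt_id y).pow 2).div_const 2).sub
        (((h1.div_const r).const_mul (D / 2)).div_const (sinh (r * D / 2)))).const_mul (s / r ^ 2))
    convert! h3 using 1
    rw [centredProfile]
    simp only [id]
    field_simp
    ring
  rw [intervalIntegral.integral_eq_sub_of_hasDerivAt (fun y _ => hd y)
    ((continuous_iff_continuousAt.2 fun y =>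
      (hasDerivAt_centredProfile hr).continuousAt).intervalIntegrable _ _)]
  have hgap := cothGap_pos (show 0 < r * D / 2 by positivity)
  have hgap' : cothGap (r * D / 2) * sinh (r * D / 2) =
      r * D / 2 * cosh (r * D / 2) - sinh (r * D / 2) := by
    rw [cothGap]; field_simp
  have hev : evenSlope V₀ r D * (2 * cothGap (r * D / 2)) = V₀ * r ^ 2 := by
    rw [evenSlope]; field_simp
  simp only [hG]
  rw [show r * -(D / 2) = -(r * D / 2) by ring, show r * (D / 2) = r * D / 2 by ring, sinh_neg,
    cosh_neg]
  have h4 : evenSlope V₀ r D * (D * cosh (r * D / 2) - 2 * sinh (r * D / 2) / r) /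
      (r * sinh (r * D / 2)) = V₀ := by
    rw [div_eq_iff (by positivity)]
    have : r * (D * cosh (r * D / 2) - 2 * sinh (r * D / 2) / r) =
        2 * (cothGap (r * D / 2) * sinh (r * D / 2)) := by
      rw [hgap']; field_simp
    apply mul_left_cancel₀ hr.ne'
    linear_combination evenSlope V₀ r D * this + sinh (r * D / 2) * hev
  refine Eq.trans ?_ h4
  ring

theorem centredProfile_pos (hs : 0 < s) (hr : 0 < r) (hD : 0 < D)
    (hle : oddSlope s r D ≤ evenSlope V₀ r D) (hy : |y| < D / 2) :
    0 < centredProfile V₀ s r D y := by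
  set z := r * D / 2 with hz
  have hzpos : 0 < z := by positivity
  have hsinh := sinh_pos_iff.2 hzpos
  have hη : r * |y| < z := by rw [hz, mul_div_assoc]; exact mul_lt_mul_of_pos_left hy hr
  have hη0 : 0 ≤ r * |y| := by positivity
  have hcosh : cosh (r * y) = cosh (r * |y|) := by
    rw [← cosh_abs, abs_mul, abs_of_pos hr]
  have hcosh_lt : 0 < cosh z - cosh (r * |y|) := by
    rw [sub_pos, cosh_lt_cosh, abs_of_nonneg hη0, abs_of_pos hzpos]; exact hη
  -- the antisymmetric part at `|y|` is nonnegative, and smaller than the symmetric part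
  set o := s / r ^ 2 * (|y| - D / 2 * sinh (r * |y|) / sinh z) with ho
  have ho0 : 0 ≤ o := by
    have h1 := mul_sinh_le_mul_sinh hη0 hη.le
    refine mul_nonneg (by positivity) ?_
    rw [sub_nonneg, div_le_iff₀ hsinh]
    have h2 : r * (D / 2 * sinh (r * |y|)) ≤ r * (|y| * sinh z) := by
      calc r * (D / 2 * sinh (r * |y|)) = z * sinh (r * |y|) := by rw [hz]; ring
        _ ≤ r * |y| * sinh z := h1
        _ = r * (|y| * sinh z) := by ring
    exact le_of_mul_le_mul_left h2 hr
  set e := evenSlope V₀ r D * (cosh z - cosh (r * |y|)) / (r * sinh z) with he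
  have hoe : o < e := by
    have h1 := mul_sinh_sub_lt hη0 hη
    have h2 : oddSlope s r D * (cosh z - cosh (r * |y|)) / (r * sinh z) ≤ e := by
      rw [he]; gcongr
    refine lt_of_lt_of_le ?_ h2
    rw [ho, oddSlope, ← hz, cothGap]
    have h3 : s / r ^ 2 * (|y| - D / 2 * sinh (r * |y|) / sinh z) =
        s / (r ^ 3 * sinh z ^ 2) * (sinh z * (r * |y| * sinh z - z * sinh (r * |y|))) := by
      rw [hz]; field_simp
    have h4 : s / r ^ 2 * (z * cosh z / sinh z - 1) * (cosh z - cosh (r * |y|)) / (r * sinh z) =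
        s / (r ^ 3 * sinh z ^ 2) * ((z * cosh z - sinh z) * (cosh z - cosh (r * |y|))) := by
      field_simp
    rw [h3, h4]
    exact mul_lt_mul_of_pos_left h1 (by positivity)
  have hval : centredProfile V₀ s r D y = e + o ∨ centredProfile V₀ s r D y = e - o := by
    rw [centredProfile, ← hz, hcosh, ← he]
    rcases abs_choice y with h | h
    · left; rw [ho, h]
    · right
      rw [ho, h, mul_neg, sinh_neg]
      ring
  rcases hval with h | h <;> rw [h] <;> linarith

/-- The largest width, at which the rear slope vanishes, and the properties of the rear force. -/
theorem exists_isForce (hV₀ : 0 < V₀) (hs : 0 < s) (hr : 0 < r) :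
    ∃ Dm, IsForce (rearForce V₀ s r) Dm ∧ evenSlope V₀ r Dm = oddSlope s r Dm ∧
      ∀ D ∈ Ioo 0 Dm, oddSlope s r D < evenSlope V₀ r D := by
  have hmaps : ∀ D, 0 < D → r * D / 2 ∈ Ioi (0 : ℝ) := fun D hD => by
    change 0 < r * D / 2; positivity
  have hgap : ∀ D, 0 < D → 0 < cothGap (r * D / 2) := fun D hD => cothGap_pos (hmaps D hD)
  have hgapmono : ∀ D D', 0 < D → D < D' → cothGap (r * D / 2) < cothGap (r * D' / 2) :=
    fun D D' hD hDD' => strictMonoOn_cothGap (hmaps D hD) (hmaps D' (hD.trans hDD'))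
      (by have := mul_lt_mul_of_pos_left hDD' hr; linarith)
  have hdiff : ContDiffOn ℝ 1 (fun D => cothGap (r * D / 2)) (Ioi 0) :=
    contDiffOn_cothGap.comp (by fun_prop) fun D hD => hmaps D hD
  have hlim : Tendsto (fun D => cothGap (r * D / 2)) (𝓝[>] 0) (𝓝 0) := by
    have h1 : Tendsto (fun D => cosh (r * D / 2) - 1) (𝓝[>] 0) (𝓝 0) := by
      have : Continuous fun D => cosh (r * D / 2) - 1 := by fun_prop
      have := this.tendsto 0
      simp only [mul_zero, zero_div, cosh_zero, sub_self] at this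
      exact this.mono_left nhdsWithin_le_nhds
    refine tendsto_of_tendsto_of_tendsto_of_le_of_le' tendsto_const_nhds h1 ?_ ?_
    · filter_upwards [self_mem_nhdsWithin] with D hD using (hgap D hD).le
    · filter_upwards [self_mem_nhdsWithin] with D hD using cothGap_le_cosh_sub_one (hmaps D hD)
  -- the width at which the two slopes agree
  set γ := r ^ 2 * √(V₀ / (2 * s)) with hγ
  have hγpos : 0 < γ := by positivity
  have hγsq : γ ^ 2 * (2 * s) = V₀ * r ^ 4 := by
    rw [hγ, mul_pow, sq_sqrt (by positivity)]; field_simp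
  obtain ⟨D₁, hD₁, hD₁'⟩ := ((hlim.eventually_lt_const hγpos).and self_mem_nhdsWithin).exists
  have hD₁0 : 0 < D₁ := hD₁'
  set D₂ := max D₁ (2 * (γ + 1) / r) with hD₂
  have hD₂γ : γ ≤ cothGap (r * D₂ / 2) := by
    have h1 := sub_one_le_cothGap (hmaps D₂ (hD₁0.trans_le (le_max_left _ _)))
    have h2 : 2 * (γ + 1) / r ≤ D₂ := le_max_right _ _
    rw [div_le_iff₀ hr] at h2
    linarith
  obtain ⟨Dm, hDm, hDmγ⟩ := intermediate_value_Icc (le_max_left D₁ (2 * (γ + 1) / r))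
    (hdiff.continuousOn.mono fun D hD => hD₁0.trans_le hD.1) ⟨hD₁.le, hD₂γ⟩
  have hDm0 : 0 < Dm := hD₁0.trans_le hDm.1
  simp only at hDmγ
  have heq : evenSlope V₀ r Dm = oddSlope s r Dm := by
    rw [evenSlope, oddSlope, hDmγ, div_eq_iff (by positivity)]
    field_simp
    linarith
  have hodd : ∀ D D', 0 < D → D < D' → oddSlope s r D < oddSlope s r D' := fun D D' hD hDD' =>
    mul_lt_mul_of_pos_left (hgapmono D D' hD hDD') (by positivity)
  have heven : ∀ D D', 0 < D → D < D' → evenSlope V₀ r D' < evenSlope V₀ r D :=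
    fun D D' hD hDD' => div_lt_div_of_pos_left (by positivity) (by linarith [hgap D hD])
      (by linarith [hgapmono D D' hD hDD'])
  have hlt : ∀ D ∈ Ioo 0 Dm, oddSlope s r D < evenSlope V₀ r D := fun D hD => by
    linarith [hodd D Dm hD.1 hD.2, heven D Dm hD.1 hD.2]
  refine ⟨Dm, ⟨hDm0, fun D hD D' hD' hDD' => ?_, ?_, fun R => ?_, fun ε hε => ?_⟩, heq, hlt⟩
  · have h1 := hodd D D' hD.1 hDD'
    have h2 := heven D D' hD.1 hDD'
    have h3 : oddSlope s r D' ≤ evenSlope V₀ r D' := by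
      rcases hD'.2.lt_or_eq with h | rfl
      · exact (hlt D' ⟨hD'.1, h⟩).le
      · exact heq.ge
    rw [rearForce, rearForce]
    have := pow_lt_pow_left₀ (show evenSlope V₀ r D' - oddSlope s r D' <
      evenSlope V₀ r D - oddSlope s r D by linarith) (by linarith) two_ne_zero
    linarith
  · rw [rearForce, heq, sub_self]; norm_num
  · -- for small widths the odd slope is at most `s` and the even slope is large
    set Y := |R| + 2 with hY
    have hYpos : 0 < Y := by positivity
    have hbig : 0 < V₀ * r ^ 2 / (2 * (Y + s / r ^ 2)) := by positivity
    obtain ⟨D, ⟨⟨h1, h2⟩, hD⟩⟩ := (((hlim.eventually_lt_const hbig).and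
      (hlim.eventually_lt_const one_pos)).and (Ioo_mem_nhdsGT hDm0)).exists
    refine ⟨D, hD, ?_⟩
    have h3 : oddSlope s r D ≤ s / r ^ 2 := mul_le_of_le_one_right (by positivity) h2.le
    have h4 : Y + s / r ^ 2 ≤ evenSlope V₀ r D := by
      rw [evenSlope, le_div_iff₀ (by linarith [hgap D hD.1])]
      rw [lt_div_iff₀ (by positivity)] at h1
      linarith
    have h5 : Y ^ 2 ≤ (evenSlope V₀ r D - oddSlope s r D) ^ 2 :=
      pow_le_pow_left₀ hYpos.le (by linarith) 2
    rw [rearForce]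
    have h6 : R ≤ |R| := le_abs_self R
    have h7 : 0 ≤ |R| := abs_nonneg R
    nlinarith
  · have hcd : ContDiffOn ℝ 1 (rearForce V₀ s r) (Ioi 0) := by
      refine ContDiffOn.div_const (ContDiffOn.pow (ContDiffOn.sub ?_ ?_) 2) 2
      · exact contDiffOn_const.div (contDiffOn_const.mul hdiff) fun D hD =>
          (mul_pos two_pos (hgap D hD)).ne'
      · exact contDiffOn_const.mul hdiff
    exact (hcd.mono fun D hD => hε.1.trans_le hD.1).exists_lipschitzOnWith one_ne_zero
      (convex_Icc _ _) isCompact_Icc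

end Profile

/-! ### Solutions of the drop problem and motions of the contact points -/

section Solutions

open Real

variable {V₀ κ α r a₀ a b x : ℝ}

theorem isArgmin_profile (hr : 0 < r) (hrk : r ^ 2 = κ * cos α) (hs : 0 < κ * sin α)
    (ha₀ : a₀ ≤ a) (hab : a < b)
    (hle : oddSlope (κ * sin α) r (b - a) ≤ evenSlope V₀ r (b - a))
    (hcase : a₀ = a ∨ evenSlope V₀ r (b - a) = oddSlope (κ * sin α) r (b - a)) :
    IsArgmin V₀ κ α a₀ b (profile V₀ (κ * sin α) r a b) ∧
      ∀ v, IsArgmin V₀ κ α a₀ b v → v = profile V₀ (κ * sin α) r a b := by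
  set s := κ * sin α with hsdef
  set D := b - a with hD
  have hD0 : 0 < D := sub_pos.2 hab
  have hl : a - (a + b) / 2 = -(D / 2) := by rw [hD]; ring
  have hrt : b - (a + b) / 2 = D / 2 := by rw [hD]; ring
  refine isArgmin_of_euler_lagrange
    (Λ := evenSlope V₀ r D * r * cosh (r * D / 2) / sinh (r * D / 2) - s * ((a + b) / 2))
    (g := fun x => centredProfile V₀ s r D (x - (a + b) / 2))
    (g' := fun x => centredProfileDeriv V₀ s r D (x - (a + b) / 2))
    (by rw [← hrk]; positivity) hs ha₀ hab
    (fun x => (hasDerivAt_centredProfile hr).comp_sub_const x _) (fun x => ?_) ?_ ?_ ?_ ?_ ?_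
  · convert! (hasDerivAt_centredProfileDeriv hr hD0).comp_sub_const x ((a + b) / 2) using 1
    rw [← hrk]
    ring
  · simp only [hl, centredProfile_left hr hD0]
  · simp only [hrt, centredProfile_right hr hD0]
  · intro x hx
    refine (centredProfile_pos hs hr hD0 hle ?_).le
    rw [abs_lt]
    constructor <;> linarith [hx.1, hx.2]
  · rw [intervalIntegral.integral_comp_sub_right (centredProfile V₀ s r D), hl, hrt,
      integral_centredProfile hr hD0]
  · refine hcase.imp_right fun heq => ⟨?_, ?_⟩
    · simp only [hl, centredProfileDeriv_left hr hD0, heq, sub_self]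
    · -- since the slopes agree, the claim is `z ≤ sinh z * cosh z`
      set z := r * D / 2 with hz
      have hzpos : 0 < z := by positivity
      have hsinh := sinh_pos_iff.2 hzpos
      have h1 : z ≤ sinh z * cosh z := (self_le_sinh_iff.2 hzpos.le).trans
        (le_mul_of_one_le_right hsinh.le (one_le_cosh z))
      have h2 : s * a + (evenSlope V₀ r D * r * cosh z / sinh z - s * ((a + b) / 2)) =
          s / (r * sinh z ^ 2) * (z - sinh z * cosh z) := by
        rw [heq, oddSlope, ← hz, cothGap,
          show s * a + (s / r ^ 2 * (z * cosh z / sinh z - 1) * r * cosh z / sinh z -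
            s * ((a + b) / 2)) = s / r ^ 2 * (z * cosh z / sinh z - 1) * r * cosh z / sinh z -
            s / r * z by rw [hz, hD]; field_simp; ring]
        field_simp
        linear_combination z * cosh_sq z
      rw [h2]
      exact mul_nonpos_of_nonneg_of_nonpos (by positivity) (sub_nonpos.2 h1)

theorem setOf_profile_pos {s : ℝ} (hs : 0 < s) (hr : 0 < r) (hab : a < b)
    (hle : oddSlope s r (b - a) ≤ evenSlope V₀ r (b - a)) :
    {x | 0 < profile V₀ s r a b x} = Ioo a b := by
  ext x
  rw [mem_ofPred_eq, profile]
  by_cases hx : x ∈ Ioo a b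
  · rw [indicator_of_mem hx]
    refine iff_of_true (centredProfile_pos hs hr (sub_pos.2 hab) hle ?_) hx
    rw [abs_lt]
    constructor <;> linarith [hx.1, hx.2]
  · rw [indicator_of_notMem hx]
    exact iff_of_false (lt_irrefl _) hx

theorem profile_of_mem_Icc {s : ℝ} (hr : 0 < r) (hab : a < b) (hx : x ∈ Icc a b) :
    profile V₀ s r a b x = centredProfile V₀ s r (b - a) (x - (a + b) / 2) := by
  have hD : 0 < b - a := sub_pos.2 hab
  rcases eq_endpoints_or_mem_Ioo_of_mem_Icc hx with rfl | rfl | h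
  · rw [profile, indicator_of_notMem (by simp), show x - (x + b) / 2 = -((b - x) / 2) by ring,
      centredProfile_left hr hD]
  · rw [profile, indicator_of_notMem (by simp), show x - (a + x) / 2 = (x - a) / 2 by ring,
      centredProfile_right hr hD]
  · rw [profile, indicator_of_mem h]

theorem slopeLeft_profile {s : ℝ} (hr : 0 < r) (hab : a < b) :
    slopeLeft (profile V₀ s r a b) a = evenSlope V₀ r (b - a) - oddSlope s r (b - a) := by
  have h1 := ((hasDerivAt_centredProfile (V₀ := V₀) (s := s) (D := b - a) hr).comp_sub_const a
    ((a + b) / 2)).hasDerivWithinAt (s := Ici a)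
  rw [show a - (a + b) / 2 = -((b - a) / 2) by ring,
    centredProfileDeriv_left hr (sub_pos.2 hab)] at h1
  refine (h1.congr_of_eventuallyEq ?_ (profile_of_mem_Icc hr hab ⟨le_rfl, hab.le⟩)).derivWithin
    (uniqueDiffOn_Ici a a self_mem_Ici)
  filter_upwards [Icc_mem_nhdsGE hab] with x hx
  exact profile_of_mem_Icc hr hab hx

theorem slopeRight_profile {s : ℝ} (hr : 0 < r) (hab : a < b) :
    slopeRight (profile V₀ s r a b) b = -(evenSlope V₀ r (b - a) + oddSlope s r (b - a)) := by
  have h1 := ((hasDerivAt_centredProfile (V₀ := V₀) (s := s) (D := b - a) hr).comp_sub_const b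
    ((a + b) / 2)).hasDerivWithinAt (s := Iic b)
  rw [show b - (a + b) / 2 = (b - a) / 2 by ring,
    centredProfileDeriv_right hr (sub_pos.2 hab)] at h1
  refine (h1.congr_of_eventuallyEq ?_ (profile_of_mem_Icc hr hab ⟨hab.le, le_rfl⟩)).derivWithin
    (uniqueDiffOn_Iic b b self_mem_Iic)
  filter_upwards [Icc_mem_nhdsLE hab] with x hx
  exact profile_of_mem_Icc hr hab hx

/-- A minimizer that is positive on the whole of `(a, b)` is the explicit profile, and its width is
at most `Dm`: on a longer interval, the minimizer is the profile of width `Dm` at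
the right end, whose support is smaller. -/
theorem IsArgmin.eq_profile {Dm : ℝ} {w : ℝ → ℝ} (hV₀ : 0 < V₀) (hr : 0 < r)
    (hrk : r ^ 2 = κ * cos α) (hs : 0 < κ * sin α) (hDm : 0 < Dm)
    (heq : evenSlope V₀ r Dm = oddSlope (κ * sin α) r Dm)
    (hlt : ∀ D ∈ Ioo 0 Dm, oddSlope (κ * sin α) r D < evenSlope V₀ r D)
    (hw : IsArgmin V₀ κ α a b w) (hsupp : {x | 0 < w x} = Ioo a b) :
    a < b ∧ b - a ≤ Dm ∧ w = profile V₀ (κ * sin α) r a b := by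
  have hab : a < b := by
    by_contra! hba
    have h0 : ∀ x, w x = 0 := fun x => hw.1.1.eq_zero x (by simp [Ioo_eq_empty_of_le hba])
    have := hw.1.2.2
    simp only [h0, intervalIntegral.integral_zero] at this
    exact hV₀.ne this
  have hwidth : b - a ≤ Dm := by
    by_contra! hD
    have hD' : b - (b - Dm) = Dm := by ring
    have h1 := (isArgmin_profile (a₀ := a) (a := b - Dm) (b := b) hr hrk hs (by linarith)
      (by linarith) (by rw [hD']; exact heq.ge) (by rw [hD']; exact Or.inr heq)).2 w hw
    have h2 : (a + (b - Dm)) / 2 ∈ {x | 0 < w x} := by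
      rw [hsupp]; constructor <;> linarith
    rw [mem_ofPred_eq, h1, profile, indicator_of_notMem fun h => by linarith [h.1]] at h2
    exact lt_irrefl _ h2
  refine ⟨hab, hwidth, (isArgmin_profile hr hrk hs le_rfl hab ?_ (Or.inl rfl)).2 w hw⟩
  rcases hwidth.lt_or_eq with h | h
  · exact (hlt _ ⟨sub_pos.2 hab, h⟩).le
  · rw [h]; exact heq.ge

end Solutions

section EndPoints

open Real

variable {V₀ κ α r : ℝ} {J : Set ℝ} {β : ℝ → ℝ} {u : ℝ → ℝ → ℝ} {a b : ℝ → ℝ} {Dm : ℝ}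

theorem half_sq_add_slopes {s D : ℝ} (hr : 0 < r) (hD : 0 < D) :
    1 / 2 * (evenSlope V₀ r D + oddSlope s r D) ^ 2 = rearForce V₀ s r D + V₀ * s := by
  rw [rearForce]
  linear_combination two_mul_evenSlope_mul_oddSlope (V₀ := V₀) (s := s) hr hD

/-- The end points of the support of a solution move according to `IsMotion`. -/
theorem IsSolutionOn.isMotion (hV₀ : 0 < V₀) (hr : 0 < r) (hrk : r ^ 2 = κ * cos α)
    (hs : 0 < κ * sin α) (hDm : 0 < Dm) (heq : evenSlope V₀ r Dm = oddSlope (κ * sin α) r Dm)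
    (hlt : ∀ D ∈ Ioo 0 Dm, oddSlope (κ * sin α) r D < evenSlope V₀ r D) (hJ : MeasurableSet J)
    (h : IsSolutionOn J V₀ κ α β u a b) :
    IsMotion J (rearForce V₀ (κ * sin α) r) (V₀ * κ * sin α) Dm β a b ∧
      ∀ t ∈ J, u t = profile V₀ (κ * sin α) r (a t) (b t) := by
  have hprof := fun t ht => (h.argmin t ht).eq_profile hV₀ hr hrk hs hDm heq hlt (h.support_eq t ht)
  have hl := (ae_restrict_iff' hJ).1 h.law_left
  have hr' := (ae_restrict_iff' hJ).1 h.law_right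
  have hleft : ∀ t ∈ J, slopeLeft (u t) (a t) =
      evenSlope V₀ r (b t - a t) - oddSlope (κ * sin α) r (b t - a t) := fun t ht => by
    rw [(hprof t ht).2.2, slopeLeft_profile hr (hprof t ht).1]
  refine ⟨⟨h.lip_left, h.lip_right, fun t ht => (hprof t ht).1, fun t ht => (hprof t ht).2.1,
    ?_, ?_, ?_⟩, fun t ht => (hprof t ht).2.2⟩
  · filter_upwards [hr'] with t ht htJ
    have h1 := ht htJ
    have hD := sub_pos.2 (hprof t htJ).1
    have hpos : 0 < evenSlope V₀ r (b t - a t) + oddSlope (κ * sin α) r (b t - a t) :=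
      add_pos (evenSlope_pos hV₀ hr hD) (oddSlope_pos hs hr hD)
    rw [(hprof t htJ).2.2, slopeRight_profile hr (hprof t htJ).1, abs_neg, abs_of_pos hpos,
      half_sq_add_slopes hr hD] at h1
    rcases min_choice (-deriv b t + (rearForce V₀ (κ * sin α) r (b t - a t) + V₀ * (κ * sin α)) -
      β (b t)) (evenSlope V₀ r (b t - a t) + oddSlope (κ * sin α) r (b t - a t)) with h2 | h2
    · rw [h2] at h1; linarith
    · rw [h2] at h1; exact absurd h1 hpos.ne'
  · filter_upwards [hl] with t ht htJ
    have h1 := ht htJ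
    have h2 := min_le_left (deriv a t + 1 / 2 * |slopeLeft (u t) (a t)| ^ 2 - β (a t))
      |slopeLeft (u t) (a t)|
    rw [h1, sq_abs, hleft t htJ] at h2
    rw [rearForce]
    linarith
  · filter_upwards [hl] with t ht htJ hwidth
    have h1 := ht htJ
    have hpos := sub_pos.2 (hlt _ ⟨sub_pos.2 (hprof t htJ).1, hwidth⟩)
    rw [hleft t htJ, abs_of_pos hpos] at h1
    rw [rearForce]
    rcases min_choice (deriv a t + 1 / 2 * (evenSlope V₀ r (b t - a t) -
      oddSlope (κ * sin α) r (b t - a t)) ^ 2 - β (a t))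
      (evenSlope V₀ r (b t - a t) - oddSlope (κ * sin α) r (b t - a t)) with h2 | h2
    · rw [h2] at h1; linarith
    · rw [h2] at h1; exact absurd h1 hpos.ne'

/-- Conversely, a motion of the end points carries a solution. -/
theorem IsMotion.isSolutionOn (hV₀ : 0 < V₀) (hr : 0 < r) (hrk : r ^ 2 = κ * cos α)
    (hs : 0 < κ * sin α) (heq : evenSlope V₀ r Dm = oddSlope (κ * sin α) r Dm)
    (hlt : ∀ D ∈ Ioo 0 Dm, oddSlope (κ * sin α) r D < evenSlope V₀ r D) (hJ : MeasurableSet J)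
    (h : IsMotion J (rearForce V₀ (κ * sin α) r) (V₀ * κ * sin α) Dm β a b) :
    IsSolutionOn J V₀ κ α β (fun t => profile V₀ (κ * sin α) r (a t) (b t)) a b := by
  have hle : ∀ t ∈ J, oddSlope (κ * sin α) r (b t - a t) ≤ evenSlope V₀ r (b t - a t) := by
    intro t ht
    rcases (h.width_mem ht).2.lt_or_eq with h' | h'
    · exact (hlt _ ⟨(h.width_mem ht).1, h'⟩).le
    · rw [h']; exact heq.ge
  refine ⟨h.lip_left, h.lip_right, fun t ht => setOf_profile_pos hs hr (h.lt t ht) (hle t ht),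
    fun t ht => (isArgmin_profile hr hrk hs le_rfl (h.lt t ht) (hle t ht) (Or.inl rfl)).1,
    (ae_restrict_iff' hJ).2 ?_, (ae_restrict_iff' hJ).2 ?_⟩
  · filter_upwards [h.law_left, h.le_law_left] with t h1 h2 ht
    rw [slopeLeft_profile hr (h.lt t ht), sq_abs, abs_of_nonneg (sub_nonneg.2 (hle t ht))]
    have h3 := h2 ht
    rw [rearForce] at h3
    rcases (h.width_mem ht).2.lt_or_eq with h' | h'
    · have h4 := h1 ht h'
      rw [rearForce] at h4
      rw [min_eq_left] <;> linarith [hle t ht]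
    · rw [h', heq, sub_self] at h3 ⊢
      exact min_eq_right (by linarith)
  · filter_upwards [h.law_right] with t h1 ht
    have hD := (h.width_mem ht).1
    have hpos : 0 < evenSlope V₀ r (b t - a t) + oddSlope (κ * sin α) r (b t - a t) :=
      add_pos (evenSlope_pos hV₀ hr hD) (oddSlope_pos hs hr hD)
    rw [slopeRight_profile hr (h.lt t ht), abs_neg, abs_of_pos hpos, half_sq_add_slopes hr hD,
      h1 ht]
    rw [min_eq_left] <;> linarith

/-! ### Continuous dependence of the profile on the end points of its support -/

theorem profile_eq_clamp {s a b : ℝ} (hr : 0 < r) (hab : a < b) (x : ℝ) :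
    profile V₀ s r a b x = centredProfile V₀ s r (b - a)
      (max (-((b - a) / 2)) (min (x - (a + b) / 2) ((b - a) / 2))) := by
  have hD : 0 < b - a := sub_pos.2 hab
  rcases le_or_gt x a with h | h
  · rw [max_eq_left ((min_le_left _ _).trans (by linarith)), centredProfile_left hr hD, profile,
      indicator_of_notMem fun hx => absurd hx.1 (not_lt.2 h)]
  · rcases le_or_gt b x with h' | h'
    · rw [min_eq_right (by linarith), max_eq_right (by linarith), centredProfile_right hr hD,
        profile, indicator_of_notMem fun hx => absurd hx.2 (not_lt.2 h')]
    · rw [min_eq_left (by linarith), max_eq_right (by linarith),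
        profile_of_mem_Icc hr hab ⟨h.le, h'.le⟩]

theorem continuousOn_centredProfile {s : ℝ} (hr : 0 < r) :
    ContinuousOn (fun p : ℝ × ℝ => centredProfile V₀ s r p.1 p.2) (Ioi 0 ×ˢ univ) := by
  have hz : ∀ p ∈ (Ioi 0 ×ˢ univ : Set (ℝ × ℝ)), 0 < r * p.1 / 2 := fun p hp => by
    have : 0 < p.1 := hp.1
    positivity
  have hgap : ContinuousOn (fun p : ℝ × ℝ => cothGap (r * p.1 / 2)) (Ioi 0 ×ˢ univ) :=
    contDiffOn_cothGap.continuousOn.comp (by fun_prop) hz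
  have heven : ContinuousOn (fun p : ℝ × ℝ => evenSlope V₀ r p.1) (Ioi 0 ×ˢ univ) :=
    continuousOn_const.div (continuousOn_const.mul hgap) fun p hp =>
      (mul_pos two_pos (cothGap_pos (hz p hp))).ne'
  have hsinh : ∀ p ∈ (Ioi 0 ×ˢ univ : Set (ℝ × ℝ)), sinh (r * p.1 / 2) ≠ 0 := fun p hp =>
    (sinh_pos_iff.2 (hz p hp)).ne'
  have hcosh₁ : Continuous fun p : ℝ × ℝ => cosh (r * p.1 / 2) :=
    continuous_cosh.comp (by fun_prop)
  have hcosh₂ : Continuous fun p : ℝ × ℝ => cosh (r * p.2) := continuous_cosh.comp (by fun_prop)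
  have hsinh₁ : Continuous fun p : ℝ × ℝ => sinh (r * p.1 / 2) :=
    continuous_sinh.comp (by fun_prop)
  have hsinh₂ : Continuous fun p : ℝ × ℝ => sinh (r * p.2) := continuous_sinh.comp (by fun_prop)
  have hhalf : Continuous fun p : ℝ × ℝ => p.1 / 2 := by fun_prop
  exact ((heven.mul (hcosh₁.sub hcosh₂).continuousOn).div (hsinh₁.const_mul r).continuousOn
    fun p hp => mul_ne_zero hr.ne' (hsinh p hp)).add (continuousOn_const.mul
      (continuous_snd.continuousOn.sub
        ((hhalf.mul hsinh₂).continuousOn.div hsinh₁.continuousOn hsinh)))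

theorem tendstoUniformly_profile_sub {s ε : ℝ} {A B : ℝ → ℝ} (hr : 0 < r) (hε : 0 < ε)
    (hab : ∀ᶠ t in atTop, b t - a t ≤ Dm) (hAB : ∀ t, B t - A t ∈ Icc ε Dm)
    (ha : Tendsto (fun t => a t - A t) atTop (𝓝 0))
    (hb : Tendsto (fun t => b t - B t) atTop (𝓝 0)) :
    TendstoUniformly (fun t x => profile V₀ s r (a t) (b t) x - profile V₀ s r (A t) (B t) x)
      (fun _ => 0) atTop := by
  have hK : UniformContinuousOn (fun p : ℝ × ℝ => centredProfile V₀ s r p.1 p.2)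
      (Icc (ε / 2) Dm ×ˢ Icc (-(Dm / 2)) (Dm / 2)) :=
    (isCompact_Icc.prod isCompact_Icc).uniformContinuousOn_of_continuous
      ((continuousOn_centredProfile hr).mono (prod_mono
        (fun x hx => (half_pos hε).trans_le hx.1) (subset_univ _)))
  rw [Metric.tendstoUniformly_iff]
  intro η hη
  obtain ⟨δ, hδ, hδη⟩ := Metric.uniformContinuousOn_iff.1 hK η hη
  have hδ' : 0 < min (δ / 2) (ε / 4) := by positivity
  have ha' := (Metric.tendsto_nhds.1 ha) _ hδ'
  have hb' := (Metric.tendsto_nhds.1 hb) _ hδ'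
  filter_upwards [ha', hb', hab] with t h1 h2 h3 x
  rw [Real.dist_0_eq_abs, lt_min_iff] at h1 h2
  obtain ⟨h1a, h1b⟩ := h1
  obtain ⟨h2a, h2b⟩ := h2
  rw [abs_lt] at h1a h1b h2a h2b
  have h5 := hAB t
  have h4 := h5.1
  have hmem : ∀ D y : ℝ, D ∈ Icc (ε / 2) Dm → (D, max (-(D / 2)) (min y (D / 2))) ∈
      Icc (ε / 2) Dm ×ˢ Icc (-(Dm / 2)) (Dm / 2) := fun D y hD =>
    ⟨hD, le_max_of_le_left (by linarith [hD.2]), max_le (by linarith [hD.1, hD.2])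
      ((min_le_right _ _).trans (by linarith [hD.2]))⟩
  have hclose : dist (b t - a t, max (-((b t - a t) / 2))
      (min (x - (a t + b t) / 2) ((b t - a t) / 2))) (B t - A t, max (-((B t - A t) / 2))
      (min (x - (A t + B t) / 2) ((B t - A t) / 2))) < δ := by
    rw [Prod.dist_eq, Real.dist_eq, Real.dist_eq]
    refine max_lt (abs_lt.2 ⟨by linarith, by linarith⟩) ?_
    refine (abs_max_sub_max_le_max _ _ _ _).trans_lt (max_lt (abs_lt.2 ⟨by linarith, by linarith⟩)
      ((abs_min_sub_min_le_max _ _ _ _).trans_lt (max_lt (abs_lt.2 ⟨by linarith, by linarith⟩)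
        (abs_lt.2 ⟨by linarith, by linarith⟩))))
  have hdist := hδη _ (hmem (b t - a t) _ ⟨by linarith, h3⟩) _
    (hmem (B t - A t) _ ⟨by linarith, h5.2⟩) hclose
  rw [dist_comm, dist_zero_right, profile_eq_clamp hr (by linarith),
    profile_eq_clamp hr (by linarith), ← dist_eq_norm]
  exact hdist

end EndPoints

/-! ### Translations of the profile, and the theorem on sliding drops -/

variable {V₀ s r : ℝ}

theorem profile_add_add (a b L x : ℝ) :
    profile V₀ s r (a + L) (b + L) x = profile V₀ s r a b (x - L) := by
  have h1 : b + L - (a + L) = b - a := by ring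
  have h2 : x - (a + L + (b + L)) / 2 = x - L - (a + b) / 2 := by ring
  by_cases hx : x - L ∈ Ioo a b
  · have hx' : x ∈ Ioo (a + L) (b + L) := ⟨by linarith [hx.1], by linarith [hx.2]⟩
    rw [profile, profile, indicator_of_mem hx, indicator_of_mem hx', h1, h2]
  · have hx' : x ∉ Ioo (a + L) (b + L) := fun h => hx ⟨by linarith [h.1], by linarith [h.2]⟩
    rw [profile, profile, indicator_of_notMem hx, indicator_of_notMem hx']

theorem IsPulsating.support_add {κ α L T : ℝ} {β : ℝ → ℝ} {u : ℝ → ℝ → ℝ} {a b : ℝ → ℝ}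
    (h : IsPulsating V₀ κ α β L T u a b) (hab : ∀ t, a t < b t) (t : ℝ) :
    a (t + T) = a t + L ∧ b (t + T) = b t + L := by
  have h1 : Ioo (a (t + T)) (b (t + T)) = Ioo (a t + L) (b t + L) := by
    rw [← h.1.support_eq _ trivial]
    ext x
    have h2 : x - L ∈ {x | 0 < u t x} ↔ x - L ∈ Ioo (a t) (b t) := by
      rw [h.1.support_eq t trivial]
    rw [mem_ofPred_eq] at h2 ⊢
    rw [h.2, h2, mem_Ioo, mem_Ioo, lt_sub_iff_add_lt, sub_lt_iff_lt_add]
  have h3 := hab t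
  have h4 : a t + L < b t + L := by linarith
  constructor
  · rw [← csInf_Ioo (hab (t + T)), h1, csInf_Ioo h4]
  · rw [← csSup_Ioo (hab (t + T)), h1, csSup_Ioo h4]

end SlidingDrop

open SlidingDrop

theorem theorem2p5 (V₀ κ α : ℝ) (hV₀ : 0 < V₀) (hκ : 0 < κ) (hα : α ∈ Set.Ioo 0 (Real.pi / 2)) :
    (∀ (β : ℝ → ℝ) (L M m : ℝ), 0 < L → Function.Periodic β L → (∃ K, LipschitzWith K β) →
      IsGreatest (Set.range β) M → IsLeast (Set.range β) m →
      M - m < V₀ * κ * Real.sin α →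
      ∃ (U : ℝ → ℝ → ℝ) (A B : ℝ → ℝ) (T : ℝ), 0 < T ∧
        SlidingDrop.IsPulsating V₀ κ α β L T U A B ∧
        (∀ (U' : ℝ → ℝ → ℝ) (A' B' : ℝ → ℝ) (T' : ℝ),
          SlidingDrop.IsPulsating V₀ κ α β L T' U' A' B' →
          ∃ τ : ℝ, ∀ t x, U' t x = U (t + τ) x) ∧
        (∀ (u : ℝ → ℝ → ℝ) (a b : ℝ → ℝ), SlidingDrop.IsSolution V₀ κ α β u a b →
          (∃ t₀ : ℝ, ∀ t ≥ t₀, DifferentiableAt ℝ b t ∧ 0 < deriv b t) ∧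
          ∃ τ : ℝ,
            TendstoUniformly (fun t x => u t x - U (t + τ) x) (fun _ => 0) Filter.atTop ∧
            Filter.Tendsto (fun t => a t - A (t + τ)) Filter.atTop (nhds 0) ∧
            Filter.Tendsto (fun t => b t - B (t + τ)) Filter.atTop (nhds 0))) ∧
    (∀ M m : ℝ, 0 ≤ m → V₀ * κ * Real.sin α < M - m →
      ∃ δ > 0, ∃ C : ℝ, ∀ (β : ℝ → ℝ) (L : ℝ), 0 < L → L < δ →
        Function.Periodic β L → (∃ K, LipschitzWith K β) →
        IsGreatest (Set.range β) M → IsLeast (Set.range β) m →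
        ∀ (u : ℝ → ℝ → ℝ) (a b : ℝ → ℝ), SlidingDrop.IsSolution V₀ κ α β u a b →
          ∀ t ≥ 0, |a t - a 0| ≤ C ∧ |b t - b 0| ≤ C) := by
  have hcos : 0 < κ * Real.cos α :=
    mul_pos hκ (Real.cos_pos_of_mem_Ioo ⟨by linarith [hα.1, Real.pi_pos], hα.2⟩)
  have hs : 0 < κ * Real.sin α :=
    mul_pos hκ (Real.sin_pos_of_pos_of_lt_pi hα.1 (by linarith [hα.2, Real.pi_pos]))
  have hS : 0 < V₀ * κ * Real.sin α := by rw [mul_assoc]; exact mul_pos hV₀ hs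
  obtain ⟨r, hr, hrk⟩ : ∃ r : ℝ, 0 < r ∧ r ^ 2 = κ * Real.cos α :=
    ⟨_, Real.sqrt_pos.2 hcos, Real.sq_sqrt hcos.le⟩
  obtain ⟨Dm, hF, heq, hlt⟩ := exists_isForce hV₀ hs hr
  refine ⟨?_, ?_⟩
  · rintro β L M m hL hper ⟨K, hβ⟩ hM hm hMm
    obtain ⟨T, A, B, hU⟩ := exists_pulsatingMotion hF hL hper hβ
      (fun x => hM.2 (mem_range_self x)) (fun x => hm.2 (mem_range_self x)) hMm
    refine ⟨fun t => profile V₀ (κ * Real.sin α) r (A t) (B t), A, B, T, hU.period_pos,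
      ⟨hU.motion.isSolutionOn hV₀ hr hrk hs heq hlt .univ, fun t x => ?_⟩, ?_, ?_⟩
    · simp only [hU.left_add, hU.right_add, profile_add_add]
    · intro U' A' B' T' hU'
      obtain ⟨hmot, hprof⟩ := hU'.1.isMotion hV₀ hr hrk hs hF.width_pos heq hlt .univ
      have hshift := hU'.support_add fun t => hmot.lt t trivial
      obtain ⟨τ, hτ⟩ := hmot.eq_translate_of_pulsating hF hL hper hβ hU
        (fun t => (hshift t).1) fun t => (hshift t).2
      refine ⟨τ, fun t x => ?_⟩
      rw [hprof t trivial, (hτ t).1, (hτ t).2]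
    · intro u a b hu
      obtain ⟨hmot, hprof⟩ :=
        IsSolutionOn.isMotion hV₀ hr hrk hs hF.width_pos heq hlt measurableSet_Ici hu
      obtain ⟨τ, ha, hb⟩ := hmot.exists_phase hF hL hper hβ hU
      obtain ⟨ε, hε, hεle⟩ := hU.exists_pos_le_width
      refine ⟨hmot.eventually_speed_pos hF hper hβ hU ha hb, τ, ?_, ha, hb⟩
      have hunif : TendstoUniformly (fun t x => profile V₀ (κ * Real.sin α) r (a t) (b t) x -
          profile V₀ (κ * Real.sin α) r (A (t + τ)) (B (t + τ)) x) (fun _ => 0) atTop :=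
        tendstoUniformly_profile_sub hr hε
          ((eventually_ge_atTop 0).mono fun t ht => hmot.width_le t ht)
          (fun t => ⟨hεle (t + τ), hU.motion.width_le (t + τ) trivial⟩) ha hb
      intro v hv
      filter_upwards [hunif v hv, eventually_ge_atTop 0] with t h1 ht x
      rw [hprof t ht]
      exact h1 x
  · intro M m hm hMm
    obtain ⟨δ, hδ, C, hC⟩ := exists_sticking_bound hF hS hm hMm
    refine ⟨δ, hδ, C, ?_⟩
    rintro β L hL hLδ hper ⟨K, hβ⟩ hM hm u a b hu
    exact hC β L hL hLδ hper hβ.continuous hM hm a b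
      (IsSolutionOn.isMotion hV₀ hr hrk hs hF.width_pos heq hlt measurableSet_Ici hu).1
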